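/- Conventions. Let $M$ be a (finite) oriented matroid on $E$. For a basis $B$ and $e\in E\setminus B$, the fundamental circuit $C(B;e)$ is the circuit contained in $B\cup e$; for $b\in B$, the fundamental cocircuit $C^*(B;b)$ is the cocircuit whose support is the complement of the closure of $B\setminus b$; as signed sets they are taken positive on $e$, resp. on $b$. For $A\subseteq E$, $-_AM$ is the oriented matroid obtained by reorienting $A$; $M$ is considered to have $2^{|E|}$ reorientations, one for each $A$. A generic extension of $M$ with respect to $f\notin E$ is an oriented matroid $M_f$ on $E\cup f$ with $M_f\backslash f=M$ whose circuits containing $f$ are exactly the sets $B\cup f$, $B$ a basis of $M$. Its signature $\sigma^*$ maps the support $D$ of a cocircuit of $M$ to the signed cocircuit of $M$ with support $D$ whose corresponding cocircuit in $M_f$, with support $D\cup f$, is positive on $f$. A generic lifting of $M$ with respect to $g\notin E$ is an oriented matroid $M_g$ on $E\cup g$ with $M_g/g=M$ whose cocircuits containing $g$ are exactly the sets $(E\setminus B)\cup g$, $B$ a basis of $M$. Its signature $\sigma$ maps the support $C$ of a circuit of $M$ to the signed circuit of $M$ with support $C$ whose corresponding circuit in $M_g$, with support $C\cup g$, is positive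 on $g$. A reorientation $-_AM$ is $(\sigma^*,\sigma)$-compatible if for every positive cocircuit $D$ of $-_AM$ the corresponding cocircuit $D\cup f$ of $-_AM_f$ is positive on $f$, and for every positive circuit $C$ of $-_AM$ the corresponding circuit $C\cup g$ of $-_AM_g$ is positive on $g$. A generic extension-lifting of $M$ with respect to $(f,g)$, $f\neq g$, given by $(\sigma^*,\sigma)$, is an oriented matroid $\overline M$ on $E\cup\{f,g\}$ with $\overline M/g=M_f$ and $\overline M\backslash f=M_g$ that is a generic extension of $\overline M\backslash f$ with respect to $f$ and a generic lifting of $\overline M/g$ with respect to $g$. It is compliant if no signed cocircuit of $\overline M$ is positive on $g$ and negative on $f$. For an oriented matroid $N$ with linearly ordered ground set, $N$ is bounded if it has no positive circuit and all its positive cocircuits contain the smallest element. A basis $B$ of $N$ is fully optimal if for every $e\notin B$ the signs in $C(B;e)$ of $e$ and of $\min C(B;e)$ are opposite and, for every $b\in B$ other than the smallest element of the ground set, the signs in $C^*(B;b)$ of $b$ and of $\min C^*(B;b)$ are opposite. If $N$ is bounded, $\alpha(N)$ denotes its fully optimal basis. Theorem. Let $M$ be an oriented matroid on $E$, let $f\ne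 g$ be not in $E$, and let $\sigma^*$ be the signature of a generic extension $M_f$ of $M$ with respect to $f$ and $\sigma$ the signature of a generic lifting $M_g$ of $M$ with respect to $g$. (1) For a basis $B$ of $M$, let $O(B)$ be the reorientation of $M$ in which each $e\notin B$ is reoriented if and only if it is negative in $\sigma(C(B;e))$, and each $e\in B$ is reoriented if and only if it is negative in $\sigma^*(C^*(B;e))$. Then $B\mapsto O(B)$ is a bijection from the set of bases of $M$ onto the set of $(\sigma^*,\sigma)$-compatible reorientations of $M$. (2) There exists a compliant generic extension-lifting of $M$ with respect to $(f,g)$ given by $(\sigma^*,\sigma)$. Let $\overline M$ be any such, with any linear ordering such that $g<f<e$ for all $e\in E$. Then, for every $(\sigma^*,\sigma)$-compatible reorientation $-_AM$, the oriented matroid $-_{fg}-_A\overline M$ is bounded and has exactly one fully optimal basis, and $$-_AM\mapsto \alpha(-_{fg}-_A\overline M)\setminus g$$ is a bijection from the set of $(\sigma^*,\sigma)$-compatible reorientations of $M$ onto the set of bases of $M$. It is the inverse of the bijection $B\mapsto O(B)$ of (1). -/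

import Mathlib

open Set Function

/-- A (finite) oriented matroid on the set `E`: a matroid together with a family of signed circuits
satisfying the circuit axioms. A signed subset is a map to the signs `-1, 0, 1`,
and its support is the underlying unsigned set. The supports of the signed circuits are exactly the
circuits of the underlying matroid, each of them carries exactly two opposite signed circuits, and
signed circuits satisfy (weak, signed) elimination. -/
structure OrientedMatroid (α : Type*) extends Matroid α where
  ground_finite : E.Finite
  IsSignedCircuit : (α → SignType) → Prop
  support_isCircuit : ∀ X, IsSignedCircuit X → toMatroid.IsCircuit (support X)
  exists_signing : ∀ C, toMatroid.IsCircuit C → ∃ X, IsSignedCircuit X ∧ support X = C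
  neg_signed : ∀ X, IsSignedCircuit X → IsSignedCircuit (-X)
  eq_or_eq_neg : ∀ X Y, IsSignedCircuit X → IsSignedCircuit Y → support X = support Y →
    X = Y ∨ X = -Y
  elimination : ∀ X Y e, IsSignedCircuit X → IsSignedCircuit Y → X ≠ -Y →
    X e ≠ 0 → Y e = -X e →
    ∃ Z, IsSignedCircuit Z ∧ Z e = 0 ∧ ∀ x, Z x ≠ 0 → Z x = X x ∨ Z x = Y x

namespace OrientedMatroid

variable {α : Type*}

/-- Orthogonality of signed subsets: either the supports are disjoint, or the signs
agree somewhere and disagree somewhere. -/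
def Orthogonal (X Y : α → SignType) : Prop :=
  (∃ e, X e * Y e = 1) ↔ (∃ e, X e * Y e = -1)

/-- The signed cocircuits: the signings of the cocircuits of the underlying matroid
that are orthogonal to all signed circuits. -/
def IsSignedCocircuit (M : OrientedMatroid α) (Y : α → SignType) : Prop :=
  M.IsCocircuit (support Y) ∧ ∀ X, M.IsSignedCircuit X → Orthogonal X Y

/-- A signed subset without negative element. -/
def Positive (X : α → SignType) : Prop := ∀ e, X e ≠ -1

open Classical in
/-- Change the sign of the elements of `A` in a signed subset. -/
noncomputable def flip (A : Set α) (X : α → SignType) : α → SignType :=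
  fun e => if e ∈ A then -X e else X e

theorem support_flip (A : Set α) (X : α → SignType) : support (flip A X) = support X := by
  ext e
  by_cases h : e ∈ A <;> simp [flip, h]

theorem flip_flip (A : Set α) (X : α → SignType) : flip A (flip A X) = X := by
  funext e
  by_cases h : e ∈ A <;> simp [flip, h]

theorem flip_neg (A : Set α) (X : α → SignType) : flip A (-X) = -flip A X := by
  funext e
  by_cases h : e ∈ A <;> simp [flip, h]

/-- The reorientation `-_A M`. -/
noncomputable def reorient (M : OrientedMatroid α) (A : Set α) : OrientedMatroid α where
  toMatroid := M.toMatroid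
  ground_finite := M.ground_finite
  IsSignedCircuit X := M.IsSignedCircuit (flip A X)
  support_isCircuit X hX := by
    have h := M.support_isCircuit _ hX
    rwa [support_flip] at h
  exists_signing C hC := by
    obtain ⟨X, hX, hXC⟩ := M.exists_signing C hC
    exact ⟨flip A X, by rwa [flip_flip], by rwa [support_flip]⟩
  neg_signed X hX := by
    rw [flip_neg]
    exact M.neg_signed _ hX
  eq_or_eq_neg X Y hX hY h := by
    rcases M.eq_or_eq_neg _ _ hX hY (by rwa [support_flip, support_flip]) with h | h
    · left
      rw [← flip_flip A X, h, flip_flip]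
    · right
      rw [← flip_flip A X, h, flip_neg, flip_flip]
  elimination X Y e hX hY hne h0 he := by
    obtain ⟨Z, hZ, hZe, hZ'⟩ := M.elimination (flip A X) (flip A Y) e hX hY
      (fun h => hne (by rw [← flip_flip A X, h, flip_neg, flip_flip]))
      (by by_cases h : e ∈ A <;> simpa [flip, h] using h0)
      (by by_cases h : e ∈ A <;> simp [flip, h, he])
    refine ⟨flip A Z, by rwa [flip_flip], ?_, fun x hx => ?_⟩
    · by_cases h : e ∈ A <;> simpa [flip, h] using hZe
    · by_cases h : x ∈ A
      · have h1 : Z x ≠ 0 := by simpa [flip, h] using hx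
        rcases hZ' x h1 with h2 | h2
        · left
          simp [flip, h, h2]
        · right
          simp [flip, h, h2]
      · have h1 : Z x ≠ 0 := by simpa [flip, h] using hx
        rcases hZ' x h1 with h2 | h2
        · left
          simpa [flip, h] using h2
        · right
          simpa [flip, h] using h2

/-- `M` is the deletion `N \ f`: the signed circuits of `M` are the signed circuits of `N`
that do not contain `f`. -/
def IsDeletion (N : OrientedMatroid α) (f : α) (M : OrientedMatroid α) : Prop :=
  M.toMatroid = N.toMatroid.delete {f} ∧
    ∀ X, M.IsSignedCircuit X ↔ N.IsSignedCircuit X ∧ X f = 0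

open Classical in
/-- The signed subset that has sign `s` on `f` and agrees with `X` elsewhere. -/
noncomputable def withSign (X : α → SignType) (f : α) (s : SignType) : α → SignType :=
  Function.update X f s

/-- `M` is the contraction `N / g`: the signed circuits of `M` are the restrictions of the signed
circuits of `N` whose support is a circuit of the contracted matroid. -/
def IsContraction (N : OrientedMatroid α) (g : α) (M : OrientedMatroid α) : Prop :=
  M.toMatroid = N.toMatroid.contract {g} ∧
    ∀ Z, M.IsSignedCircuit Z ↔
      M.IsCircuit (support Z) ∧ ∃ X, N.IsSignedCircuit X ∧ Z = withSign X g 0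

/-- `N` is a generic extension of `M` with respect to `f`: `N \ f = M`, and the circuits of `N`
containing `f` are the sets `B ∪ f` where `B` is a basis of `M`. -/
def IsGenericExtension (M : OrientedMatroid α) (f : α) (N : OrientedMatroid α) : Prop :=
  N.IsDeletion f M ∧
    ∀ C, (N.IsCircuit C ∧ f ∈ C) ↔ ∃ B, M.IsBase B ∧ C = insert f B

/-- `N` is a generic lifting of `M` with respect to `g`: `N / g = M`, and the cocircuits of `N`
containing `g` are the sets `(E \ B) ∪ g` where `B` is a basis of `M`. -/
def IsGenericLifting (M : OrientedMatroid α) (g : α) (N : OrientedMatroid α) : Prop :=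
  N.IsContraction g M ∧
    ∀ D, (N.IsCocircuit D ∧ g ∈ D) ↔ ∃ B, M.IsBase B ∧ D = insert g (M.E \ B)

/-- The signature `σ*` of a generic extension `N` of `M` with respect to `f`:
`σ*(D)` is the signed cocircuit of `M` with support `D` whose corresponding cocircuit in `N`,
with support `D ∪ f`, has a positive sign for `f`. -/
noncomputable def extensionSignature (M : OrientedMatroid α) (f : α) (N : OrientedMatroid α)
    (D : Set α) : α → SignType :=
  Classical.epsilon fun Y =>
    M.IsSignedCocircuit Y ∧ support Y = D ∧ N.IsSignedCocircuit (withSign Y f 1)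

/-- The signature `σ` of a generic lifting `N` of `M` with respect to `g`:
`σ(C)` is the signed circuit of `M` with support `C` whose corresponding circuit in `N`,
with support `C ∪ g`, has a positive sign for `g`. -/
noncomputable def liftingSignature (M : OrientedMatroid α) (g : α) (N : OrientedMatroid α)
    (C : Set α) : α → SignType :=
  Classical.epsilon fun X =>
    M.IsSignedCircuit X ∧ support X = C ∧ N.IsSignedCircuit (withSign X g 1)

/-- The set `A` such that `O(B) = -_A M`: the elements `e ∉ B` that are negative in `σ(C(B;e))`
and the elements `e ∈ B` that are negative in `σ*(C*(B;e))`. -/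
def basisReorientation (M : OrientedMatroid α) (σs σ : Set α → α → SignType)
    (B : Set α) : Set α :=
  {e | e ∈ M.E ∧ ((e ∉ B ∧ σ (M.fundCircuit e B) e = -1) ∨
    (e ∈ B ∧ σs (M.fundCocircuit e B) e = -1))}

/-- `-_A M` is compatible with the extension `N` of `M` with respect to `f`: for every positive
cocircuit `D` of `-_A M`, the corresponding cocircuit `D ∪ f` of `-_A N` is positive on `f`. -/
def CompatibleExtension (M : OrientedMatroid α) (f : α) (N : OrientedMatroid α)
    (A : Set α) : Prop :=
  ∀ D, (M.reorient A).IsSignedCocircuit D → Positive D →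
    (N.reorient A).IsSignedCocircuit (withSign D f 1)

/-- `-_A M` is compatible with the lifting `N` of `M` with respect to `g`: for every positive
circuit `C` of `-_A M`, the corresponding circuit `C ∪ g` of `-_A N` is positive on `g`. -/
def CompatibleLifting (M : OrientedMatroid α) (g : α) (N : OrientedMatroid α)
    (A : Set α) : Prop :=
  ∀ C, (M.reorient A).IsSignedCircuit C → Positive C →
    (N.reorient A).IsSignedCircuit (withSign C g 1)

/-- The `(σ*, σ)`-compatible reorientations of `M`, for the signatures `σ*` of the generic
extension `Mf` with respect to `f` and `σ` of the generic lifting `Mg` with respect to `g`.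
A reorientation `-_A M` is given by the subset `A` of the ground set. -/
def compatibleReorientations (M : OrientedMatroid α) (f : α) (Mf : OrientedMatroid α)
    (g : α) (Mg : OrientedMatroid α) : Set (Set α) :=
  {A | A ⊆ M.E ∧ M.CompatibleExtension f Mf A ∧ M.CompatibleLifting g Mg A}

/-- `N` is a generic extension-lifting of `M` with respect to `(f, g)`, given by the generic
extension `Mf` and the generic lifting `Mg` of `M`: `N / g = Mf`, `N \ f = Mg`, and `N` is both a
generic extension of `N \ f` and a generic lifting of `N / g`. -/
def IsGenericExtensionLifting (f : α) (Mf : OrientedMatroid α) (g : α) (Mg : OrientedMatroid α)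
    (N : OrientedMatroid α) : Prop :=
  Mg.IsGenericExtension f N ∧ Mf.IsGenericLifting g N

/-- There is no vertex (signed cocircuit) in the positive side of `g` and negative side of `f`. -/
def Compliant (f g : α) (N : OrientedMatroid α) : Prop :=
  ∀ Y, N.IsSignedCocircuit Y → ¬ (Y g = 1 ∧ Y f = -1)

/-- An ordered oriented matroid is bounded if it is acyclic (no positive circuit) and
all its positive cocircuits contain the smallest element. -/
def Bounded [LinearOrder α] (N : OrientedMatroid α) : Prop :=
  (∀ X, N.IsSignedCircuit X → ¬ Positive X) ∧
    ∀ Y, N.IsSignedCocircuit Y → Positive Y → ∃ p, IsLeast N.E p ∧ Y p ≠ 0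

/-- Fully optimal bases of an ordered oriented matroid: for every `e ∉ B`, the signs in `C(B;e)` of
`e` and of the smallest element of `C(B;e)` are opposite, and, for every `b ∈ B` other than the
smallest element of the ground set, the signs in `C*(B;b)` of `b` and of the smallest element
of `C*(B;b)` are opposite. -/
def IsFullyOptimal [LinearOrder α] (N : OrientedMatroid α) (B : Set α) : Prop :=
  N.IsBase B ∧
    (∀ e ∈ N.E \ B, ∃ X, N.IsSignedCircuit X ∧ support X = N.fundCircuit e B ∧ X e = 1 ∧
      ∃ m, IsLeast (support X) m ∧ X m = -1) ∧
    (∀ b ∈ B, ¬ IsLeast N.E b → ∃ Y, N.IsSignedCocircuit Y ∧ support Y = N.fundCocircuit b B ∧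
      Y b = 1 ∧ ∃ m, IsLeast (support Y) m ∧ Y m = -1)

/-- `α(N)`: the fully optimal basis of a bounded ordered oriented matroid. -/
noncomputable def fullyOptimalBasis [LinearOrder α] (N : OrientedMatroid α) : Set α :=
  Classical.epsilon fun B => N.IsFullyOptimal B

end OrientedMatroid

namespace OrientedMatroid
variable {α : Type*}

/-! ### Orthogonality of signed subsets -/

/-! For a basis B take the signed circuit X of M_f on B ∪ f with X f = -1 and the signed cocircuit Y
of M_g on (E \ B) ∪ g with Y g = -1 (`IsBasisSigning`). Orthogonality with extended fundamental
cocircuits and lifted fundamental circuits shows that X gives the signs of σ*(C*(B;e)) at e ∈ B and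
Y those of σ(C(B;e)) at e ∉ B. So O(B) = -_A M means that the sign vector ε of A (-1 on A, 1
elsewhere) is X on B and Y on E \ B. Compatibility of A means that no circuit of M lifting with sign
-1 on g, and no cocircuit of M extending with sign -1 on f, is conformal to ε.

Part (1) is then a play with orthogonality. A forbidden circuit conformal to ε would agree with Y
off B and have product 1 with Y at g, so O(B) is compatible; dually for cocircuits and X. If two
bases gave the same ε, eliminating f between X₁ and -X₂ would give a circuit of M whose lift
contradicts Y₁ or Y₂, according to its sign on g (`eq_of_agree`). Surjectivity is a
deletion-contraction induction with the same case analysis as the painting lemma, in which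
injectivity settles the one remaining case (`exists_basis_of_compatible`).

In part (2) compliance forces Y to extend with -1 on f, and then X to extend with 1 on g. After the
reorientations by A = O(B) and {f, g}, the cocircuit on Y is positive with complement B, which
excludes positive circuits; X is positive in M_f, which excludes positive cocircuits missing g. As g
< f are the two smallest elements, a fully optimal basis must be B ∪ g, and the optimality
conditions say exactly that ε comes from B (`isFullyOptimal_iff`).

For existence, the free extension of M_g is signed as if f were replaced by g plus an infinitesimal
multiple of f. Only orthogonality of the proposed circuits and cocircuits has to be checked, since
by the painting lemma orthogonal signatures satisfy elimination (`ofOrthogonalPair`). Conversely,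
oriented matroids being given by circuits alone, signed cocircuits must be shown to exist
(`exists_signedCocircuit`). -/

theorem Orthogonal.symm {X Y : α → SignType} (h : Orthogonal X Y) : Orthogonal Y X := by
  simpa only [Orthogonal, mul_comm] using h

theorem Orthogonal.neg_right {X Y : α → SignType} (h : Orthogonal X Y) : Orthogonal X (-Y) := by
  unfold Orthogonal at *
  simp only [Pi.neg_apply, mul_neg, neg_eq_iff_eq_neg, neg_neg]
  exact h.symm

theorem Orthogonal.neg_left {X Y : α → SignType} (h : Orthogonal X Y) : Orthogonal (-X) Y :=
  h.symm.neg_right.symm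

theorem orthogonal_neg_left {X Y : α → SignType} : Orthogonal (-X) Y ↔ Orthogonal X Y :=
  ⟨fun h => by simpa using h.neg_left, fun h => h.neg_left⟩

theorem orthogonal_neg_right {X Y : α → SignType} : Orthogonal X (-Y) ↔ Orthogonal X Y :=
  ⟨fun h => by simpa using h.neg_right, fun h => h.neg_right⟩

theorem orthogonal_of_exists {X Y : α → SignType} (h₁ : ∃ e, X e * Y e = 1)
    (h₂ : ∃ e, X e * Y e = -1) : Orthogonal X Y :=
  iff_of_true h₁ h₂

theorem Orthogonal.mul_eq_zero {X Y : α → SignType} (h : Orthogonal X Y)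
    (hn : ∀ e, X e * Y e ≠ -1) (e : α) : X e * Y e = 0 := by
  have h1 : X e * Y e ≠ 1 := fun h1 => by
    obtain ⟨x, hx⟩ := h.1 ⟨e, h1⟩
    exact hn x hx
  have h2 := hn e
  generalize X e * Y e = s at *
  revert h1 h2
  revert s
  decide

theorem Orthogonal.exists_of_mul_eq_neg {X Y : α → SignType} (h : Orthogonal X Y) {e : α}
    (he : X e * Y e ≠ 0) : ∃ x, X x * Y x = - (X e * Y e) := by
  rcases SignType.trichotomy (X e * Y e) with h1 | h1 | h1
  · rw [h1, neg_neg]; exact h.2 ⟨e, h1⟩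
  · exact absurd h1 he
  · rw [h1]; exact h.1 ⟨e, h1⟩

/-- The main tool for computing signs: a nonzero product at one of two possible common elements can
only be compensated at the other. If both products vanish the equation reads 0 = 0, so a and b need
not lie in the supports. -/
theorem Orthogonal.eq_neg_of_pair {X Y : α → SignType} (h : Orthogonal X Y) {a b : α}
    (hab : ∀ x, X x ≠ 0 → Y x ≠ 0 → x = a ∨ x = b) : X a * Y a = - (X b * Y b) := by
  have key : ∀ {u v : α}, (∀ x, X x ≠ 0 → Y x ≠ 0 → x = u ∨ x = v) → X u * Y u ≠ 0 →
      X u * Y u = - (X v * Y v) := by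
    intro u v huv hu
    obtain ⟨x, hx⟩ := h.exists_of_mul_eq_neg hu
    have hx0 : X x * Y x ≠ 0 := by rw [hx]; simpa using hu
    rcases huv x (left_ne_zero_of_mul hx0) (right_ne_zero_of_mul hx0) with rfl | rfl
    · exfalso
      generalize X x * Y x = s at *
      revert s; decide
    · rw [hx, neg_neg]
  by_cases ha : X a * Y a = 0
  · by_cases hb : X b * Y b = 0
    · simp [ha, hb]
    · have := key (fun x h1 h2 => (hab x h1 h2).symm) hb
      rw [this, neg_neg]
  · exact key hab ha

theorem sign_mul_self {s : SignType} (h : s ≠ 0) : s * s = 1 := by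
  revert s; decide

theorem sign_eq_of_mul_eq_one {s t : SignType} (h : s * t = 1) : s = t := by
  revert s t; decide

theorem sign_eq_or_eq_neg {s t : SignType} (hs : s ≠ 0) (ht : t ≠ 0) : s = t ∨ s = -t := by
  revert s t; decide

/-! ### Orthogonal pairs of signatures -/

/-- Signatures of the circuits and of the cocircuits of a finite matroid that are orthogonal to
each other. -/
structure IsOrthogonalPair (M : Matroid α) (C D : (α → SignType) → Prop) : Prop where
  ground_finite : M.E.Finite
  isCircuit : ∀ X, C X → M.IsCircuit (support X)
  isCocircuit : ∀ Y, D Y → M.IsCocircuit (support Y)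
  exists_circuit : ∀ K, M.IsCircuit K → ∃ X, C X ∧ support X = K
  exists_cocircuit : ∀ K, M.IsCocircuit K → ∃ Y, D Y ∧ support Y = K
  neg_circuit : ∀ X, C X → C (-X)
  neg_cocircuit : ∀ Y, D Y → D (-Y)
  orthogonal : ∀ X Y, C X → D Y → Orthogonal X Y

namespace IsOrthogonalPair

variable {M : Matroid α} {C D : (α → SignType) → Prop}

theorem dual (h : IsOrthogonalPair M C D) : IsOrthogonalPair M✶ D C where
  ground_finite := h.ground_finite
  isCircuit := h.isCocircuit
  isCocircuit X hX := by simpa using h.isCircuit X hX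
  exists_circuit := h.exists_cocircuit
  exists_cocircuit K hK := h.exists_circuit K (by simpa using hK)
  neg_circuit := h.neg_cocircuit
  neg_cocircuit := h.neg_circuit
  orthogonal X Y hX hY := (h.orthogonal Y X hY hX).symm

end IsOrthogonalPair

/-- The unsigned painting lemma, decided by whether f lies in the closure of S. -/
theorem _root_.Matroid.exists_isCircuit_or_isCocircuit (M : Matroid α) (S : Set α) {f : α}
    (hf : f ∈ M.E) (hfS : f ∉ S) :
    (∃ K, M.IsCircuit K ∧ f ∈ K ∧ K ⊆ insert f S) ∨
      ∃ K, M.IsCocircuit K ∧ f ∈ K ∧ Disjoint K S := by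
  by_cases hcl : f ∈ M.closure S
  · left
    obtain ⟨K, hKS, hK, hfK⟩ := Matroid.exists_isCircuit_of_mem_closure hcl hfS
    exact ⟨K, hK, hfK, hKS⟩
  · right
    obtain ⟨I, hI⟩ := M.exists_isBasis' S
    have hfI : f ∉ I := fun h => hfS (hI.subset h)
    have hins : M.Indep (insert f I) := by
      rw [hI.indep.insert_indep_iff_of_notMem hfI, hI.closure_eq_closure]
      exact ⟨hf, hcl⟩
    obtain ⟨K, hK, hKI⟩ := hins.exists_isCocircuit_inter_eq_mem (mem_insert f I)
    have hfK : f ∈ K := (hKI.symm.subset (mem_singleton f)).1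
    refine ⟨K, hK, hfK, Set.disjoint_left.2 fun s hsK hsS => ?_⟩
    have hsI : s ∉ I := fun hsI => by
      have : s ∈ ({f} : Set α) := hKI.subset ⟨hsK, mem_insert_of_mem _ hsI⟩
      rw [mem_singleton_iff] at this
      exact hfI (this ▸ hsI)
    have hscl : s ∈ M.closure I := by
      rw [hI.closure_eq_closure]
      exact M.mem_closure_of_mem' hsS (hK.subset_ground hsK)
    obtain ⟨J, hJI, hJ, hsJ⟩ := Matroid.exists_isCircuit_of_mem_closure hscl hsI
    apply hJ.inter_isCocircuit_ne_singleton hK (e := s)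
    apply Subset.antisymm
    · rintro x ⟨hxJ, hxK⟩
      rcases hJI hxJ with rfl | hxI
      · rfl
      · have : x ∈ ({f} : Set α) := hKI.subset ⟨hxK, mem_insert_of_mem _ hxI⟩
        rw [mem_singleton_iff] at this
        exact absurd (this ▸ hxI) hfI
    · rintro x rfl
      exact ⟨hsJ, hsK⟩

namespace IsOrthogonalPair

variable {M : Matroid α} {C D : (α → SignType) → Prop}

theorem exists_circuit_sign (h : IsOrthogonalPair M C D) {K : Set α} (hK : M.IsCircuit K) {f : α}
    (hf : f ∈ K) {s : SignType} (hs : s ≠ 0) : ∃ X, C X ∧ support X = K ∧ X f = s := by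
  obtain ⟨X, hX, rfl⟩ := h.exists_circuit K hK
  rcases sign_eq_or_eq_neg (mem_support.1 hf) hs with h1 | h1
  · exact ⟨X, hX, rfl, h1⟩
  · exact ⟨-X, h.neg_circuit X hX, by ext; simp, by simp [h1]⟩

theorem exists_cocircuit_sign (h : IsOrthogonalPair M C D) {K : Set α} (hK : M.IsCocircuit K)
    {f : α} (hf : f ∈ K) {s : SignType} (hs : s ≠ 0) : ∃ X, D X ∧ support X = K ∧ X f = s :=
  h.dual.exists_circuit_sign hK hf hs

/-- The painting lemma: the elements of `S` are free in circuits and forbidden in cocircuits, those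
of `U` have a prescribed sign, and all others except `f` are forbidden in circuits and free in
cocircuits. -/
theorem painting (h : IsOrthogonalPair M C D) (T : α → SignType) (hT : ∀ x, T x ≠ 0) {U : Set α}
    (hU : U.Finite) {f : α} (hf : f ∈ M.E) (hfU : f ∉ U) (S : Set α) (hfS : f ∉ S)
    (hSU : ∀ x ∈ U, x ∉ S) :
    (∃ Z, C Z ∧ Z f = T f ∧ (∀ x, x ∉ S → x ∉ U → x ≠ f → Z x = 0) ∧
      ∀ x ∈ U, Z x = 0 ∨ Z x = T x) ∨
    (∃ Y, D Y ∧ Y f = T f ∧ (∀ x ∈ S, Y x = 0) ∧ ∀ x ∈ U, Y x = 0 ∨ Y x = T x) := by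
  induction U, hU using Set.Finite.induction_on generalizing S with
  | empty =>
    rcases M.exists_isCircuit_or_isCocircuit S hf hfS with ⟨K, hK, hfK, hKS⟩ | ⟨K, hK, hfK, hKS⟩
    · left
      obtain ⟨Z, hZ, rfl, hZf⟩ := h.exists_circuit_sign hK hfK (hT f)
      refine ⟨Z, hZ, hZf, fun x hxS _ hxf => ?_, by simp⟩
      by_contra hx
      rcases hKS (mem_support.2 hx) with h1 | h1
      · exact hxf h1
      · exact hxS h1
    · right
      obtain ⟨Y, hY, rfl, hYf⟩ := h.exists_cocircuit_sign hK hfK (hT f)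
      refine ⟨Y, hY, hYf, fun x hxS => ?_, by simp⟩
      by_contra hx
      exact Set.disjoint_left.1 hKS (mem_support.2 hx) hxS
  | @insert e U heU _ ih =>
    rw [mem_insert_iff, not_or] at hfU
    have heS : e ∉ S := hSU e (mem_insert _ _)
    have hSU' : ∀ x ∈ U, x ∉ S := fun x hx => hSU x (mem_insert_of_mem _ hx)
    -- The element e is tried first as forbidden in circuits, then as forbidden in cocircuits. If no
    -- outcome respects the sign at e, the circuit Z of the second trial and the cocircuit Y of the
    -- first both have sign -T e there; their products are then never -1 although the product at f
    -- is 1.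
    rcases ih hfU.2 S hfS hSU' with ⟨Z, hZ, hZf, hZ0, hZU⟩ | ⟨Y, hY, hYf, hY0, hYU⟩
    · left
      refine ⟨Z, hZ, hZf, fun x h1 h2 h3 => hZ0 x h1 (fun h => h2 (mem_insert_of_mem _ h)) h3, ?_⟩
      rintro x (rfl | hx)
      · exact Or.inl (hZ0 x heS heU (Ne.symm hfU.1))
      · exact hZU x hx
    rcases ih hfU.2 (insert e S) (by simp [hfU.1, hfS])
      (by rintro x hx (rfl | h); exacts [heU hx, hSU' x hx h]) with
      ⟨Z, hZ, hZf, hZ0, hZU⟩ | ⟨Y', hY', hYf', hY0', hYU'⟩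
    · by_cases hZe : Z e = 0 ∨ Z e = T e
      · left
        refine ⟨Z, hZ, hZf, fun x h1 h2 h3 => hZ0 x ?_ (fun h => h2 (mem_insert_of_mem _ h)) h3, ?_⟩
        · rintro (rfl | h)
          · exact h2 (mem_insert _ _)
          · exact h1 h
        · rintro x (rfl | hx)
          · exact hZe
          · exact hZU x hx
      by_cases hYe : Y e = 0 ∨ Y e = T e
      · right
        refine ⟨Y, hY, hYf, hY0, ?_⟩
        rintro x (rfl | hx)
        · exact hYe
        · exact hYU x hx
      exfalso
      have horth := (h.orthogonal Z Y hZ hY).mul_eq_zero ?_ f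
      · rw [hZf, hYf, sign_mul_self (hT f)] at horth
        exact one_ne_zero horth
      intro x
      have hTx := hT x
      by_cases hxf : x = f
      · subst hxf
        rw [hZf, hYf, sign_mul_self hTx]; decide
      by_cases hxe : x = e
      · subst hxe
        generalize Z x = a, Y x = b, T x = c at *
        revert a b c; decide
      by_cases hxU : x ∈ U
      · have h1 := hZU x hxU
        have h2 := hYU x hxU
        generalize Z x = a, Y x = b, T x = c at *
        rcases h1 with rfl | rfl
        · simp
        · rcases h2 with rfl | rfl
          · simp
          · rw [sign_mul_self hTx]; decide
      by_cases hxS : x ∈ S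
      · simp [hY0 x hxS]
      · rw [hZ0 x (by rintro (h | h); exacts [hxe h, hxS h]) hxU hxf]; simp
    · right
      refine ⟨Y', hY', hYf', fun x hx => hY0' x (mem_insert_of_mem _ hx), ?_⟩
      rintro x (rfl | hx)
      · exact Or.inl (hY0' x (mem_insert _ _))
      · exact hYU' x hx

/-- A signed subset orthogonal to all cocircuits contains a conformal circuit through each of its
elements. -/
theorem exists_conformal (h : IsOrthogonalPair M C D) {X : α → SignType}
    (hX : ∀ Y, D Y → Orthogonal X Y) (hXE : support X ⊆ M.E) {f : α} (hf : X f ≠ 0) :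
    ∃ Z, C Z ∧ Z f = X f ∧ ∀ x, Z x = 0 ∨ Z x = X x := by
  classical
  -- The value 1 off the support of X is a filler: `painting` wants nonzero signs, but only those on
  -- the support are prescribed.
  rcases h.painting (fun x => if X x = 0 then 1 else X x)
    (by intro x; by_cases hx : X x = 0 <;> simp [hx])
    (U := support X \ {f}) (h.ground_finite.subset (sdiff_subset.trans hXE))
    (f := f) (hXE hf) (by simp) ∅ (by simp) (by simp) with
    ⟨Z, hZ, hZf, hZ0, hZU⟩ | ⟨Y, hY, hYf, -, hYU⟩
  · refine ⟨Z, hZ, by simpa [hf] using hZf, fun x => ?_⟩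
    by_cases hxf : x = f
    · subst hxf; right; simpa [hf] using hZf
    by_cases hx : X x = 0
    · left; exact hZ0 x (by simp) (by simp [hx]) hxf
    · simpa [hx] using hZU x ⟨hx, hxf⟩
  · exfalso
    have horth := (hX Y hY).mul_eq_zero ?_ f
    · rw [hYf, if_neg hf, sign_mul_self hf] at horth
      exact one_ne_zero horth
    intro x
    by_cases hx : X x = 0
    · simp [hx]
    have hYx : Y x = 0 ∨ Y x = X x := by
      by_cases hxf : x = f
      · subst hxf; right; simpa [hf] using hYf
      · simpa [hx] using hYU x ⟨hx, hxf⟩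
    rcases hYx with h1 | h1
    · simp [h1]
    · rw [h1, sign_mul_self hx]; decide

/-- A circuit Z conformal to X through e is orthogonal to Y, and the element of opposite product it
provides serves for X as well. Thus vectors and covectors are orthogonal even when they are not
circuits and cocircuits. -/
theorem orthogonal_of_forall (h : IsOrthogonalPair M C D) {X Y : α → SignType}
    (hX : ∀ Y, D Y → Orthogonal X Y) (hXE : support X ⊆ M.E) (hY : ∀ X, C X → Orthogonal X Y) :
    Orthogonal X Y := by
  have key : ∀ Y, (∀ X, C X → Orthogonal X Y) → (∃ e, X e * Y e = 1) → ∃ e, X e * Y e = -1 := by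
    rintro Y hY ⟨e, he⟩
    have hXe : X e ≠ 0 := by rintro h0; simp [h0] at he
    obtain ⟨Z, hZ, hZe, hZX⟩ := h.exists_conformal hX hXE hXe
    obtain ⟨x, hx⟩ := (hY Z hZ).1 ⟨e, by rw [hZe, he]⟩
    refine ⟨x, ?_⟩
    rcases hZX x with h1 | h1
    · simp [h1] at hx
    · rwa [← h1]
  refine ⟨key Y hY, fun hneg => ?_⟩
  obtain ⟨e, he⟩ := key (-Y) (fun X hX => (hY X hX).neg_right) 
    (hneg.imp fun e he => by rw [Pi.neg_apply, mul_neg, he, neg_neg])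
  rw [Pi.neg_apply, mul_neg] at he
  exact ⟨e, neg_injective he⟩

/-- Any two elements of a circuit are its whole intersection with some cocircuit, whose signs
determine the relation between the signs of the two elements. -/
theorem circuit_eq_or_eq_neg (h : IsOrthogonalPair M C D) {X Y : α → SignType} (hX : C X)
    (hY : C Y) (hXY : support X = support Y) : X = Y ∨ X = -Y := by
  have hXc := h.isCircuit X hX
  obtain ⟨e, he⟩ := hXc.nonempty
  have key : ∀ Y, C Y → support X = support Y → X e = Y e → X = Y := by
    intro Y hY hXY hXYe
    ext x
    by_cases hx : X x = 0
    · have : Y x = 0 := by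
        by_contra h0
        exact (hXY.symm.subset (mem_support.2 h0) : X x ≠ 0) hx
      rw [hx, this]
    by_cases hxe : x = e
    · rw [hxe, hXYe]
    have hind := hXc.sdiff_singleton_indep he
    obtain ⟨K, hK, hKX⟩ := hind.exists_isCocircuit_inter_eq_mem (e := x) ⟨hx, hxe⟩
    obtain ⟨W, hW, rfl⟩ := h.exists_cocircuit K hK
    have hpair : ∀ y, X y ≠ 0 → W y ≠ 0 → y = x ∨ y = e := by
      intro y hy hyW
      by_cases hye : y = e
      · exact Or.inr hye
      · left
        exact hKX.subset ⟨hyW, hy, hye⟩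
    have hWx : W x ≠ 0 := (hKX.symm.subset (mem_singleton x)).1
    have h1 := (h.orthogonal X W hX hW).eq_neg_of_pair hpair
    have h2 := (h.orthogonal Y W hY hW).eq_neg_of_pair
      fun y hy => hpair y (hXY.symm.subset (mem_support.2 hy))
    rw [hXYe, ← h2] at h1
    generalize X x = a, Y x = b, W x = c at *
    clear * - h1 hWx
    revert a b c; decide
  rcases sign_eq_or_eq_neg he (hXY.subset he : Y e ≠ 0) with h1 | h1
  · exact Or.inl (key Y hY hXY h1)
  · exact Or.inr (key (-Y) (h.neg_circuit Y hY) (by rw [hXY]; ext; simp) (by simp [h1]))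

theorem cocircuit_eq_or_eq_neg (h : IsOrthogonalPair M C D) {X Y : α → SignType} (hX : D X)
    (hY : D Y) (hXY : support X = support Y) : X = Y ∨ X = -Y :=
  h.dual.circuit_eq_or_eq_neg hX hY hXY

theorem saturate (h : IsOrthogonalPair M C D) : IsOrthogonalPair M C
    fun Y => M.IsCocircuit (support Y) ∧ ∀ X, C X → Orthogonal X Y where
  ground_finite := h.ground_finite
  isCircuit := h.isCircuit
  isCocircuit _ hY := hY.1
  exists_circuit := h.exists_circuit
  exists_cocircuit K hK := by
    obtain ⟨Y, hY, rfl⟩ := h.exists_cocircuit K hK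
    exact ⟨Y, ⟨hK, fun X hX => h.orthogonal X Y hX hY⟩, rfl⟩
  neg_circuit := h.neg_circuit
  neg_cocircuit Y hY :=
    ⟨by rw [show support (-Y) = support Y by ext; simp]; exact hY.1,
      fun X hX => (hY.2 X hX).neg_right⟩
  orthogonal X Y hX hY := hY.2 X hX

/-- Enlarging D to all cocircuit signings orthogonal to C keeps an orthogonal pair, in which a
support has only two signings; so D was already everything. -/
theorem cocircuit_of_orthogonal (h : IsOrthogonalPair M C D) {Y : α → SignType}
    (hY : M.IsCocircuit (support Y)) (hC : ∀ X, C X → Orthogonal X Y) : D Y := by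
  obtain ⟨W, hW, hWY⟩ := h.exists_cocircuit _ hY
  rcases h.saturate.cocircuit_eq_or_eq_neg ⟨hY, hC⟩
    ⟨h.isCocircuit W hW, fun X hX => h.orthogonal X W hX hW⟩ hWY.symm with rfl | rfl
  · exact hW
  · exact h.neg_cocircuit W hW

/-- Painting, with f in X but not in Y, the common elements of opposite sign (other than e) free in
circuits, e forbidden in circuits, and the remaining support elements carrying their sign. A
cocircuit outcome W has no negative product with X or Y off e. Orthogonality to X forces X e * W e =
-1, so Y e * W e = 1, and W is not orthogonal to Y. -/
theorem elimination (h : IsOrthogonalPair M C D) {X Y : α → SignType} (hX : C X)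
    (hY : C Y) (hne : X ≠ -Y) {e : α} (he : X e ≠ 0) (hYe : Y e = -X e) :
    ∃ Z, C Z ∧ Z e = 0 ∧ ∀ x, Z x ≠ 0 → Z x = X x ∨ Z x = Y x := by
  classical
  have hXc := h.isCircuit X hX
  have hnsub : ¬ support X ⊆ support Y := fun hsub => by
    have := hXc.eq_of_subset_isCircuit (h.isCircuit Y hY) hsub
    rcases h.circuit_eq_or_eq_neg hX hY this with h1 | h1
    · rw [← h1] at hYe
      generalize X e = s at *
      revert s; decide
    · exact hne h1
  obtain ⟨f, hfX, hfY⟩ := Set.not_subset.1 hnsub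
  rw [mem_support, not_not] at hfY
  have hfe : f ≠ e := by
    rintro rfl
    rw [hfY] at hYe
    exact he (by simpa using hYe.symm)
  have hXE := hXc.subset_ground
  have hYE := (h.isCircuit Y hY).subset_ground
  set T : α → SignType := fun x => if X x ≠ 0 then X x else if Y x ≠ 0 then Y x else 1 with hTdef
  set S : Set α := {x | X x ≠ 0 ∧ Y x = -X x ∧ x ≠ e} with hS
  rcases h.painting T (by intro x; simp only [hTdef]; split_ifs <;> simp_all)
    (U := ((support X ∪ support Y) \ S) \ {f, e})
    (h.ground_finite.subset (sdiff_subset.trans (sdiff_subset.trans (union_subset hXE hYE))))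
    (f := f) (hXE hfX) (by simp) S (by
      rintro ⟨-, h2, -⟩
      rw [hfY] at h2
      exact hfX (by simpa using h2.symm))
    (fun x hx => hx.1.2) with
    ⟨Z, hZ, hZf, hZ0, hZU⟩ | ⟨W, hW, hWf, hWS, hWU⟩
  · refine ⟨Z, hZ, hZ0 e (by simp [hS]) (by simp) hfe.symm, fun x hx => ?_⟩
    by_cases hxS : x ∈ S
    · rw [hxS.2.1]
      exact sign_eq_or_eq_neg hx hxS.1
    by_cases hxf : x = f
    · left; subst hxf
      rw [hZf]; simp only [hTdef]; rw [if_pos (mem_support.1 hfX)]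
    by_cases hxU : x ∈ ((support X ∪ support Y) \ S) \ {f, e}
    · have h1 := (hZU x hxU).resolve_left hx
      rw [h1]; simp only [hTdef]
      split_ifs with h2 h3
      · exact Or.inl rfl
      · exact Or.inr rfl
      · exact absurd hxU.1.1 (by simp_all)
    · exact absurd (hZ0 x hxS hxU hxf) hx
  · exfalso
    have hTX : ∀ x, X x ≠ 0 → T x = X x := fun x hx => by simp only [hTdef]; rw [if_pos hx]
    have hTY : ∀ x, Y x ≠ 0 → x ∉ S → x ≠ e → T x = Y x := by
      intro x hx hxS hxe
      by_cases hXx : X x = 0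
      · simp only [hTdef]; rw [if_neg (by simpa using hXx), if_pos hx]
      · rw [hTX x hXx]
        rcases sign_eq_or_eq_neg hx hXx with h1 | h1
        · exact h1.symm
        · exact absurd ⟨hXx, h1, hxe⟩ hxS
    have hWX : ∀ x, x ≠ e → X x * W x ≠ -1 := by
      intro x hxe
      by_cases hX0 : X x = 0
      · simp [hX0]
      by_cases hxS : x ∈ S
      · simp [hWS x hxS]
      have : W x = 0 ∨ W x = X x := by
        rw [← hTX x hX0]
        by_cases hxf : x = f
        · subst hxf; exact Or.inr hWf
        · exact hWU x ⟨⟨Or.inl hX0, hxS⟩, by simp [hxf, hxe]⟩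
      rcases this with h1 | h1
      · simp [h1]
      · rw [h1, sign_mul_self hX0]; decide
    have hWY : ∀ x, x ≠ e → Y x * W x ≠ -1 := by
      intro x hxe
      by_cases hY0 : Y x = 0
      · simp [hY0]
      by_cases hxS : x ∈ S
      · simp [hWS x hxS]
      have : W x = 0 ∨ W x = Y x := by
        rw [← hTY x hY0 hxS hxe]
        by_cases hxf : x = f
        · subst hxf; exact Or.inr hWf
        · exact hWU x ⟨⟨Or.inr hY0, hxS⟩, by simp [hxf, hxe]⟩
      rcases this with h1 | h1
      · simp [h1]
      · rw [h1, sign_mul_self hY0]; decide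
    have hXf1 : X f * W f = 1 := by rw [hWf, hTX f hfX, sign_mul_self hfX]
    obtain ⟨x, hx⟩ := (h.orthogonal X W hX hW).1 ⟨f, hXf1⟩
    have hxe : x = e := by
      by_contra hxe
      exact hWX x hxe hx
    subst hxe
    obtain ⟨y, hy⟩ := (h.orthogonal Y W hY hW).1 ⟨x, by rw [hYe, neg_mul, hx, neg_neg]⟩
    by_cases hyx : y = x
    · subst hyx
      rw [hYe, neg_mul, hx] at hy
      exact absurd hy (by decide)
    · exact hWY y hyx hy

end IsOrthogonalPair

/-- The oriented matroid of an orthogonal pair of signatures. -/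
def ofOrthogonalPair (M : Matroid α) (C D : (α → SignType) → Prop) (h : IsOrthogonalPair M C D) :
    OrientedMatroid α where
  toMatroid := M
  ground_finite := h.ground_finite
  IsSignedCircuit := C
  support_isCircuit := h.isCircuit
  exists_signing := h.exists_circuit
  neg_signed := h.neg_circuit
  eq_or_eq_neg _ _ hX hY := h.circuit_eq_or_eq_neg hX hY
  elimination _ _ _ hX hY hne he hYe := h.elimination hX hY hne he hYe

theorem ofOrthogonalPair_isSignedCocircuit_iff {M : Matroid α} {C D : (α → SignType) → Prop}
    (h : IsOrthogonalPair M C D) {Y : α → SignType} :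
    (ofOrthogonalPair M C D h).IsSignedCocircuit Y ↔ D Y := by
  exact ⟨fun hY => h.cocircuit_of_orthogonal hY.1 hY.2,
    fun hY => ⟨h.isCocircuit Y hY, fun X hX => h.orthogonal X Y hX hY⟩⟩

end OrientedMatroid

namespace OrientedMatroid
variable {α : Type*}

/-! ### Every cocircuit can be signed -/

theorem _root_.Matroid.IsCocircuit.notMem_closure_compl {M : Matroid α} {D : Set α}
    (hD : M.IsCocircuit D) {e : α} (he : e ∈ D) : e ∉ M.closure (M.E \ D) := by
  intro hcl
  obtain ⟨C, hC, hCc, heC⟩ := Matroid.exists_isCircuit_of_mem_closure hcl (fun h => h.2 he)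
  refine hCc.inter_isCocircuit_ne_singleton hD (e := e) (Subset.antisymm ?_ ?_)
  · rintro x ⟨hxC, hxD⟩
    rcases hC hxC with h | h
    · exact h
    · exact absurd hxD h.2
  · rintro x rfl
    exact ⟨heC, he⟩

theorem _root_.Matroid.IsCocircuit.spanning_insert_compl {M : Matroid α} {D : Set α}
    (hD : M.IsCocircuit D) {e : α} (he : e ∈ D) : M.Spanning (insert e (M.E \ D)) := by
  rw [Matroid.isCocircuit_iff_minimal_compl_nonspanning] at hD
  by_contra hns
  have heE : M.E \ (D \ {e}) = insert e (M.E \ D) := by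
    have : e ∈ M.E := by
      by_contra heE
      have h2 := hD.2 (y := D \ {e}) (by
        have : M.E \ (D \ {e}) = M.E \ D := by
          ext x; by_cases hx : x = e <;> simp [hx, heE]
        simpa [this] using hD.1) sdiff_subset
      exact (h2 he).2 rfl
    ext x
    by_cases hx : x = e
    · simp [hx, this]
    · simp [hx]
  have h2 := hD.2 (y := D \ {e}) (by simpa [heE] using hns) sdiff_subset
  exact (h2 he).2 rfl

theorem _root_.Matroid.IsCocircuit.insert_isBase {M : Matroid α} {D I : Set α}
    (hD : M.IsCocircuit D) (hI : M.IsBasis I (M.E \ D)) {e : α} (he : e ∈ D) :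
    M.IsBase (insert e I) := by
  have heI : e ∉ I := fun h => (hI.subset h).2 he
  have hind : M.Indep (insert e I) := by
    rw [hI.indep.insert_indep_iff_of_notMem heI, hI.closure_eq_closure]
    exact ⟨hD.subset_ground he, hD.notMem_closure_compl he⟩
  have hsp := hD.spanning_insert_compl he
  refine hind.isBase_of_spanning ?_
  rw [Matroid.spanning_iff_closure_eq hind.subset_ground, Matroid.closure_insert_congr_right
    hI.closure_eq_closure]
  exact hsp.closure_eq

variable (M : OrientedMatroid α)

theorem eq_or_eq_neg_of_subset_insert {I : Set α} {e : α} {X Z : α → SignType}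
    (hI : M.Indep I) (hX : M.IsSignedCircuit X) (hZ : M.IsSignedCircuit Z)
    (hXI : support X ⊆ insert e I) (hZI : support Z ⊆ insert e I) : X = Z ∨ X = -Z := by
  apply M.eq_or_eq_neg _ _ hX hZ
  rw [(M.support_isCircuit X hX).eq_fundCircuit_of_subset hI hXI,
    (M.support_isCircuit Z hZ).eq_fundCircuit_of_subset hI hZI]

variable {M} {D : Set α}

theorem ne_zero_of_subset_basis (hD : M.IsCocircuit D) {I : Set α} (hI : M.IsBasis I (M.E \ D))
    {e₁ e₂ : α} (h1 : e₁ ∈ D) {X : α → SignType} (hX : M.IsSignedCircuit X)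
    (hXI : support X ⊆ insert e₂ (insert e₁ I)) : X e₂ ≠ 0 := by
  intro h0
  refine (M.support_isCircuit X hX).not_indep ((hD.insert_isBase hI h1).indep.subset ?_)
  intro x hx
  rcases hXI hx with rfl | h
  · exact absurd h0 hx
  · exact h

/-- If the signs were opposite at e₁ and equal at e₂, eliminating e₁ between X and Z, and e₂ between
X and -Z, would give two circuits. Neither can meet D in a single element, so both lie in I ∪ b'.
They agree at b and are opposite at b', but one independent set plus one element carries only one
circuit up to sign. -/
theorem ne_of_basis_exchange (hD : M.IsCocircuit D) {I : Set α} (hI : M.IsBasis I (M.E \ D))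
    {b b' : α} (hb : b ∈ I) (hb' : b' ∉ I) (hJ : M.IsBasis (insert b' (I \ {b})) (M.E \ D))
    {e₁ e₂ : α} (h1 : e₁ ∈ D) (h2 : e₂ ∈ D) {X Z : α → SignType}
    (hX : M.IsSignedCircuit X) (hXI : support X ⊆ insert e₂ (insert e₁ I))
    (hZ : M.IsSignedCircuit Z) (hZJ : support Z ⊆ insert e₂ (insert e₁ (insert b' (I \ {b}))))
    (hX1 : X e₁ = -Z e₁) : X e₂ ≠ Z e₂ := by
  intro hX2
  have hX1' : X e₁ ≠ 0 := ne_zero_of_subset_basis hD hI h2 hX (by rwa [insert_comm])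
  have hX2' : X e₂ ≠ 0 := ne_zero_of_subset_basis hD hI h1 hX hXI
  have hbD : b ∉ D := (hI.subset hb).2
  have hb'D : b' ∉ D := (hJ.subset (mem_insert _ _)).2
  have hbb' : b ≠ b' := by rintro rfl; exact hb' hb
  have hXb' : X b' = 0 := by
    by_contra h
    rcases hXI h with rfl | rfl | h
    exacts [hb'D h2, hb'D h1, hb' h]
  have hZb : Z b = 0 := by
    by_contra h
    rcases hZJ h with rfl | rfl | rfl | h
    exacts [hbD h2, hbD h1, hbb' rfl, h.2 rfl]
  have key : ∀ Z' : α → SignType, ∀ u v : α, u ∈ D → v ∈ D → M.IsSignedCircuit Z' →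
      support X ⊆ insert u (insert v I) → support Z' ⊆ insert u (insert v (insert b' (I \ {b}))) →
      X ≠ -Z' → X u ≠ 0 → Z' u = -X u → Z' b = 0 →
      ∃ W, M.IsSignedCircuit W ∧ support W ⊆ insert b' I ∧ W b = X b ∧ W b ≠ 0 ∧ W b' = Z' b' ∧
        W b' ≠ 0 := by
    intro Z' u v hu hv hZ' hXs hZs hne hXu hZu hZ'b
    obtain ⟨W, hW, hWu, hWx⟩ := M.elimination X Z' u hX hZ' hne hXu hZu
    have hsub : support W ⊆ insert v (insert b' I) := by
      intro x hx
      have hxu : x ≠ u := by rintro rfl; exact hx hWu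
      have : X x ≠ 0 ∨ Z' x ≠ 0 := by
        rcases hWx x hx with h | h
        · left; rwa [← h]
        · right; rwa [← h]
      rcases this with h | h
      · rcases hXs h with rfl | rfl | h
        · exact absurd rfl hxu
        · simp
        · simp [h]
      · rcases hZs h with rfl | rfl | rfl | h
        · exact absurd rfl hxu
        · simp
        · simp
        · simp [h.1]
    have hWv : W v = 0 := by
      by_contra hv0
      refine (M.support_isCircuit W hW).inter_isCocircuit_ne_singleton hD (e := v)
        (Subset.antisymm ?_ (by rintro x rfl; exact ⟨hv0, hv⟩))
      rintro x ⟨hxW, hxD⟩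
      rcases hsub hxW with rfl | rfl | h
      · rfl
      · exact absurd hxD hb'D
      · exact absurd hxD (hI.subset h).2
    have hsub' : support W ⊆ insert b' I := by
      intro x hx
      rcases hsub hx with rfl | h
      · exact absurd hWv hx
      · exact h
    have hWb : W b ≠ 0 := fun h0 => by
      refine (M.support_isCircuit W hW).not_indep (hJ.indep.subset fun x hx => ?_)
      rcases hsub' hx with rfl | h
      · exact mem_insert _ _
      · exact mem_insert_of_mem _ ⟨h, by rintro rfl; exact hx h0⟩
    have hWb' : W b' ≠ 0 := fun h0 => by
      refine (M.support_isCircuit W hW).not_indep (hI.indep.subset fun x hx => ?_)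
      rcases hsub' hx with rfl | h
      · exact absurd h0 hx
      · exact h
    refine ⟨W, hW, hsub', ?_, hWb, ?_, hWb'⟩
    · rcases hWx b hWb with h | h
      · exact h
      · rw [hZ'b] at h; exact absurd h hWb
    · rcases hWx b' hWb' with h | h
      · rw [hXb'] at h; exact absurd h hWb'
      · exact h
  obtain ⟨W, hW, hWs, hWb, hWb0, hWb', hWb'0⟩ := key Z e₁ e₂ h1 h2 hZ (by rwa [insert_comm])
    (by rwa [insert_comm]) (by
      rintro rfl
      rw [Pi.neg_apply] at hX2 hX2'
      generalize Z e₂ = s at *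
      clear * - hX2 hX2'
      revert s; decide) hX1' (by rw [hX1, neg_neg]) hZb
  obtain ⟨W', hW', hWs', hWc, hWc0, hWc', hWc'0⟩ := key (-Z) e₂ e₁ h2 h1 (M.neg_signed Z hZ)
    hXI (by rwa [show support (-Z) = support Z by ext; simp]) (by
      rw [neg_neg]
      rintro rfl
      generalize X e₁ = s at *
      clear * - hX1 hX1'
      revert s; decide) hX2' (by simp [hX2]) (by simp [hZb])
  rw [Pi.neg_apply] at hWc'
  rcases M.eq_or_eq_neg_of_subset_insert hI.indep hW hW' hWs hWs' with rfl | rfl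
  · rw [hWb'] at hWc' hWb'0
    generalize Z b' = s at *
    clear * - hWc' hWb'0
    revert s; decide
  · rw [Pi.neg_apply, hWc] at hWb
    rw [hWc] at hWc0
    generalize X b = s at *
    clear * - hWb hWc0
    revert s; decide

theorem exists_signed_pair (hD : M.IsCocircuit D) {I : Set α} (hI : M.IsBasis I (M.E \ D))
    {e₁ e₂ : α} (h1 : e₁ ∈ D) (h2 : e₂ ∈ D) (hne : e₁ ≠ e₂) :
    ∃ X, M.IsSignedCircuit X ∧ support X ⊆ insert e₂ (insert e₁ I) := by
  have hB := hD.insert_isBase hI h1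
  have he : e₂ ∉ insert e₁ I := by
    rintro (h | h)
    · exact hne h.symm
    · exact (hI.subset h).2 h2
  obtain ⟨X, hX, hXs⟩ := M.exists_signing _ (hB.fundCircuit_isCircuit (hD.subset_ground h2) he)
  exact ⟨X, hX, hXs ▸ M.fundCircuit_subset_insert e₂ (insert e₁ I)⟩

/-- Basis exchanges lead from I to J inside the hyperplane E \ D. By `ne_of_basis_exchange`, each
exchange preserves or reverses the signs at e₁ and e₂ simultaneously, hence keeps their product. -/
theorem mul_eq_mul_of_bases (hD : M.IsCocircuit D) {I J : Set α} (hI : M.IsBasis I (M.E \ D))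
    (hJ : M.IsBasis J (M.E \ D)) {e₁ e₂ : α} (h1 : e₁ ∈ D) (h2 : e₂ ∈ D) (hne : e₁ ≠ e₂)
    {X Z : α → SignType} (hX : M.IsSignedCircuit X)
    (hXI : support X ⊆ insert e₂ (insert e₁ I)) (hZ : M.IsSignedCircuit Z)
    (hZJ : support Z ⊆ insert e₂ (insert e₁ J)) : X e₁ * X e₂ = Z e₁ * Z e₂ := by
  induction hn : (I \ J).ncard generalizing I X with
  | zero =>
    have hfin : (I \ J).Finite :=
      M.ground_finite.subset (sdiff_subset.trans hI.indep.subset_ground)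
    rw [Set.ncard_eq_zero hfin, sdiff_eq_empty] at hn
    have hIJ : I = J := hI.eq_of_subset_indep hJ.indep hn hJ.subset
    subst hIJ
    rcases M.eq_or_eq_neg_of_subset_insert (hD.insert_isBase hI h1).indep hX hZ hXI hZJ
      with rfl | rfl
    · rfl
    · simp
  | succ n ih =>
    have hfin : (I \ J).Finite :=
      M.ground_finite.subset (sdiff_subset.trans hI.indep.subset_ground)
    obtain ⟨b, hb⟩ : (I \ J).Nonempty := by
      rw [← Set.ncard_pos hfin]; omega
    have hI' := hI.isBase_restrict
    obtain ⟨b', hb', hexch⟩ := hI'.exchange hJ.isBase_restrict hb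
    have hexch' : M.IsBasis (insert b' (I \ {b})) (M.E \ D) :=
      (Matroid.isBase_restrict_iff sdiff_subset).1 hexch
    obtain ⟨X', hX', hX'I⟩ := exists_signed_pair hD hexch' h1 h2 hne
    have hcard : (insert b' (I \ {b}) \ J).ncard = n := by
      have : insert b' (I \ {b}) \ J = (I \ J) \ {b} := by
        ext x
        by_cases hx : x = b'
        · simp [hx, hb'.1]
        · simp only [mem_sdiff, mem_insert_iff, hx, false_or, mem_singleton_iff]; tauto
      rw [this, Set.ncard_sdiff_singleton_of_mem hb, hn]; rfl
    rw [← ih hexch' hX' hX'I hcard]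
    have hX1' : X e₁ ≠ 0 := ne_zero_of_subset_basis hD hI h2 hX (by rwa [insert_comm])
    have hX2' : X e₂ ≠ 0 := ne_zero_of_subset_basis hD hI h1 hX hXI
    have hY1' : X' e₁ ≠ 0 := ne_zero_of_subset_basis hD hexch' h2 hX' (by rwa [insert_comm])
    have hY2' : X' e₂ ≠ 0 := ne_zero_of_subset_basis hD hexch' h1 hX' hX'I
    have c1 := ne_of_basis_exchange hD hI hb.1 hb'.2 hexch' h1 h2 hX hXI hX' hX'I
    have c2 := ne_of_basis_exchange hD hI hb.1 hb'.2 hexch' h1 h2 hX hXI (M.neg_signed _ hX')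
      (by rwa [show support (-X') = support X' by ext; simp])
    rw [Pi.neg_apply, Pi.neg_apply] at c2
    rcases sign_eq_or_eq_neg hX1' hY1' with p | p <;> rcases sign_eq_or_eq_neg hX2' hY2' with q | q
    · rw [p, q]
    · exact absurd q (c2 (by rw [p, neg_neg]))
    · exact absurd q (c1 p)
    · rw [p, q, neg_mul_neg]

theorem mul_eq_mul_of_pair (hD : M.IsCocircuit D) {e₁ e₂ : α} (h1 : e₁ ∈ D) (h2 : e₂ ∈ D)
    (hne : e₁ ≠ e₂) {X Z : α → SignType} (hX : M.IsSignedCircuit X) (hZ : M.IsSignedCircuit Z)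
    (hXD : ∀ x ∈ D, X x ≠ 0 → x = e₁ ∨ x = e₂) (hZD : ∀ x ∈ D, Z x ≠ 0 → x = e₁ ∨ x = e₂)
    (hX1 : X e₁ ≠ 0) (hZ1 : Z e₁ ≠ 0) :
    X e₁ * X e₂ = Z e₁ * Z e₂ := by
  have key : ∀ X, M.IsSignedCircuit X → (∀ x ∈ D, X x ≠ 0 → x = e₁ ∨ x = e₂) → X e₁ ≠ 0 →
      ∃ I, M.IsBasis I (M.E \ D) ∧ support X ⊆ insert e₂ (insert e₁ I) := by
    intro X hX hXD hX1
    have hXc := M.support_isCircuit X hX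
    have hind : M.Indep (support X \ D) :=
      hXc.ssubset_indep ⟨sdiff_subset, fun h => (h (mem_support.2 hX1)).2 h1⟩
    obtain ⟨I, hI, hsub⟩ := hind.subset_isBasis_of_subset
      (sdiff_subset_sdiff_left hXc.subset_ground)
    refine ⟨I, hI, fun x hx => ?_⟩
    by_cases hxD : x ∈ D
    · rcases hXD x hxD hx with rfl | rfl <;> simp
    · exact Or.inr (Or.inr (hsub ⟨hx, hxD⟩))
  obtain ⟨I, hI, hXI⟩ := key X hX hXD hX1
  obtain ⟨J, hJ, hZJ⟩ := key Z hZ hZD hZ1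
  exact mul_eq_mul_of_bases hD hI hJ h1 h2 hne hX hXI hZ hZJ

theorem sign_mul_eq_neg_mul {a b c d : SignType} (ha : a ≠ 0) (hb : b ≠ 0) (hc : c ≠ 0)
    (hd : d ≠ 0) (h : a * b = c * -d) : a * c = -(b * d) := by
  revert a b c d; decide

/-- The pairwise relations between the signs of the elements of a cocircuit are consistent. -/
theorem exists_pairwise_signing (hD : M.IsCocircuit D) :
    ∃ Y : α → SignType, support Y = D ∧ ∀ X, M.IsSignedCircuit X → ∀ e₁ ∈ D, ∀ e₂ ∈ D, e₁ ≠ e₂ →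
      X e₁ ≠ 0 → X e₂ ≠ 0 → (∀ x ∈ D, X x ≠ 0 → x = e₁ ∨ x = e₂) →
      X e₁ * Y e₁ = -(X e₂ * Y e₂) := by
  classical
  obtain ⟨e₀, h0⟩ := hD.nonempty
  obtain ⟨I, hI⟩ := M.exists_isBasis (M.E \ D)
  have hID : ∀ {x}, x ∈ I → x ∉ D := fun hx => (hI.subset hx).2
  have hc : ∀ e, ∃ X : α → SignType, e ∈ D → e ≠ e₀ → M.IsSignedCircuit X ∧
      support X ⊆ insert e (insert e₀ I) ∧ X e₀ = -1 := by
    intro e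
    by_cases he : e ∈ D ∧ e ≠ e₀
    · obtain ⟨X, hX, hXs⟩ := exists_signed_pair hD hI h0 he.1 he.2.symm
      have hXe : X e₀ ≠ 0 := ne_zero_of_subset_basis hD hI he.1 hX (by rwa [insert_comm])
      rcases sign_eq_or_eq_neg hXe (t := 1) (by decide) with h | h
      · exact ⟨-X, fun _ _ => ⟨M.neg_signed X hX,
          by rwa [show support (-X) = support X by ext; simp], by simp [h]⟩⟩
      · exact ⟨X, fun _ _ => ⟨hX, hXs, h⟩⟩
    · exact ⟨0, fun h1 h2 => absurd ⟨h1, h2⟩ he⟩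
  choose W hW using hc
  have hWe : ∀ {e}, e ∈ D → e ≠ e₀ → W e e ≠ 0 := fun he hne =>
    ne_zero_of_subset_basis hD hI h0 (hW _ he hne).1 (hW _ he hne).2.1
  have hWD : ∀ {e}, e ∈ D → e ≠ e₀ → ∀ x ∈ D, W e x ≠ 0 → x = e₀ ∨ x = e := by
    intro e he hne x hxD hx
    rcases (hW e he hne).2.1 hx with h | h | h
    exacts [Or.inr h, Or.inl h, absurd hxD (hID h)]
  -- Signs are measured against e₀: since W e is -1 at e₀, the value Y e = W e e is the one that
  -- makes W e balanced on {e₀, e}.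
  set Y : α → SignType := fun e => if e ∈ D then if e = e₀ then 1 else W e e else 0 with hYdef
  have hY0 : Y e₀ = 1 := by simp [hYdef, h0]
  have hYe : ∀ {e}, e ∈ D → e ≠ e₀ → Y e = W e e := by
    intro e he hne
    simp only [hYdef]; rw [if_pos he, if_neg hne]
  refine ⟨Y, ?_, ?_⟩
  · ext e
    by_cases he : e ∈ D
    · by_cases hne : e = e₀
      · subst hne; simp [hY0, h0]
      · simp [hYe he hne, he, hWe he hne]
    · simp [hYdef, he]
  have base : ∀ X, M.IsSignedCircuit X → ∀ e ∈ D, e ≠ e₀ → X e ≠ 0 → X e₀ ≠ 0 →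
      (∀ x ∈ D, X x ≠ 0 → x = e₀ ∨ x = e) → X e₀ * Y e₀ = -(X e * Y e) := by
    intro X hX e he hne hXe hX0 hXD
    obtain ⟨hWc, hWs, hW0⟩ := hW e he hne
    have := mul_eq_mul_of_pair hD h0 he hne.symm hX hWc hXD (hWD he hne) hX0 (by rw [hW0]; decide)
    rw [hW0] at this
    rw [hY0, hYe he hne]
    have hWee := hWe he hne
    generalize X e = a, X e₀ = b, W e e = c at *
    clear * - this hXe hX0 hWee
    revert a b c; decide
  intro X hX e₁ h1 e₂ h2 hne hX1 hX2 hXD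
  by_cases he1 : e₁ = e₀
  · subst he1
    exact base X hX e₂ h2 hne.symm hX2 hX1 hXD
  by_cases he2 : e₂ = e₀
  · subst he2
    rw [base X hX e₁ h1 hne hX1 hX2 (fun x hx hx0 => (hXD x hx hx0).symm), neg_neg]
  obtain ⟨hA, hAs, hA0⟩ := hW e₁ h1 he1
  obtain ⟨hB, hBs, hB0⟩ := hW e₂ h2 he2
  have hA2 : W e₁ e₂ = 0 := by
    by_contra h
    rcases hWD h1 he1 e₂ h2 h with h | h
    exacts [he2 h, hne h.symm]
  have hB1 : W e₂ e₁ = 0 := by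
    by_contra h
    rcases hWD h2 he2 e₁ h1 h with h | h
    exacts [he1 h, hne h]
  -- For e₁ and e₂ other than e₀, eliminating e₀ produces a circuit meeting D in e₁ and e₂ with
  -- known signs, to which X can be compared.
  obtain ⟨V, hV, hV0, hVx⟩ := M.elimination (W e₁) (-W e₂) e₀ hA (M.neg_signed _ hB)
    (by rw [neg_neg]; intro h; exact hWe h1 he1 (by rw [h, hB1]))
    (by rw [hA0]; decide) (by simp [hA0, hB0])
  have hVs : support V ⊆ insert e₂ (insert e₁ I) := by
    intro x hx
    have hx0 : x ≠ e₀ := by rintro rfl; exact hx hV0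
    have : W e₁ x ≠ 0 ∨ W e₂ x ≠ 0 := by
      rcases hVx x hx with h | h
      · left; rwa [← h]
      · right; intro h'; rw [Pi.neg_apply, h', neg_zero] at h; exact hx h
    rcases this with h | h
    · rcases hAs h with rfl | rfl | h
      · simp
      · exact absurd rfl hx0
      · simp [h]
    · rcases hBs h with rfl | rfl | h
      · simp
      · exact absurd rfl hx0
      · simp [h]
  have hV1 : V e₁ ≠ 0 := ne_zero_of_subset_basis hD hI h2 hV (by rwa [insert_comm])
  have hV2 : V e₂ ≠ 0 := ne_zero_of_subset_basis hD hI h1 hV hVs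
  have hV1' : V e₁ = W e₁ e₁ := by
    rcases hVx e₁ hV1 with h | h
    · exact h
    · rw [Pi.neg_apply, hB1, neg_zero] at h; exact absurd h hV1
  have hV2' : V e₂ = -W e₂ e₂ := by
    rcases hVx e₂ hV2 with h | h
    · rw [hA2] at h; exact absurd h hV2
    · exact h
  have := mul_eq_mul_of_pair hD h1 h2 hne hX hV hXD (by
    intro x hxD hx
    rcases hVs hx with h | h | h
    exacts [Or.inr h, Or.inl h, absurd hxD (hID h)]) hX1 hV1
  rw [hYe h1 he1, hYe h2 he2]
  rw [hV1', hV2'] at this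
  have hWa := hWe h1 he1
  have hWb := hWe h2 he2
  exact sign_mul_eq_neg_mul hX1 hX2 hWa hWb this

/-- If T \ D spanned the hyperplane E \ D, adding a would span everything, in particular b, against
the independence of T. -/
theorem _root_.Matroid.IsCocircuit.exists_notMem_closure_sdiff {M : Matroid α} {D T : Set α}
    (hD : M.IsCocircuit D) (hT : M.Indep T) {a b : α} (ha : a ∈ T ∩ D) (hb : b ∈ T ∩ D)
    (hab : a ≠ b) : ∃ h ∈ M.E \ D, h ∉ M.closure (T \ D) := by
  by_contra! hcl
  have hsub : insert a (M.E \ D) ⊆ M.closure (insert a (T \ D)) := by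
    rintro x (rfl | hx)
    · exact M.mem_closure_of_mem' (mem_insert _ _) (hT.subset_ground ha.1)
    · exact M.closure_subset_closure (subset_insert _ _) (hcl x hx)
  have hbcl : b ∈ M.closure (insert a (T \ D)) := by
    refine M.closure_subset_closure_of_subset_closure hsub ?_
    rw [(hD.spanning_insert_compl ha.2).closure_eq]
    exact hT.subset_ground hb.1
  refine hT.notMem_closure_sdiff_of_mem hb.1 (M.closure_subset_closure ?_ hbcl)
  rintro x (rfl | hx)
  · exact ⟨ha.1, hab⟩
  · exact ⟨hx.1, by rintro rfl; exact hx.2 hb.2⟩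

/-- Passes from circuits meeting D in two elements to all circuits, by induction on the size of X ∩
D. A counterexample X meets D in at least three elements with all products 1. An auxiliary circuit Z
meeting D in fewer elements has products of both signs by induction; repeated elimination against X
removes the negative products and leaves a circuit with a smaller trace on D and none, against the
induction hypothesis. -/
theorem exists_mul_eq_neg_one (M : OrientedMatroid α) {D : Set α} (hD : M.IsCocircuit D)
    {Y : α → SignType} (hYD : support Y = D)
    (hpair : ∀ X, M.IsSignedCircuit X → ∀ e₁ ∈ D, ∀ e₂ ∈ D, e₁ ≠ e₂ →
      X e₁ ≠ 0 → X e₂ ≠ 0 → (∀ x ∈ D, X x ≠ 0 → x = e₁ ∨ x = e₂) →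
      X e₁ * Y e₁ = -(X e₂ * Y e₂)) (n : ℕ) :
    ∀ X, M.IsSignedCircuit X → (support X ∩ D).ncard = n → (support X ∩ D).Nonempty →
      ∃ x, X x * Y x = -1 := by
  induction n using Nat.strong_induction_on with
  | _ n ih =>
  intro X hX hcard hne
  have hXc := M.support_isCircuit X hX
  have hfin : ∀ {s : Set α}, s ⊆ M.E → s.Finite := fun hs => M.ground_finite.subset hs
  have hY0 : ∀ {x}, x ∈ D → Y x ≠ 0 := fun hx => by rwa [← mem_support, hYD]
  have hDY : ∀ {x}, Y x ≠ 0 → x ∈ D := fun hx => by rwa [← mem_support, hYD] at hx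
  by_contra! hcon
  have hXY : ∀ x, X x ≠ 0 → x ∈ D → X x * Y x = 1 := by
    intro x hx hxD
    have h1 := hY0 hxD
    have h2 := hcon x
    generalize X x = a, Y x = b at *
    clear * - hx h1 h2
    revert a b; decide
  obtain ⟨e₁, hX1, h1⟩ := hne
  obtain ⟨e₂, ⟨hX2, h2⟩, h12⟩ := (hXc.isCocircuit_inter_nontrivial hD ⟨e₁, hX1, h1⟩).exists_ne e₁
  obtain ⟨e₃, hX3, h3, h31, h32⟩ : ∃ e₃, X e₃ ≠ 0 ∧ e₃ ∈ D ∧ e₃ ≠ e₁ ∧ e₃ ≠ e₂ := by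
    by_contra! h
    have := hpair X hX e₁ h1 e₂ h2 h12.symm hX1 hX2 (fun x hxD hx => by
      by_contra! hx'
      exact hx'.2 (h x hx hxD hx'.1))
    rw [hXY e₁ hX1 h1, hXY e₂ hX2 h2] at this
    exact absurd this (by decide)
  have hXind := hXc.sdiff_singleton_indep (mem_support.2 hX1)
  -- T becomes a basis of M whose elements in D all lie in X \ e₁. So X is the fundamental circuit
  -- of e₁, while that of any h outside D and T meets D inside X without e₁.
  obtain ⟨T, hT, hXT⟩ := hXind.subset_isBasis_of_subset
    (X := (support X \ {e₁}) ∪ (M.E \ D)) subset_union_left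
    (union_subset hXind.subset_ground sdiff_subset)
  have hTs : M.IsBase T := by
    refine hT.isBase_of_spanning ?_
    refine (hD.spanning_insert_compl h2).superset ?_ (union_subset hXind.subset_ground sdiff_subset)
    rintro x (rfl | hx)
    · exact Or.inl ⟨hX2, h12⟩
    · exact Or.inr hx
  have hTD : ∀ x ∈ T, x ∈ D → X x ≠ 0 ∧ x ≠ e₁ := by
    intro x hx hxD
    rcases hT.subset hx with h | h
    · exact h
    · exact absurd hxD h.2
  have heT : e₁ ∉ T := fun h => (hTD e₁ h h1).2 rfl
  have hXT' : support X ⊆ insert e₁ T := fun x hx => by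
    by_cases hx1 : x = e₁
    · exact Or.inl hx1
    · exact Or.inr (hXT ⟨hx, hx1⟩)
  obtain ⟨h, ⟨hhE, hhD⟩, hh⟩ := hD.exists_notMem_closure_sdiff hTs.indep
    ⟨hXT ⟨hX2, h12⟩, h2⟩ ⟨hXT ⟨hX3, h31⟩, h3⟩ h32.symm
  have hhT : h ∉ T := fun hT' =>
    hh (M.mem_closure_of_mem' ⟨hT', hhD⟩ hhE)
  have hXh : X h = 0 := by
    by_contra h0
    rcases hXT' h0 with rfl | h'
    exacts [hhD h1, hhT h']
  obtain ⟨Z, hZ, hZs⟩ := M.exists_signing _ (hTs.fundCircuit_isCircuit hhE hhT)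
  have hZh : Z h ≠ 0 := by
    rw [← mem_support, hZs]; exact M.mem_fundCircuit h T
  have hZT : support Z ⊆ insert h T := hZs ▸ M.fundCircuit_subset_insert h T
  have hlt : ∀ W, M.IsSignedCircuit W → (∀ x ∈ D, W x ≠ 0 → X x ≠ 0) →
      (∃ x ∈ D, X x ≠ 0 ∧ W x = 0) → (support W ∩ D).Nonempty → ∃ x, W x * Y x = -1 := by
    rintro W hW hsub ⟨x, hxD, hXx, hWx⟩ hne
    refine ih _ ?_ W hW rfl hne
    rw [← hcard]
    refine Set.ncard_lt_ncard ⟨fun y hy => ⟨hsub y hy.2 hy.1, hy.2⟩, fun h => ?_⟩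
      ((hfin hXc.subset_ground).subset inter_subset_left)
    exact (h ⟨hXx, hxD⟩).1 hWx
  have hZX : ∀ x ∈ D, Z x ≠ 0 → X x ≠ 0 ∧ x ≠ e₁ := by
    intro x hxD hx
    rcases hZT hx with rfl | h
    · exact absurd hxD hhD
    · exact hTD x h hxD
  have hZ1 : Z e₁ = 0 := by
    by_contra h
    exact (hZX e₁ h1 h).2 rfl
  have hZne : (support Z ∩ D).Nonempty := by
    by_contra hemp
    rw [not_nonempty_iff_eq_empty] at hemp
    apply hh
    refine M.closure_subset_closure ?_
      ((M.support_isCircuit Z hZ).mem_closure_sdiff_singleton_of_mem hZh)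
    rintro x ⟨hx, hxh⟩
    rcases hZT hx with h | h
    · exact absurd h hxh
    · exact ⟨h, fun hxD => (hemp.subset ⟨hx, hxD⟩ : x ∈ (∅ : Set α))⟩
  obtain ⟨a, ha⟩ := hlt Z hZ (fun x hxD hx => (hZX x hxD hx).1) ⟨e₁, h1, hX1, hZ1⟩ hZne
  obtain ⟨b, hb⟩ := hlt (-Z) (M.neg_signed Z hZ) (fun x hxD hx => (hZX x hxD (by simpa using hx)).1)
    ⟨e₁, h1, hX1, by simp [hZ1]⟩ (by rwa [show support (-Z) = support Z by ext; simp])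
  -- Descent on the number of negative products of W. Eliminating a negative element j against X
  -- adds no negative product and removes j; h survives because a circuit in T ∪ e₁ would be ±X,
  -- nonzero at j. At the end e₁ lies in W, since otherwise W = ±Z, and W misses u, so its trace on
  -- D is nonempty and smaller.
  have main : ∀ (k : ℕ) (W : α → SignType), M.IsSignedCircuit W →
      support W ⊆ insert h (insert e₁ T) → W h ≠ 0 →
      (∀ x, W x * Y x = -1 → Z x * Y x = -1) → (∃ x ∈ D, X x ≠ 0 ∧ W x * Y x ≠ 1) →
      {x | W x * Y x = -1}.ncard = k → False := by
    intro k
    induction k using Nat.strong_induction_on with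
    | _ k ihk =>
    rintro W hW hWs hWh hWneg ⟨u, huD, hXu, hWu⟩ hk
    have hWX : ∀ x ∈ D, W x ≠ 0 → X x ≠ 0 := by
      intro x hxD hx
      rcases hWs hx with rfl | rfl | h
      · exact absurd hxD hhD
      · exact hX1
      · exact (hTD x h hxD).1
    by_cases hneg : ∃ j, W j * Y j = -1
    · obtain ⟨j, hj⟩ := hneg
      have hj0 : W j * Y j ≠ 0 := by rw [hj]; decide
      have hjD := hDY (right_ne_zero_of_mul hj0)
      have hXj := hWX j hjD (left_ne_zero_of_mul hj0)
      have hXj1 := hXY j hXj hjD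
      have hWj : W j = -X j := by
        generalize W j = a, X j = b, Y j = c at *
        clear * - hj hXj1
        revert a b c; decide
      obtain ⟨V, hV, hVj, hVx⟩ := M.elimination X W j hX hW
        (by rintro rfl; exact hWh (by simpa using hXh)) hXj hWj
      have hVs : support V ⊆ insert h (insert e₁ T) := by
        intro x hx
        rcases hVx x hx with h' | h'
        · exact Or.inr (hXT' (show X x ≠ 0 from h' ▸ hx))
        · exact hWs (show W x ≠ 0 from h' ▸ hx)
      refine ihk _ ?_ V hV hVs ?_ ?_ ⟨j, hjD, hXj, by rw [hVj, zero_mul]; decide⟩ rfl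
      · rw [← hk]
        have hsub : {x | V x * Y x = -1} ⊆ {x | W x * Y x = -1} := by
          intro x hx
          rw [mem_ofPred_eq] at hx ⊢
          have hVx0 : V x ≠ 0 := by rintro h0; rw [h0, zero_mul] at hx; exact absurd hx (by decide)
          rcases hVx x hVx0 with h' | h'
          · rw [h'] at hx; exact absurd hx (hcon x)
          · rwa [h'] at hx
        refine Set.ncard_lt_ncard ⟨hsub, fun h' => ?_⟩ (hfin fun x hx => ?_)
        · have : V j * Y j = -1 := h' hj
          rw [hVj, zero_mul] at this
          exact absurd this (by decide)
        · rw [mem_ofPred_eq] at hx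
          refine hD.subset_ground (hDY fun h0 => ?_)
          rw [h0, mul_zero] at hx
          exact absurd hx (by decide)
      · intro hVh
        have hVs' : support V ⊆ insert e₁ T := by
          intro x hx
          rcases hVs hx with rfl | h'
          · exact absurd hVh hx
          · exact h'
        rcases M.eq_or_eq_neg_of_subset_insert hTs.indep hV hX hVs' hXT' with rfl | rfl
        · exact hXj hVj
        · exact hXj (by simpa using hVj)
      · intro x hx
        have hVx0 : V x ≠ 0 := by rintro h0; rw [h0, zero_mul] at hx; exact absurd hx (by decide)
        rcases hVx x hVx0 with h' | h'
        · rw [h'] at hx; exact absurd hx (hcon x)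
        · rw [h'] at hx; exact hWneg x hx
    · push Not at hneg
      have hWu0 : W u = 0 := by
        have h1 := hneg u
        have h2 := hY0 huD
        generalize W u = a, Y u = b at *
        clear * - h1 h2 hWu
        revert a b; decide
      have hW1 : W e₁ ≠ 0 := by
        intro hW1
        have hWs' : support W ⊆ insert h T := by
          intro x hx
          rcases hWs hx with h' | rfl | h'
          · exact Or.inl h'
          · exact absurd hW1 hx
          · exact Or.inr h'
        rcases M.eq_or_eq_neg_of_subset_insert hTs.indep hW hZ hWs' hZT with rfl | rfl
        · exact hneg a ha
        · exact hneg b hb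
      obtain ⟨x, hx⟩ := hlt W hW hWX ⟨u, huD, hXu, hWu0⟩ ⟨e₁, hW1, h1⟩
      exact hneg x hx
  have ha0 : Z a * Y a ≠ 0 := by rw [ha]; decide
  refine main _ Z hZ (hZT.trans (insert_subset_insert (subset_insert _ _))) hZh (fun x hx => hx)
    ⟨a, hDY (right_ne_zero_of_mul ha0), (hZX a (hDY (right_ne_zero_of_mul ha0))
      (left_ne_zero_of_mul ha0)).1, by rw [ha]; decide⟩ rfl

theorem exists_signedCocircuit (M : OrientedMatroid α) {D : Set α} (hD : M.IsCocircuit D) :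
    ∃ Y, M.IsSignedCocircuit Y ∧ support Y = D := by
  obtain ⟨Y, hYD, hpair⟩ := exists_pairwise_signing hD
  refine ⟨Y, ⟨by rwa [hYD], fun X hX => ?_⟩, hYD⟩
  have key : ∀ X, M.IsSignedCircuit X → (∃ x, X x * Y x ≠ 0) → ∃ x, X x * Y x = -1 := by
    rintro X hX ⟨x, hx⟩
    exact M.exists_mul_eq_neg_one hD hYD hpair _ X hX rfl
      ⟨x, left_ne_zero_of_mul hx, by rw [← hYD]; exact right_ne_zero_of_mul hx⟩
  constructor
  · rintro ⟨x, hx⟩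
    exact key X hX ⟨x, by rw [hx]; decide⟩
  · rintro ⟨x, hx⟩
    obtain ⟨y, hy⟩ := key (-X) (M.neg_signed X hX) ⟨x, by simp [hx]⟩
    exact ⟨y, by rw [Pi.neg_apply, neg_mul] at hy; exact neg_injective hy⟩

/-- The signed circuits and the signed cocircuits of an oriented matroid. -/
theorem isOrthogonalPair (M : OrientedMatroid α) :
    IsOrthogonalPair M.toMatroid M.IsSignedCircuit M.IsSignedCocircuit where
  ground_finite := M.ground_finite
  isCircuit := M.support_isCircuit
  isCocircuit Y hY := hY.1
  exists_circuit := M.exists_signing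
  exists_cocircuit K hK := M.exists_signedCocircuit hK
  neg_circuit := M.neg_signed
  neg_cocircuit Y hY := ⟨by rw [show support (-Y) = support Y by ext; simp]; exact hY.1,
    fun X hX => (hY.2 X hX).neg_right⟩
  orthogonal X Y hX hY := hY.2 X hX

/-- The dual oriented matroid. -/
def dual (M : OrientedMatroid α) : OrientedMatroid α :=
  ofOrthogonalPair M.toMatroid✶ M.IsSignedCocircuit M.IsSignedCircuit M.isOrthogonalPair.dual

theorem dual_isSignedCocircuit_iff (M : OrientedMatroid α) {X : α → SignType} :
    M.dual.IsSignedCocircuit X ↔ M.IsSignedCircuit X :=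
  ofOrthogonalPair_isSignedCocircuit_iff M.isOrthogonalPair.dual

end OrientedMatroid

namespace OrientedMatroid
variable {α : Type*}

/-! ### Generic extensions and generic liftings -/

@[simp] theorem withSign_self (X : α → SignType) (f : α) (s : SignType) :
    withSign X f s f = s := by
  simp [withSign]

theorem withSign_of_ne (X : α → SignType) {f x : α} (s : SignType) (h : x ≠ f) :
    withSign X f s x = X x := by
  simp [withSign, h]

theorem withSign_eq_self {X : α → SignType} {f : α} {s : SignType} (h : X f = s) :
    withSign X f s = X := by
  funext x
  by_cases hx : x = f
  · subst hx; simp [h]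
  · exact withSign_of_ne X s hx

theorem neg_withSign (X : α → SignType) (f : α) (s : SignType) :
    -withSign X f s = withSign (-X) f (-s) := by
  funext x
  by_cases hx : x = f
  · subst hx; simp
  · simp [withSign_of_ne _ _ hx]

theorem withSign_withSign (X : α → SignType) (f : α) (s t : SignType) :
    withSign (withSign X f s) f t = withSign X f t := by
  simp [withSign]

theorem support_neg_sign (X : α → SignType) : support (-X) = support X := by
  ext; simp

theorem support_withSign_zero (X : α → SignType) (f : α) :
    support (withSign X f 0) = support X \ {f} := by
  ext x
  by_cases hx : x = f
  · subst hx; simp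
  · simp [withSign_of_ne _ _ hx, hx]

theorem support_withSign (X : α → SignType) (f : α) {s : SignType} (hs : s ≠ 0) :
    support (withSign X f s) = insert f (support X) := by
  ext x
  by_cases hx : x = f
  · subst hx; simp [hs]
  · simp [withSign_of_ne _ _ hx, hx]

theorem orthogonal_withSign_right {X : α → SignType} {f : α} (h : X f = 0) (Y : α → SignType)
    (s : SignType) : Orthogonal X (withSign Y f s) ↔ Orthogonal X Y := by
  have : ∀ e, X e * withSign Y f s e = X e * Y e := by
    intro e
    by_cases he : e = f
    · subst he; simp [h]
    · rw [withSign_of_ne _ _ he]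
  simp only [Orthogonal, this]

theorem orthogonal_withSign_left {Y : α → SignType} {f : α} (h : Y f = 0) (X : α → SignType)
    (s : SignType) : Orthogonal (withSign X f s) Y ↔ Orthogonal X Y :=
  ⟨fun h' => ((orthogonal_withSign_right h X s).1 h'.symm).symm,
    fun h' => ((orthogonal_withSign_right h X s).2 h'.symm).symm⟩

theorem neg_signedCocircuit (M : OrientedMatroid α) {Y : α → SignType}
    (hY : M.IsSignedCocircuit Y) : M.IsSignedCocircuit (-Y) :=
  M.isOrthogonalPair.neg_cocircuit Y hY

theorem IsSignedCocircuit.eq_zero {M : OrientedMatroid α} {Y : α → SignType}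
    (hY : M.IsSignedCocircuit Y) {x : α} (hx : x ∉ M.E) : Y x = 0 := by
  by_contra h
  exact hx (hY.1.subset_ground h)

theorem eq_zero_of_notMem_ground {M : OrientedMatroid α} {X : α → SignType}
    (hX : M.IsSignedCircuit X) {x : α} (hx : x ∉ M.E) : X x = 0 := by
  by_contra h
  exact hx ((M.support_isCircuit X hX).subset_ground h)

namespace IsGenericExtension

variable {M F : OrientedMatroid α} {f : α}

theorem toMatroid_eq (h : M.IsGenericExtension f F) : M.toMatroid = F.toMatroid.delete {f} :=
  h.1.1

theorem isCircuit_insert (h : M.IsGenericExtension f F) {B : Set α} (hB : M.IsBase B) :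
    F.IsCircuit (insert f B) :=
  ((h.2 _).2 ⟨B, hB, rfl⟩).1

theorem notMem (h : M.IsGenericExtension f F) : f ∉ M.E := by
  rw [h.toMatroid_eq]; simp

theorem mem (h : M.IsGenericExtension f F) : f ∈ F.E := by
  obtain ⟨B, hB⟩ := M.exists_isBase
  exact (h.isCircuit_insert hB).subset_ground (mem_insert _ _)

theorem ground_eq (h : M.IsGenericExtension f F) : F.E = insert f M.E := by
  rw [h.toMatroid_eq, Matroid.delete_ground, insert_sdiff_singleton, insert_eq_of_mem h.mem]

theorem indep_iff (h : M.IsGenericExtension f F) {I : Set α} :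
    M.Indep I ↔ F.Indep I ∧ f ∉ I := by
  rw [h.toMatroid_eq, Matroid.deleteElem_indep_iff]

theorem isCircuit_iff (h : M.IsGenericExtension f F) {C : Set α} :
    M.IsCircuit C ↔ F.IsCircuit C ∧ f ∉ C := by
  rw [h.toMatroid_eq, Matroid.delete_isCircuit_iff, Set.disjoint_singleton_right]

theorem coindep (h : M.IsGenericExtension f F) : F.Coindep {f} := by
  rw [Matroid.coindep_iff_forall_subset_not_isCocircuit]
  refine ⟨fun K hK hKc => ?_, singleton_subset_iff.2 h.mem⟩
  obtain ⟨B, hB⟩ := M.exists_isBase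
  have hKf : K = {f} := (subset_singleton_iff_eq.1 hK).resolve_left hKc.nonempty.ne_empty
  subst hKf
  refine (h.isCircuit_insert hB).inter_isCocircuit_ne_singleton hKc (e := f) ?_
  simp

theorem isBase_iff (h : M.IsGenericExtension f F) {B : Set α} :
    M.IsBase B ↔ F.IsBase B ∧ f ∉ B := by
  rw [h.toMatroid_eq, h.coindep.delete_isBase_iff, Set.disjoint_singleton_right]

theorem isSignedCircuit_iff (h : M.IsGenericExtension f F) {X : α → SignType} :
    M.IsSignedCircuit X ↔ F.IsSignedCircuit X ∧ X f = 0 :=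
  h.1.2 X

/-- Either D or D ∪ f is a cocircuit of F. The former fails: a basis B of M meeting D in a single
element d gives a circuit B ∪ f meeting D only in d. -/
theorem isCocircuit_insert (h : M.IsGenericExtension f F) {D : Set α} (hD : M.IsCocircuit D) :
    F.IsCocircuit (insert f D) := by
  have hD' : (F.toMatroid✶.contract {f}).IsCircuit D := by
    rw [← Matroid.dual_delete, ← h.toMatroid_eq]; exact hD
  have hfD : f ∉ D := fun hf => h.notMem (hD.subset_ground hf)
  obtain ⟨K, hK, hDK, hKD⟩ := hD'.exists_subset_isCircuit_of_contract
  have hKD' : K ⊆ insert f D := fun x hx => by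
    rcases hKD hx with h | h
    · exact Or.inr h
    · exact Or.inl h
  by_cases hfK : f ∈ K
  · have : K = insert f D := Subset.antisymm hKD' (insert_subset hfK hDK)
    exact this ▸ hK
  · exfalso
    have hKeq : K = D := Subset.antisymm (fun x hx => by
      rcases hKD' hx with rfl | h
      · exact absurd hx hfK
      · exact h) hDK
    subst hKeq
    obtain ⟨d, hd⟩ := hD.nonempty
    have hind : M.toMatroid✶.Indep (K \ {d}) := hD.isCircuit.sdiff_singleton_indep hd
    obtain ⟨B, hB, hdisj⟩ := (Matroid.dual_indep_iff_exists'.1 hind).2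
    have hFK : F.IsCocircuit K := hK
    have hsub : insert f B ∩ K ⊆ {d} := by
      rintro x ⟨rfl | hx, hxK⟩
      · exact absurd hxK hfK
      · by_contra hxd
        exact Set.disjoint_left.1 hdisj ⟨hxK, hxd⟩ hx
    obtain ⟨b, hb⟩ : (insert f B ∩ K).Nonempty := by
      obtain ⟨b, hbK, hbB⟩ := (Matroid.dual_dep_iff_forall.1 hD.isCircuit.dep).1 B hB
      exact ⟨b, Or.inr hbB, hbK⟩
    have hbd := hsub hb
    rw [mem_singleton_iff] at hbd
    subst hbd
    exact (h.isCircuit_insert hB).inter_isCocircuit_ne_singleton hFK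
      (hsub.antisymm (singleton_subset_iff.2 hb))

theorem orthogonal_of_cocircuit (h : M.IsGenericExtension f F) {Y : α → SignType}
    (hY : F.IsSignedCocircuit Y) {X : α → SignType} (hX : M.IsSignedCircuit X) :
    Orthogonal X Y :=
  hY.2 X (h.isSignedCircuit_iff.1 hX).1

theorem exists_extension (h : M.IsGenericExtension f F) {D : Set α} (hD : M.IsCocircuit D) :
    ∃ Y, M.IsSignedCocircuit Y ∧ support Y = D ∧ F.IsSignedCocircuit (withSign Y f 1) := by
  obtain ⟨Y, hY, hYs, hYf⟩ := F.isOrthogonalPair.exists_cocircuit_sign (h.isCocircuit_insert hD)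
    (mem_insert f D) (s := 1) (by decide)
  have hs : support (withSign Y f 0) = D := by
    rw [support_withSign_zero, hYs]
    exact insert_sdiff_self_of_notMem fun hf => h.notMem (hD.subset_ground hf)
  refine ⟨withSign Y f 0, ⟨by rwa [hs], fun X hX => ?_⟩, hs, ?_⟩
  · rw [orthogonal_withSign_right (h.isSignedCircuit_iff.1 hX).2]
    exact h.orthogonal_of_cocircuit hY hX
  · rwa [withSign_withSign, withSign_eq_self hYf]

theorem exists_sign (h : M.IsGenericExtension f F) {Y : α → SignType}
    (hY : M.IsSignedCocircuit Y) : ∃ s, s ≠ 0 ∧ F.IsSignedCocircuit (withSign Y f s) := by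
  obtain ⟨Y', hY', hs, hF⟩ := h.exists_extension hY.1
  rcases M.isOrthogonalPair.cocircuit_eq_or_eq_neg hY hY' hs.symm with rfl | rfl
  · exact ⟨1, by decide, hF⟩
  · exact ⟨-1, by decide, by rw [← neg_withSign]; exact F.neg_signedCocircuit hF⟩

theorem extensionSignature_spec (h : M.IsGenericExtension f F) {D : Set α}
    (hD : M.IsCocircuit D) :
    M.IsSignedCocircuit (M.extensionSignature f F D) ∧ support (M.extensionSignature f F D) = D ∧
      F.IsSignedCocircuit (withSign (M.extensionSignature f F D) f 1) :=
  Classical.epsilon_spec (h.exists_extension hD)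

end IsGenericExtension

namespace IsGenericLifting

variable {M G : OrientedMatroid α} {g : α}

theorem toMatroid_eq (h : M.IsGenericLifting g G) : M.toMatroid = G.toMatroid.contract {g} :=
  h.1.1

theorem orthogonal_of_circuit (h : M.IsGenericLifting g G) {X Y : α → SignType}
    (hX : M.IsSignedCircuit X) (hY : G.IsSignedCocircuit Y) (hYg : Y g = 0) :
    Orthogonal X Y := by
  obtain ⟨-, Z, hZ, rfl⟩ := (h.1.2 X).1 hX
  rw [orthogonal_withSign_left hYg]
  exact hY.2 Z hZ

/-- Lets most facts on liftings be read off from those on extensions. What needs proof is that the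
signed cocircuits of G / g are those of G avoiding g, as contraction is defined through circuits. -/
theorem dual (h : M.IsGenericLifting g G) : M.dual.IsGenericExtension g G.dual := by
  have hg : g ∉ M.E := by rw [h.toMatroid_eq]; simp
  have hcoc : ∀ K, M.IsCocircuit K ↔ G.IsCocircuit K ∧ g ∉ K := fun K => by
    rw [h.toMatroid_eq, Matroid.contract_isCocircuit_iff, Set.disjoint_singleton_right]
  refine ⟨⟨?_, fun Y => ?_⟩, fun C => ?_⟩
  · change M.toMatroid✶ = G.toMatroid✶.delete {g}
    rw [h.toMatroid_eq, Matroid.dual_contract]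
  · change M.IsSignedCocircuit Y ↔ G.IsSignedCocircuit Y ∧ Y g = 0
    constructor
    · intro hY
      have hYg := hY.eq_zero hg
      refine ⟨?_, hYg⟩
      obtain ⟨Y', hY', hs⟩ := G.exists_signedCocircuit ((hcoc _).1 hY.1).1
      have hY'g : Y' g = 0 := by
        rw [← notMem_support, hs]; simpa using hYg
      have hM : M.IsSignedCocircuit Y' :=
        ⟨by rw [hs]; exact hY.1, fun X hX => h.orthogonal_of_circuit hX hY' hY'g⟩
      rcases M.isOrthogonalPair.cocircuit_eq_or_eq_neg hY hM hs.symm with rfl | rfl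
      · exact hY'
      · exact G.neg_signedCocircuit hY'
    · rintro ⟨hY, hYg⟩
      exact ⟨(hcoc _).2 ⟨hY.1, by simpa using hYg⟩,
        fun X hX => h.orthogonal_of_circuit hX hY hYg⟩
  · change (G.IsCocircuit C ∧ g ∈ C) ↔ ∃ B, M.toMatroid✶.IsBase B ∧ C = insert g B
    rw [h.2 C]
    constructor
    · rintro ⟨B, hB, rfl⟩
      exact ⟨M.E \ B, hB.compl_isBase_dual, rfl⟩
    · rintro ⟨B, hB, rfl⟩
      refine ⟨M.E \ B, hB.compl_isBase_of_dual, ?_⟩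
      rw [sdiff_sdiff_cancel_left]
      exact hB.subset_ground

theorem notMem (h : M.IsGenericLifting g G) : g ∉ M.E := h.dual.notMem

theorem mem (h : M.IsGenericLifting g G) : g ∈ G.E := h.dual.mem

theorem ground_eq (h : M.IsGenericLifting g G) : G.E = insert g M.E := h.dual.ground_eq

theorem isCocircuit_insert (h : M.IsGenericLifting g G) {B : Set α} (hB : M.IsBase B) :
    G.IsCocircuit (insert g (M.E \ B)) :=
  ((h.2 _).2 ⟨B, hB, rfl⟩).1

theorem isNonloop (h : M.IsGenericLifting g G) : G.IsNonloop g := by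
  obtain ⟨B, hB⟩ := M.exists_isBase
  exact (h.isCocircuit_insert hB).isNonloop_of_mem (mem_insert _ _)

theorem indep_iff (h : M.IsGenericLifting g G) {I : Set α} :
    M.Indep I ↔ g ∉ I ∧ G.Indep (insert g I) := by
  rw [h.toMatroid_eq, h.isNonloop.contractElem_indep_iff]

theorem isBase_iff (h : M.IsGenericLifting g G) {B : Set α} :
    M.IsBase B ↔ G.IsBase (insert g B) ∧ g ∉ B := by
  rw [h.toMatroid_eq, h.isNonloop.indep.contract_isBase_iff, union_singleton,
    Set.disjoint_singleton_right]

theorem isSignedCocircuit_iff (h : M.IsGenericLifting g G) {Y : α → SignType} :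
    M.IsSignedCocircuit Y ↔ G.IsSignedCocircuit Y ∧ Y g = 0 :=
  h.dual.isSignedCircuit_iff

theorem exists_lifting (h : M.IsGenericLifting g G) {C : Set α} (hC : M.IsCircuit C) :
    ∃ X, M.IsSignedCircuit X ∧ support X = C ∧ G.IsSignedCircuit (withSign X g 1) := by
  simpa only [dual_isSignedCocircuit_iff] using h.dual.exists_extension hC.isCocircuit

theorem exists_sign (h : M.IsGenericLifting g G) {X : α → SignType}
    (hX : M.IsSignedCircuit X) : ∃ s, s ≠ 0 ∧ G.IsSignedCircuit (withSign X g s) := by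
  simpa only [dual_isSignedCocircuit_iff] using h.dual.exists_sign
    (M.dual_isSignedCocircuit_iff.2 hX)

theorem liftingSignature_spec (h : M.IsGenericLifting g G) {C : Set α} (hC : M.IsCircuit C) :
    M.IsSignedCircuit (M.liftingSignature g G C) ∧ support (M.liftingSignature g G C) = C ∧
      G.IsSignedCircuit (withSign (M.liftingSignature g G C) g 1) :=
  Classical.epsilon_spec (h.exists_lifting hC)

/-- Signed circuits of a lifting, restricted to the ground set, are orthogonal to cocircuits. -/
theorem orthogonal_of_lifted (h : M.IsGenericLifting g G) {X Y : α → SignType}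
    (hX : G.IsSignedCircuit X) (hY : M.IsSignedCocircuit Y) : Orthogonal X Y :=
  (h.isSignedCocircuit_iff.1 hY).1.2 X hX

end IsGenericLifting
end OrientedMatroid

namespace OrientedMatroid
variable {α : Type*}

/-! ### Reorientation signs -/

open Classical in
/-- The signs of the elements in the reorientation of `A`. -/
noncomputable def reorientSign (A : Set α) (e : α) : SignType := if e ∈ A then -1 else 1

theorem reorientSign_ne_zero (A : Set α) (e : α) : reorientSign A e ≠ 0 := by
  unfold reorientSign; split_ifs <;> decide

theorem reorientSign_of_notMem {A : Set α} {e : α} (h : e ∉ A) : reorientSign A e = 1 := by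
  simp [reorientSign, h]

theorem reorientSign_eq_neg_one_iff {A : Set α} {e : α} : reorientSign A e = -1 ↔ e ∈ A := by
  unfold reorientSign; split_ifs with h <;> simp [h]

theorem flip_apply (A : Set α) (X : α → SignType) (e : α) :
    flip A X e = reorientSign A e * X e := by
  unfold flip reorientSign; split_ifs <;> simp

theorem orthogonal_flip_iff (A : Set α) (X Y : α → SignType) :
    Orthogonal (flip A X) (flip A Y) ↔ Orthogonal X Y := by
  have : ∀ e, flip A X e * flip A Y e = X e * Y e := by
    intro e
    rw [flip_apply, flip_apply, mul_mul_mul_comm, sign_mul_self (reorientSign_ne_zero A e),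
      one_mul]
  simp only [Orthogonal, this]

theorem reorient_isSignedCocircuit_iff (M : OrientedMatroid α) (A : Set α) {Y : α → SignType} :
    (M.reorient A).IsSignedCocircuit Y ↔ M.IsSignedCocircuit (flip A Y) := by
  unfold IsSignedCocircuit
  rw [support_flip]
  refine and_congr Iff.rfl ⟨fun h X hX => ?_, fun h X hX => ?_⟩
  · have := h (flip A X) (show M.IsSignedCircuit (flip A (flip A X)) by rwa [flip_flip])
    rwa [← orthogonal_flip_iff A, flip_flip] at this
  · rw [← orthogonal_flip_iff A]
    exact h _ hX

theorem flip_withSign {A : Set α} {f : α} (hf : f ∉ A) (X : α → SignType) (s : SignType) :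
    flip A (withSign X f s) = withSign (flip A X) f s := by
  funext x
  by_cases hx : x = f
  · subst hx; simp [flip, hf]
  · rw [withSign_of_ne _ _ hx, flip_apply, flip_apply, withSign_of_ne _ _ hx]

theorem positive_flip_iff {A : Set α} {X : α → SignType} :
    Positive (flip A X) ↔ ∀ x, X x = 0 ∨ X x = reorientSign A x := by
  refine forall_congr' fun x => ?_
  rw [flip_apply]
  have := reorientSign_ne_zero A x
  generalize reorientSign A x = a, X x = b at *
  revert a b; decide

/-- The sign on the added element is determined: two signings of one support differing only at g are
neither equal nor, because of a further element, opposite. -/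
theorem withSign_inj_of_pair {M : Matroid α} {C D : (α → SignType) → Prop}
    (h : IsOrthogonalPair M C D) {X : α → SignType} {g : α} {s : SignType} (hs : s ≠ 0)
    (h1 : C (withSign X g s)) (h2 : C (withSign X g (-s))) (hX : ∃ x, x ≠ g ∧ X x ≠ 0) : False := by
  have hs' : -s ≠ 0 := by simpa using hs
  rcases h.circuit_eq_or_eq_neg h1 h2
    (by rw [support_withSign _ _ hs, support_withSign _ _ hs']) with h | h
  · have := congrFun h g
    rw [withSign_self, withSign_self] at this
    clear * - this hs
    revert s; decide
  · obtain ⟨x, hx, hX0⟩ := hX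
    have := congrFun h x
    rw [Pi.neg_apply, withSign_of_ne _ _ hx, withSign_of_ne _ _ hx] at this
    generalize X x = a at *
    clear * - this hX0
    revert a; decide

/-- Replaces positivity after reorientation by conformity to the sign vector of A, so that the rest
takes place in M itself. -/
theorem compatibleLifting_iff {M G : OrientedMatroid α} {g : α} (h : M.IsGenericLifting g G)
    {A : Set α} (hA : A ⊆ M.E) : M.CompatibleLifting g G A ↔
      ∀ Z, M.IsSignedCircuit Z → G.IsSignedCircuit (withSign Z g (-1)) →
        ¬ ∀ x, Z x = 0 ∨ Z x = reorientSign A x := by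
  have hgA : g ∉ A := fun hg => h.notMem (hA hg)
  constructor
  · intro hc Z hZ hZg hpos
    have hG : G.IsSignedCircuit (flip A (withSign (flip A Z) g 1)) :=
      hc (flip A Z) (show M.IsSignedCircuit (flip A (flip A Z)) by rwa [flip_flip])
        (positive_flip_iff.2 hpos)
    rw [flip_withSign hgA, flip_flip] at hG
    obtain ⟨x, hx⟩ := (M.support_isCircuit Z hZ).nonempty
    refine withSign_inj_of_pair G.isOrthogonalPair (s := 1) (by decide) hG hZg ⟨x, ?_, hx⟩
    rintro rfl
    exact h.notMem ((M.support_isCircuit Z hZ).subset_ground hx)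
  · intro hc C hC hpos
    change G.IsSignedCircuit (flip A (withSign C g 1))
    rw [flip_withSign hgA]
    have hC' : M.IsSignedCircuit (flip A C) := hC
    obtain ⟨s, hs, hG⟩ := h.exists_sign hC'
    rcases sign_eq_or_eq_neg hs (t := 1) (by decide) with rfl | rfl
    · exact hG
    · refine absurd ?_ (hc _ hC' hG)
      exact positive_flip_iff.1 (by rwa [flip_flip])

theorem compatibleExtension_iff {M F : OrientedMatroid α} {f : α} (h : M.IsGenericExtension f F)
    {A : Set α} (hA : A ⊆ M.E) : M.CompatibleExtension f F A ↔
      ∀ W, M.IsSignedCocircuit W → F.IsSignedCocircuit (withSign W f (-1)) →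
        ¬ ∀ x, W x = 0 ∨ W x = reorientSign A x := by
  have hfA : f ∉ A := fun hf => h.notMem (hA hf)
  constructor
  · intro hc Z hZ hZf hpos
    have hF := hc (flip A Z) ((reorient_isSignedCocircuit_iff _ _).2 (by rwa [flip_flip]))
        (positive_flip_iff.2 hpos)
    rw [reorient_isSignedCocircuit_iff, flip_withSign hfA, flip_flip] at hF
    obtain ⟨x, hx⟩ := hZ.1.nonempty
    refine withSign_inj_of_pair F.isOrthogonalPair.dual (s := 1) (by decide) hF hZf ⟨x, ?_, hx⟩
    rintro rfl
    exact h.notMem (hZ.1.subset_ground hx)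
  · intro hc C hC hpos
    rw [reorient_isSignedCocircuit_iff] at hC ⊢
    rw [flip_withSign hfA]
    obtain ⟨s, hs, hF⟩ := h.exists_sign hC
    rcases sign_eq_or_eq_neg hs (t := 1) (by decide) with rfl | rfl
    · exact hF
    · refine absurd ?_ (hc _ hC hF)
      exact positive_flip_iff.1 (by rwa [flip_flip])

/-! ### The bijection between bases and compatible reorientations -/

/-- `X` is the signed circuit of the extension supported by `B ∪ f`, negative on `f`, and `Y` is the
signed cocircuit of the lifting supported by `(E \ B) ∪ g`, negative on `g`. -/
structure IsBasisSigning (M F G : OrientedMatroid α) (f g : α) (B : Set α)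
    (X Y : α → SignType) : Prop where
  isBase : M.IsBase B
  circuit : F.IsSignedCircuit X
  support_circuit : support X = insert f B
  circuit_apply : X f = -1
  cocircuit : G.IsSignedCocircuit Y
  support_cocircuit : support Y = insert g (M.E \ B)
  cocircuit_apply : Y g = -1

variable {M F G : OrientedMatroid α} {f g : α}

theorem exists_isBasisSigning (hf : M.IsGenericExtension f F) (hg : M.IsGenericLifting g G)
    {B : Set α} (hB : M.IsBase B) : ∃ X Y, IsBasisSigning M F G f g B X Y := by
  obtain ⟨X, hX, hXs, hXf⟩ := F.isOrthogonalPair.exists_circuit_sign (hf.isCircuit_insert hB)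
    (mem_insert f B) (s := -1) (by decide)
  obtain ⟨Y, hY, hYs, hYg⟩ := G.isOrthogonalPair.exists_cocircuit_sign (hg.isCocircuit_insert hB)
    (mem_insert g _) (s := -1) (by decide)
  exact ⟨X, Y, hB, hX, hXs, hXf, hY, hYs, hYg⟩

namespace IsBasisSigning

variable {B : Set α} {X Y : α → SignType}

theorem circuit_ne_zero (h : IsBasisSigning M F G f g B X Y) {x : α} (hx : x ∈ B) : X x ≠ 0 := by
  rw [← mem_support, h.support_circuit]; exact mem_insert_of_mem _ hx

theorem cocircuit_ne_zero (h : IsBasisSigning M F G f g B X Y) {x : α} (hxE : x ∈ M.E)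
    (hx : x ∉ B) : Y x ≠ 0 := by
  rw [← mem_support, h.support_cocircuit]; exact mem_insert_of_mem _ ⟨hxE, hx⟩

theorem mem_of_circuit_ne_zero (h : IsBasisSigning M F G f g B X Y) {x : α} (hx : X x ≠ 0)
    (hxf : x ≠ f) : x ∈ B := by
  rw [← mem_support, h.support_circuit] at hx; exact hx.resolve_left hxf

theorem mem_of_cocircuit_ne_zero (h : IsBasisSigning M F G f g B X Y) {x : α} (hx : Y x ≠ 0)
    (hxg : x ≠ g) : x ∈ M.E ∧ x ∉ B := by
  rw [← mem_support, h.support_cocircuit] at hx; exact hx.resolve_left hxg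

/-- The product at g is (-1)(-1) = 1, so some product is -1; it occurs off B in E, where Z and Y
then disagree. -/
theorem not_conformal_lifted (h : IsBasisSigning M F G f g B X Y) {Z : α → SignType}
    (hZ : G.IsSignedCircuit (withSign Z g (-1))) :
    ¬ ∀ x ∈ M.E, x ∉ B → Z x ≠ 0 → Z x = Y x := by
  intro hc
  obtain ⟨x, hx⟩ := (h.cocircuit.2 _ hZ).1 ⟨g, by rw [withSign_self, h.cocircuit_apply]; decide⟩
  by_cases hxg : x = g
  · subst hxg
    rw [withSign_self, h.cocircuit_apply] at hx
    exact absurd hx (by decide)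
  · rw [withSign_of_ne _ _ hxg] at hx
    have hx0 : Z x * Y x ≠ 0 := by rw [hx]; decide
    have hm := h.mem_of_cocircuit_ne_zero (right_ne_zero_of_mul hx0) hxg
    rw [hc x hm.1 hm.2 (left_ne_zero_of_mul hx0),
      sign_mul_self (right_ne_zero_of_mul hx0)] at hx
    exact absurd hx (by decide)

theorem not_conformal_extended (h : IsBasisSigning M F G f g B X Y) {W : α → SignType}
    (hW : F.IsSignedCocircuit (withSign W f (-1))) :
    ¬ ∀ x ∈ B, W x ≠ 0 → W x = X x := by
  intro hc
  obtain ⟨x, hx⟩ := (hW.2 _ h.circuit).1 ⟨f, by rw [withSign_self, h.circuit_apply]; decide⟩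
  by_cases hxf : x = f
  · subst hxf
    rw [withSign_self, h.circuit_apply] at hx
    exact absurd hx (by decide)
  · rw [withSign_of_ne _ _ hxf] at hx
    have hx0 : X x * W x ≠ 0 := by rw [hx]; decide
    rw [hc x (h.mem_of_circuit_ne_zero (left_ne_zero_of_mul hx0) hxf) (right_ne_zero_of_mul hx0),
      sign_mul_self (left_ne_zero_of_mul hx0)] at hx
    exact absurd hx (by decide)

/-- Eliminating f between X₁ and -X₂ gives a circuit Z of M that is X₁ = Y₂ off B₂ and -X₂ = -Y₁ off
B₁. If Z lifts with 1 on g, then -Z contradicts Y₁; if with -1, Z contradicts Y₂. -/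
theorem eq_of_agree (hf : M.IsGenericExtension f F) (hg : M.IsGenericLifting g G)
    {B₁ B₂ : Set α} {X₁ Y₁ X₂ Y₂ : α → SignType}
    (h₁ : IsBasisSigning M F G f g B₁ X₁ Y₁) (h₂ : IsBasisSigning M F G f g B₂ X₂ Y₂)
    (h12 : ∀ e ∈ B₁, e ∉ B₂ → X₁ e = Y₂ e) (h21 : ∀ e ∈ B₂, e ∉ B₁ → X₂ e = Y₁ e) :
    B₁ = B₂ := by
  by_contra hne
  have hfB : ∀ {B}, M.IsBase B → f ∉ B := fun hB h => hf.notMem (hB.subset_ground h)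
  obtain ⟨Z, hZ, hZf, hZx⟩ := F.elimination X₁ (-X₂) f h₁.circuit (F.neg_signed _ h₂.circuit)
    (by
      rw [neg_neg]
      rintro rfl
      apply hne
      have := h₁.support_circuit.symm.trans h₂.support_circuit
      rw [← insert_sdiff_self_of_notMem (hfB h₁.isBase), this,
        insert_sdiff_self_of_notMem (hfB h₂.isBase)])
    (by rw [h₁.circuit_apply]; decide) (by rw [Pi.neg_apply, h₁.circuit_apply, h₂.circuit_apply])
  have hZM := hf.isSignedCircuit_iff.2 ⟨hZ, hZf⟩
  have hZne : ∀ {x}, Z x ≠ 0 → x ≠ f := by rintro x hx rfl; exact hx hZf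
  obtain ⟨s, hs, hG⟩ := hg.exists_sign hZM
  rcases sign_eq_or_eq_neg hs (t := 1) (by decide) with rfl | rfl
  · refine h₁.not_conformal_lifted (Z := -Z) (by rw [← neg_withSign]; exact G.neg_signed _ hG)
      fun x hxE hxB hx => ?_
    replace hx : Z x ≠ 0 := by simpa using hx
    rcases hZx x hx with h | h
    · exact absurd (h₁.mem_of_circuit_ne_zero (h ▸ hx) (hZne hx)) hxB
    · have : X₂ x ≠ 0 := by rw [h] at hx; simpa using hx
      rw [Pi.neg_apply, h, Pi.neg_apply, neg_neg]
      exact h21 x (h₂.mem_of_circuit_ne_zero this (hZne hx)) hxB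
  · refine h₂.not_conformal_lifted hG fun x hxE hxB hx => ?_
    rcases hZx x hx with h | h
    · rw [h]
      exact h12 x (h₁.mem_of_circuit_ne_zero (h ▸ hx) (hZne hx)) hxB
    · have : X₂ x ≠ 0 := by rw [h] at hx; simpa using hx
      exact absurd (h₂.mem_of_circuit_ne_zero this (hZne hx)) hxB

end IsBasisSigning

/-- If the elements of `U` have prescribed signs `ε`, those of `S` are contracted and all others are
deleted, and the resulting reorientation is compatible, then it comes from a basis. -/
theorem exists_basis_of_compatible (hf : M.IsGenericExtension f F) (hg : M.IsGenericLifting g G)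
    {ε : α → SignType} (hε : ∀ x, ε x ≠ 0) {U : Set α} (hU : U.Finite) (hUE : U ⊆ M.E)
    (S : Set α) (hSE : S ⊆ M.E) (hSU : ∀ x ∈ U, x ∉ S)
    (ha : ∀ Z, M.IsSignedCircuit Z → G.IsSignedCircuit (withSign Z g (-1)) →
      (∀ x, x ∉ S → x ∉ U → Z x = 0) → ¬ ∀ x ∈ U, Z x = 0 ∨ Z x = ε x)
    (hc : ∀ W, M.IsSignedCocircuit W → F.IsSignedCocircuit (withSign W f (-1)) →
      (∀ x ∈ S, W x = 0) → ¬ ∀ x ∈ U, W x = 0 ∨ W x = ε x) :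
    ∃ B X Y, IsBasisSigning M F G f g B X Y ∧ S ⊆ B ∧ B ⊆ S ∪ U ∧
      ∀ x ∈ U, (x ∈ B → X x = ε x) ∧ (x ∉ B → Y x = ε x) := by
  induction U, hU using Set.Finite.induction_on generalizing S with
  | empty =>
    -- With nothing prescribed, the hypotheses say that S contains no circuit and E \ S no
    -- cocircuit, so S is a basis.
    have hind : M.Indep S := by
      rw [Matroid.indep_iff_forall_subset_not_isCircuit hSE]
      intro K hKS hK
      obtain ⟨Z, hZ, rfl, hZG⟩ := hg.exists_lifting hK
      refine ha (-Z) (M.neg_signed Z hZ) (by rw [← neg_withSign]; exact G.neg_signed _ hZG)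
        (fun x hxS _ => ?_) (by simp)
      by_contra hx
      exact hxS (hKS (by simpa using hx))
    have hco : M.Coindep (M.E \ S) := by
      rw [Matroid.coindep_iff_forall_subset_not_isCocircuit]
      refine ⟨fun K hKS hK => ?_, sdiff_subset⟩
      obtain ⟨W, hW, rfl, hWF⟩ := hf.exists_extension hK
      refine hc (-W) (M.neg_signedCocircuit hW)
        (by rw [← neg_withSign]; exact F.neg_signedCocircuit hWF) (fun x hxS => ?_) (by simp)
      by_contra hx
      exact (hKS (show x ∈ support W by simpa using hx)).2 hxS
    have hB : M.IsBase S := by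
      refine hind.isBase_of_spanning ?_
      have := hco.compl_spanning
      rwa [sdiff_sdiff_cancel_left hSE] at this
    obtain ⟨X, Y, h⟩ := exists_isBasisSigning hf hg hB
    exact ⟨S, X, Y, h, subset_rfl, by simp, by simp⟩
  | @insert e U heU _ ih =>
    have heS : e ∉ S := hSU e (mem_insert _ _)
    have heE : e ∈ M.E := hUE (mem_insert _ _)
    have hUE' : U ⊆ M.E := (subset_insert _ _).trans hUE
    have hSU' : ∀ x ∈ U, x ∉ S := fun x hx => hSU x (mem_insert_of_mem _ hx)
    -- Deleting e preserves the circuit condition and contracting e preserves the cocircuit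
    -- condition. Only the other condition can fail in each minor, and a witness of failure has sign
    -- -ε e at e.
    have ha0 : ∀ Z, M.IsSignedCircuit Z → G.IsSignedCircuit (withSign Z g (-1)) →
        (∀ x, x ∉ S → x ∉ U → Z x = 0) → ¬ ∀ x ∈ U, Z x = 0 ∨ Z x = ε x := by
      intro Z hZ hZG h1 h2
      refine ha Z hZ hZG (fun x hx hxU => h1 x hx fun h => hxU (mem_insert_of_mem _ h)) ?_
      rintro x (rfl | hx)
      · exact Or.inl (h1 x heS heU)
      · exact h2 x hx
    have hc0 : ∀ W, M.IsSignedCocircuit W → F.IsSignedCocircuit (withSign W f (-1)) →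
        (∀ x ∈ insert e S, W x = 0) → ¬ ∀ x ∈ U, W x = 0 ∨ W x = ε x := by
      intro W hW hWF h1 h2
      refine hc W hW hWF (fun x hx => h1 x (mem_insert_of_mem _ hx)) ?_
      rintro x (rfl | hx)
      · exact Or.inl (h1 x (mem_insert _ _))
      · exact h2 x hx
    have contracted := ih hUE' (insert e S) (insert_subset heE hSE)
      (by rintro x hx (rfl | h); exacts [heU hx, hSU' x hx h])
    have deleted := ih hUE' S hSE hSU' ha0
    have agree_insert : ∀ {B : Set α} {X Y : α → SignType},
        (∀ x ∈ U, (x ∈ B → X x = ε x) ∧ (x ∉ B → Y x = ε x)) →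
        ((e ∈ B → X e = ε e) ∧ (e ∉ B → Y e = ε e)) →
        ∀ x ∈ insert e U, (x ∈ B → X x = ε x) ∧ (x ∉ B → Y x = ε x) := by
      rintro B X Y h1 h2 x (rfl | hx)
      · exact h2
      · exact h1 x hx
    have hsub1 : insert e S ∪ U = S ∪ insert e U := by
      rw [insert_union, union_insert]
    have hsub2 : S ∪ U ⊆ S ∪ insert e U := union_subset_union_right _ (subset_insert _ _)
    by_cases ha' : ∀ Z, M.IsSignedCircuit Z → G.IsSignedCircuit (withSign Z g (-1)) →
        (∀ x, x ∉ insert e S → x ∉ U → Z x = 0) → ¬ ∀ x ∈ U, Z x = 0 ∨ Z x = ε x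
    · obtain ⟨B₁, X₁, Y₁, h₁, hS₁, hU₁, hε₁⟩ := contracted ha' hc0
      have he₁ : e ∈ B₁ := hS₁ (mem_insert _ _)
      by_cases hX₁ : X₁ e = ε e
      · exact ⟨B₁, X₁, Y₁, h₁, (subset_insert _ _).trans hS₁, hsub1 ▸ hU₁,
          agree_insert hε₁ ⟨fun _ => hX₁, fun h => absurd he₁ h⟩⟩
      have hX₁' := (sign_eq_or_eq_neg (h₁.circuit_ne_zero he₁) (hε e)).resolve_left hX₁
      by_cases hc' : ∀ W, M.IsSignedCocircuit W → F.IsSignedCocircuit (withSign W f (-1)) →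
          (∀ x ∈ S, W x = 0) → ¬ ∀ x ∈ U, W x = 0 ∨ W x = ε x
      · obtain ⟨B₂, X₂, Y₂, h₂, hS₂, hU₂, hε₂⟩ := deleted hc'
        have he₂ : e ∉ B₂ := fun h => (hU₂ h).elim heS heU
        by_cases hY₂ : Y₂ e = ε e
        · exact ⟨B₂, X₂, Y₂, h₂, hS₂, hU₂.trans hsub2,
            agree_insert hε₂ ⟨fun h => absurd h he₂, fun _ => hY₂⟩⟩
        have hY₂' := (sign_eq_or_eq_neg (h₂.cocircuit_ne_zero heE he₂) (hε e)).resolve_left hY₂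
        -- Both bases realise ε with its sign at e reversed, so injectivity would identify them,
        -- although only B₁ contains e.
        have : B₁ = B₂ := by
          refine IsBasisSigning.eq_of_agree hf hg h₁ h₂ (fun x hx1 hx2 => ?_) fun x hx2 hx1 => ?_
          · by_cases hxe : x = e
            · rw [hxe, hX₁', hY₂']
            have hxU : x ∈ U := by
              rcases hU₁ hx1 with (h | h) | h
              exacts [absurd h hxe, absurd (hS₂ h) hx2, h]
            rw [(hε₁ x hxU).1 hx1, (hε₂ x hxU).2 hx2]
          · have hxU : x ∈ U := by
              rcases hU₂ hx2 with h | h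
              exacts [absurd (hS₁ (mem_insert_of_mem _ h)) hx1, h]
            rw [(hε₂ x hxU).1 hx2, (hε₁ x hxU).2 hx1]
        exact absurd (this ▸ he₁) he₂
      · exfalso
        push Not at hc'
        obtain ⟨W, hW, hWF, hWS, hWU⟩ := hc'
        have hWe : W e ≠ 0 ∧ W e ≠ ε e := by
          rw [← not_or]
          intro h
          refine hc W hW hWF hWS ?_
          rintro x (rfl | hx)
          exacts [h, hWU x hx]
        refine h₁.not_conformal_extended hWF fun x hxB hx => ?_
        rcases hU₁ hxB with (rfl | h) | h
        · rw [hX₁']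
          exact (sign_eq_or_eq_neg hWe.1 (hε x)).resolve_left hWe.2
        · exact absurd (hWS x h) hx
        · rw [(hε₁ x h).1 hxB]
          exact (hWU x h).resolve_left hx
    · push Not at ha'
      obtain ⟨Z, hZ, hZG, hZS, hZU⟩ := ha'
      have hZe : Z e ≠ 0 ∧ Z e ≠ ε e := by
        rw [← not_or]
        intro h
        refine ha Z hZ hZG (fun x hxS hxU => ?_) ?_
        · rw [mem_insert_iff, not_or] at hxU
          exact hZS x (by simp [hxS, hxU.1]) hxU.2
        · rintro x (rfl | hx)
          exacts [h, hZU x hx]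
      have hZe' := (sign_eq_or_eq_neg hZe.1 (hε e)).resolve_left hZe.2
      by_cases hc' : ∀ W, M.IsSignedCocircuit W → F.IsSignedCocircuit (withSign W f (-1)) →
          (∀ x ∈ S, W x = 0) → ¬ ∀ x ∈ U, W x = 0 ∨ W x = ε x
      · obtain ⟨B₂, X₂, Y₂, h₂, hS₂, hU₂, hε₂⟩ := deleted hc'
        have he₂ : e ∉ B₂ := fun h => (hU₂ h).elim heS heU
        refine ⟨B₂, X₂, Y₂, h₂, hS₂, hU₂.trans hsub2,
            agree_insert hε₂ ⟨fun h => absurd h he₂, fun _ => ?_⟩⟩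
        by_contra hY₂
        have hY₂' := (sign_eq_or_eq_neg (h₂.cocircuit_ne_zero heE he₂) (hε e)).resolve_left hY₂
        refine h₂.not_conformal_lifted hZG fun x hxE hxB hx => ?_
        by_cases hxe : x = e
        · rw [hxe, hZe', hY₂']
        by_cases hxU : x ∈ U
        · rw [(hε₂ x hxU).2 hxB]
          exact (hZU x hxU).resolve_left hx
        · refine absurd (hZS x ?_ hxU) hx
          rintro (h | h)
          exacts [hxe h, hxB (hS₂ h)]
      · exfalso
        push Not at hc'
        obtain ⟨W, hW, hWF, hWS, hWU⟩ := hc'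
        have hWe : W e ≠ 0 ∧ W e ≠ ε e := by
          rw [← not_or]
          intro h
          refine hc W hW hWF hWS ?_
          rintro x (rfl | hx)
          exacts [h, hWU x hx]
        have hWe' := (sign_eq_or_eq_neg hWe.1 (hε e)).resolve_left hWe.2
        -- Both minors cannot fail: the witnesses Z and W share the sign -ε e at e and agree
        -- wherever both are nonzero, which violates orthogonality.
        obtain ⟨x, hx⟩ := (hW.2 Z hZ).1 ⟨e, by rw [hZe', ← hWe', sign_mul_self hWe.1]⟩
        have hx0 : Z x * W x ≠ 0 := by rw [hx]; decide
        have : Z x = W x := by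
          by_cases hxe : x = e
          · rw [hxe, hZe', hWe']
          by_cases hxU : x ∈ U
          · rw [(hZU x hxU).resolve_left (left_ne_zero_of_mul hx0),
              (hWU x hxU).resolve_left (right_ne_zero_of_mul hx0)]
          · by_cases hxS : x ∈ S
            · exact absurd (hWS x hxS) (right_ne_zero_of_mul hx0)
            · exact absurd (hZS x (by simp [hxe, hxS]) hxU) (left_ne_zero_of_mul hx0)
        rw [this, sign_mul_self (right_ne_zero_of_mul hx0)] at hx
        exact absurd hx (by decide)

/-- The lift of C(B;e) lies in B ∪ {e, g} and Y vanishes on B, so they meet only in e and g, where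
the signs at g are known. -/
theorem IsBasisSigning.liftingSignature_apply (hg : M.IsGenericLifting g G) {B : Set α}
    {X Y : α → SignType} (h : IsBasisSigning M F G f g B X Y) {e : α} (heE : e ∈ M.E)
    (heB : e ∉ B) : M.liftingSignature g G (M.fundCircuit e B) e = Y e := by
  have hC := h.isBase.fundCircuit_isCircuit heE heB
  obtain ⟨-, hs, hG⟩ := hg.liftingSignature_spec hC
  generalize M.liftingSignature g G (M.fundCircuit e B) = V at *
  have heg : e ≠ g := by rintro rfl; exact hg.notMem heE
  have := (h.cocircuit.2 _ hG).eq_neg_of_pair (a := e) (b := g) fun x hx hY => by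
    by_cases hxg : x = g
    · exact Or.inr hxg
    rw [withSign_of_ne _ _ hxg] at hx
    have hxs : x ∈ M.fundCircuit e B := hs ▸ hx
    rcases M.fundCircuit_subset_insert e B hxs with h' | h'
    · exact Or.inl h'
    · exact absurd h' (h.mem_of_cocircuit_ne_zero hY hxg).2
  rw [withSign_of_ne _ _ heg, withSign_self, h.cocircuit_apply] at this
  exact sign_eq_of_mul_eq_one (by rw [this]; decide)

theorem IsBasisSigning.extensionSignature_apply (hf : M.IsGenericExtension f F) {B : Set α}
    {X Y : α → SignType} (h : IsBasisSigning M F G f g B X Y) {e : α}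
    (heB : e ∈ B) : M.extensionSignature f F (M.fundCocircuit e B) e = X e := by
  have hC := Matroid.fundCocircuit_isCocircuit heB h.isBase
  obtain ⟨-, hs, hF⟩ := hf.extensionSignature_spec hC
  generalize M.extensionSignature f F (M.fundCocircuit e B) = V at *
  have hef : e ≠ f := by rintro rfl; exact hf.notMem (h.isBase.subset_ground heB)
  have := (hF.2 _ h.circuit).eq_neg_of_pair (a := e) (b := f) fun x hX hx => by
    by_cases hxf : x = f
    · exact Or.inr hxf
    rw [withSign_of_ne _ _ hxf] at hx
    have hxs : x ∈ M.fundCocircuit e B := hs ▸ hx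
    rcases M.fundCocircuit_subset_insert_compl e B hxs with h' | h'
    · exact Or.inl h'
    · exact absurd (h.mem_of_circuit_ne_zero hX hxf) h'.2
  rw [withSign_of_ne _ _ hef, withSign_self, h.circuit_apply] at this
  exact (sign_eq_of_mul_eq_one (by rw [this]; decide)).symm

theorem IsBasisSigning.basisReorientation_eq_iff (hf : M.IsGenericExtension f F)
    (hg : M.IsGenericLifting g G) {B : Set α} {X Y : α → SignType}
    (h : IsBasisSigning M F G f g B X Y) {A : Set α} (hA : A ⊆ M.E) :
    M.basisReorientation (M.extensionSignature f F) (M.liftingSignature g G) B = A ↔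
      ∀ e ∈ M.E, (e ∈ B → X e = reorientSign A e) ∧ (e ∉ B → Y e = reorientSign A e) := by
  have hmem : ∀ e ∈ M.E,
      (e ∈ M.basisReorientation (M.extensionSignature f F) (M.liftingSignature g G) B ↔
        (e ∉ B ∧ Y e = -1) ∨ (e ∈ B ∧ X e = -1)) := by
    intro e heE
    simp only [basisReorientation, mem_ofPred_eq, heE, true_and]
    by_cases heB : e ∈ B
    · simp [heB, h.extensionSignature_apply hf heB]
    · simp [heB, h.liftingSignature_apply hg heE heB]
  have hsign : ∀ {a b : SignType}, a ≠ 0 → b ≠ 0 → ((a = -1 ↔ b = -1) ↔ a = b) := by decide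
  have hE : M.basisReorientation (M.extensionSignature f F) (M.liftingSignature g G) B = A ↔
      ∀ e ∈ M.E, (e ∈ M.basisReorientation (M.extensionSignature f F)
        (M.liftingSignature g G) B ↔ e ∈ A) := by
    constructor
    · rintro rfl e -; rfl
    · intro h'
      ext e
      by_cases heE : e ∈ M.E
      · exact h' e heE
      · exact iff_of_false (fun h => heE h.1) fun h => heE (hA h)
  rw [hE]
  refine forall₂_congr fun e heE => ?_
  rw [hmem e heE, ← reorientSign_eq_neg_one_iff (A := A)]
  by_cases heB : e ∈ B
  · simpa [heB] using hsign (h.circuit_ne_zero heB) (reorientSign_ne_zero A e)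
  · simpa [heB] using hsign (h.cocircuit_ne_zero heE heB) (reorientSign_ne_zero A e)

theorem basisReorientation_subset (M : OrientedMatroid α) (σs σ : Set α → α → SignType)
    (B : Set α) : M.basisReorientation σs σ B ⊆ M.E :=
  fun _ h => h.1

theorem bijOn_basisReorientation (hf : M.IsGenericExtension f F) (hg : M.IsGenericLifting g G) :
    Set.BijOn (M.basisReorientation (M.extensionSignature f F) (M.liftingSignature g G))
      {B | M.IsBase B} (M.compatibleReorientations f F g G) := by
  refine ⟨fun B hB => ?_, fun B₁ hB₁ B₂ hB₂ heq => ?_, fun A hA => ?_⟩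
  · obtain ⟨X, Y, h⟩ := exists_isBasisSigning hf hg hB
    have hA := M.basisReorientation_subset (M.extensionSignature f F) (M.liftingSignature g G) B
    have hs := (h.basisReorientation_eq_iff hf hg hA).1 rfl
    refine ⟨hA, (compatibleExtension_iff hf hA).2 fun W _ hWF hpos => ?_,
      (compatibleLifting_iff hg hA).2 fun Z _ hZG hpos => ?_⟩
    · refine h.not_conformal_extended hWF fun x hxB hx => ?_
      rw [(hs x (h.isBase.subset_ground hxB)).1 hxB]
      exact (hpos x).resolve_left hx
    · refine h.not_conformal_lifted hZG fun x hxE hxB hx => ?_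
      rw [(hs x hxE).2 hxB]
      exact (hpos x).resolve_left hx
  · obtain ⟨X₁, Y₁, h₁⟩ := exists_isBasisSigning hf hg hB₁
    obtain ⟨X₂, Y₂, h₂⟩ := exists_isBasisSigning hf hg hB₂
    have hA := M.basisReorientation_subset (M.extensionSignature f F) (M.liftingSignature g G) B₁
    have hs₁ := (h₁.basisReorientation_eq_iff hf hg hA).1 rfl
    have hs₂ := (h₂.basisReorientation_eq_iff hf hg hA).1 heq.symm
    refine IsBasisSigning.eq_of_agree hf hg h₁ h₂ (fun x hx1 hx2 => ?_) fun x hx2 hx1 => ?_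
    · have hxE := h₁.isBase.subset_ground hx1
      rw [(hs₁ x hxE).1 hx1, (hs₂ x hxE).2 hx2]
    · have hxE := h₂.isBase.subset_ground hx2
      rw [(hs₂ x hxE).1 hx2, (hs₁ x hxE).2 hx1]
  · obtain ⟨hAE, hAF, hAG⟩ := hA
    rw [compatibleExtension_iff hf hAE] at hAF
    rw [compatibleLifting_iff hg hAE] at hAG
    obtain ⟨B, X, Y, h, -, -, hs⟩ := exists_basis_of_compatible hf hg
      (reorientSign_ne_zero A) M.ground_finite subset_rfl ∅ (empty_subset _) (by simp)
      (fun Z hZ hZG h0 hpos => hAG Z hZ hZG fun x => by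
        by_cases hxE : x ∈ M.E
        · exact hpos x hxE
        · exact Or.inl (h0 x (by simp) hxE))
      (fun W hW hWF _ hpos => hAF W hW hWF fun x => by
        by_cases hxE : x ∈ M.E
        · exact hpos x hxE
        · exact Or.inl (hW.eq_zero hxE))
    exact ⟨B, h.isBase, (h.basisReorientation_eq_iff hf hg hAE).2 hs⟩

end OrientedMatroid

namespace OrientedMatroid
variable {α : Type*} {M F G N : OrientedMatroid α} {f g : α} {A : Set α}

/-! ### Fully optimal bases of compliant extension-liftings -/

theorem reorient_reorient_isSignedCircuit_iff (S : Set α) {X : α → SignType} :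
    ((N.reorient A).reorient S).IsSignedCircuit (flip S (flip A X)) ↔ N.IsSignedCircuit X := by
  change N.IsSignedCircuit (flip A (flip S (flip S (flip A X)))) ↔ _
  rw [flip_flip, flip_flip]

theorem reorient_reorient_isSignedCocircuit_iff (S : Set α) {X : α → SignType} :
    ((N.reorient A).reorient S).IsSignedCocircuit (flip S (flip A X)) ↔ N.IsSignedCocircuit X := by
  rw [reorient_isSignedCocircuit_iff, reorient_isSignedCocircuit_iff, flip_flip, flip_flip]

theorem exists_eq_flip_flip (A S : Set α) (X : α → SignType) : ∃ V, X = flip S (flip A V) :=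
  ⟨flip A (flip S X), by rw [flip_flip, flip_flip]⟩

theorem flip_pair_apply_left {f g : α} {V : α → SignType} (hfA : f ∉ A) :
    flip {f, g} (flip A V) f = -V f := by
  simp [flip, hfA]

theorem flip_pair_apply_right {f g : α} {V : α → SignType} (hgA : g ∉ A) :
    flip {f, g} (flip A V) g = -V g := by
  simp [flip, hgA]

theorem flip_pair_apply_of_ne {f g e : α} {V : α → SignType} (hf : e ≠ f) (hg : e ≠ g) :
    flip {f, g} (flip A V) e = reorientSign A e * V e := by
  rw [flip_apply, flip_apply, reorientSign_of_notMem (A := {f, g}) (by simp [hf, hg]), one_mul]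

theorem reorientSign_mul_eq_one_iff {e : α} {s : SignType} :
    reorientSign A e * s = 1 ↔ s = reorientSign A e := by
  have := reorientSign_ne_zero A e
  generalize reorientSign A e = a at *
  revert a s; decide

namespace IsGenericExtensionLifting

theorem ground_eq (h : IsGenericExtensionLifting f F g G N) (hg : M.IsGenericLifting g G) :
    N.E = insert f (insert g M.E) := by
  rw [h.1.ground_eq, hg.ground_eq]

/-- Compliance enters only here: were the sign on f equal to 1, the opposite cocircuit would be
positive on g and negative on f. -/
theorem cocircuit_isSignedCocircuit (h : IsGenericExtensionLifting f F g G N)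
    (hcomp : Compliant f g N) (hfg : f ≠ g) {B : Set α} {X Y : α → SignType}
    (hB : IsBasisSigning M F G f g B X Y) : N.IsSignedCocircuit (withSign Y f (-1)) := by
  obtain ⟨s, hs, hN⟩ := h.1.exists_sign hB.cocircuit
  rcases sign_eq_or_eq_neg hs (t := 1) (by decide) with rfl | rfl
  · refine absurd ⟨?_, ?_⟩ (hcomp _ (N.neg_signedCocircuit hN))
    · rw [Pi.neg_apply, withSign_of_ne _ _ hfg.symm, hB.cocircuit_apply, neg_neg]
    · rw [Pi.neg_apply, withSign_self]
  · exact hN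

/-- The extension of X meets that of Y only in f and g, so three known signs give the fourth. -/
theorem circuit_isSignedCircuit (h : IsGenericExtensionLifting f F g G N)
    (hcomp : Compliant f g N) (hfg : f ≠ g) {B : Set α} {X Y : α → SignType}
    (hB : IsBasisSigning M F G f g B X Y) : N.IsSignedCircuit (withSign X g 1) := by
  obtain ⟨s, hs, hN⟩ := h.2.exists_sign hB.circuit
  have hK := h.cocircuit_isSignedCocircuit hcomp hfg hB
  have := (hK.2 _ hN).eq_neg_of_pair (a := g) (b := f) fun x hx hy => by
    by_contra! hxfg
    rw [withSign_of_ne _ _ hxfg.1] at hx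
    rw [withSign_of_ne _ _ hxfg.2] at hy
    exact (hB.mem_of_cocircuit_ne_zero hy hxfg.1).2 (hB.mem_of_circuit_ne_zero hx hxfg.2)
  rw [withSign_self, withSign_self, withSign_of_ne _ _ hfg, withSign_of_ne _ _ hfg.symm,
    hB.circuit_apply, hB.cocircuit_apply] at this
  have hs1 : s = 1 := by
    clear * - this hs
    revert s; decide
  rwa [hs1] at hN

/-- Once reoriented, the cocircuit on Y is positive on f, g and E \ B, so a positive circuit would
avoid it and lie in the independent set B. Likewise X is positive on B ∪ f, so a positive cocircuit
missing g, being a cocircuit of F, would avoid the basis B. -/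
theorem bounded_of_basisSigning [LinearOrder α] (h : IsGenericExtensionLifting f F g G N)
    (hf : M.IsGenericExtension f F)
    (hg : M.IsGenericLifting g G) (hcomp : Compliant f g N) (hfg : f ≠ g) (hA : A ⊆ M.E)
    (hleast : IsLeast N.E g) {B : Set α} {X Y : α → SignType}
    (hB : IsBasisSigning M F G f g B X Y)
    (hs : ∀ e ∈ M.E, (e ∈ B → X e = reorientSign A e) ∧ (e ∉ B → Y e = reorientSign A e)) :
    ((N.reorient A).reorient {f, g}).Bounded := by
  have hfA : f ∉ A := fun h => hf.notMem (hA h)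
  have hgA : g ∉ A := fun h => hg.notMem (hA h)
  have hsign : ∀ {a b : SignType}, a ≠ 0 → a * b ≠ -1 → b * a ≠ -1 := by decide
  have hneg : ∀ {b : SignType}, -b ≠ -1 → b * -1 ≠ -1 := by decide
  refine ⟨fun Z hZ hpos => ?_, fun Z hZ hpos => ⟨g, hleast, fun hZg => ?_⟩⟩
  · obtain ⟨V, rfl⟩ := exists_eq_flip_flip A {f, g} Z
    rw [reorient_reorient_isSignedCircuit_iff] at hZ
    have hzero := ((h.cocircuit_isSignedCocircuit hcomp hfg hB).2 V hZ).mul_eq_zero fun e => by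
      have hpe := hpos e
      by_cases hef : e = f
      · subst hef
        rw [flip_pair_apply_left hfA] at hpe
        rw [withSign_self]
        exact hneg hpe
      rw [withSign_of_ne _ _ hef]
      by_cases heg : e = g
      · subst heg
        rw [flip_pair_apply_right hgA] at hpe
        rw [hB.cocircuit_apply]
        exact hneg hpe
      by_cases hY : Y e = 0
      · rw [hY, mul_zero]; decide
      obtain ⟨heE, heB⟩ := hB.mem_of_cocircuit_ne_zero hY heg
      rw [flip_pair_apply_of_ne hef heg] at hpe
      rw [(hs e heE).2 heB]
      exact hsign (reorientSign_ne_zero A e) hpe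
    refine (N.support_isCircuit V hZ).not_indep
      ((h.1.isBase_iff.1 (hg.isBase_iff.1 hB.isBase).1).1.indep.subset fun e he => ?_)
    have hK : withSign Y f (-1) e = 0 :=
      (mul_eq_zero.1 (hzero e)).resolve_left (mem_support.1 he)
    have hef : e ≠ f := by
      rintro rfl
      rw [withSign_self] at hK
      exact absurd hK (by decide)
    rw [withSign_of_ne _ _ hef] at hK
    have heg : e ≠ g := by
      rintro rfl
      rw [hB.cocircuit_apply] at hK
      exact absurd hK (by decide)
    by_contra heB
    have heN := (N.support_isCircuit V hZ).subset_ground he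
    rw [h.ground_eq hg] at heN
    exact hB.cocircuit_ne_zero ((heN.resolve_left hef).resolve_left heg)
      (fun h => heB (mem_insert_of_mem _ h)) hK
  · obtain ⟨V, rfl⟩ := exists_eq_flip_flip A {f, g} Z
    rw [reorient_reorient_isSignedCocircuit_iff] at hZ
    rw [flip_pair_apply_right hgA] at hZg
    have hVF : F.IsSignedCocircuit V := h.2.isSignedCocircuit_iff.2 ⟨hZ, by simpa using hZg⟩
    have hzero := (hVF.2 X hB.circuit).mul_eq_zero fun e => by
      have hpe := hpos e
      rw [mul_comm]
      by_cases hef : e = f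
      · subst hef
        rw [flip_pair_apply_left hfA] at hpe
        rw [hB.circuit_apply]
        exact hneg hpe
      by_cases hX : X e = 0
      · rw [hX, mul_zero]; decide
      have heB := hB.mem_of_circuit_ne_zero hX hef
      have heE := hB.isBase.subset_ground heB
      have heg : e ≠ g := by rintro rfl; exact hg.notMem heE
      rw [flip_pair_apply_of_ne hef heg] at hpe
      rw [(hs e heE).1 heB]
      exact hsign (reorientSign_ne_zero A e) hpe
    obtain ⟨b, hbV, hbB⟩ :=
      (Matroid.dual_dep_iff_forall.1 hVF.1.isCircuit.dep).1 B (hf.isBase_iff.1 hB.isBase).1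
    exact (mul_eq_zero.1 (hzero b)).elim (hB.circuit_ne_zero hbB) hbV

/-- If g were outside B', it would be the minimum of its own fundamental circuit; if f were in B',
it would be the minimum of its fundamental cocircuit, which misses g. So B' = B ∪ g. For e in E, the
minimum is g in the circuits and f in the cocircuits, and orthogonality with Y and X turns the
required opposite signs into the equations for ε. -/
theorem isFullyOptimal_iff [LinearOrder α] (h : IsGenericExtensionLifting f F g G N)
    (hf : M.IsGenericExtension f F)
    (hg : M.IsGenericLifting g G) (hcomp : Compliant f g N) (hfg : f ≠ g) (hA : A ⊆ M.E)
    (hgf : g < f) (hfE : ∀ e ∈ M.E, f < e) {B' : Set α} :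
    ((N.reorient A).reorient {f, g}).IsFullyOptimal B' ↔
      ∃ B X Y, IsBasisSigning M F G f g B X Y ∧ B' = insert g B ∧
        ∀ e ∈ M.E, (e ∈ B → X e = reorientSign A e) ∧ (e ∉ B → Y e = reorientSign A e) := by
  have hfA : f ∉ A := fun h => hf.notMem (hA h)
  have hgA : g ∉ A := fun h => hg.notMem (hA h)
  have hE := h.ground_eq hg
  have hgN : ∀ e ∈ N.E, g ≤ e := by
    rw [hE]
    rintro e (rfl | rfl | he)
    exacts [hgf.le, le_rfl, (hgf.trans (hfE e he)).le]
  have hfN : ∀ e ∈ N.E, e ≠ g → f ≤ e := by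
    rw [hE]
    rintro e (rfl | rfl | he) hne
    exacts [le_rfl, absurd rfl hne, (hfE e he).le]
  have hleast : IsLeast N.E g := ⟨by rw [hE]; simp, hgN⟩
  have hEf : ∀ {e}, e ∈ M.E → e ≠ f := by rintro e he rfl; exact hf.notMem he
  have hEg : ∀ {e}, e ∈ M.E → e ≠ g := by rintro e he rfl; exact hg.notMem he
  have hsub : ∀ {B}, M.IsBase B → N.IsBase (insert g B) := fun hB =>
    (h.1.isBase_iff.1 (hg.isBase_iff.1 hB).1).1
  have circuit_sign : ∀ {B X Y e V}, IsBasisSigning M F G f g B X Y → e ∈ M.E → e ∉ B →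
      N.IsSignedCircuit V → support V ⊆ insert e (insert g B) → V e * Y e = V g := by
    intro B X Y e V hB heE heB hV hVs
    have hVf : V f = 0 := by
      by_contra h0
      rcases hVs h0 with h' | h' | h'
      exacts [hEf heE h'.symm, hfg h', hEf (hB.isBase.subset_ground h') rfl]
    have hVG := h.1.isSignedCircuit_iff.2 ⟨hV, hVf⟩
    rw [(hB.cocircuit.2 V hVG).eq_neg_of_pair (a := e) (b := g) fun x hx hy => by
      by_cases hxg : x = g
      · exact Or.inr hxg
      · refine (hVs hx).imp id fun hxB => ?_
        exact absurd (hxB.resolve_left hxg) (hB.mem_of_cocircuit_ne_zero hy hxg).2]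
    rw [hB.cocircuit_apply, mul_neg_one, neg_neg]
  have cocircuit_sign : ∀ {B X Y b W}, IsBasisSigning M F G f g B X Y → b ∈ B →
      N.IsSignedCocircuit W → support W ⊆ insert b (N.E \ insert g B) → X b * W b = W f := by
    intro B X Y b W hB hbB hW hWs
    have hWg : W g = 0 := by
      by_contra h0
      rcases hWs h0 with h' | h'
      exacts [hEg (hB.isBase.subset_ground hbB) h'.symm, h'.2 (mem_insert _ _)]
    have hWF := h.2.isSignedCocircuit_iff.2 ⟨hW, hWg⟩
    rw [(hWF.2 X hB.circuit).eq_neg_of_pair (a := b) (b := f) fun x hx hy => by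
      by_cases hxf : x = f
      · exact Or.inr hxf
      · refine (hWs hy).imp id fun hxB => ?_
        exact absurd (mem_insert_of_mem g (hB.mem_of_circuit_ne_zero hx hxf)) hxB.2]
    rw [hB.circuit_apply, neg_one_mul, neg_neg]
  constructor
  · rintro ⟨hB', hc, hd⟩
    replace hB' : N.IsBase B' := hB'
    have hgB : g ∈ B' := by
      by_contra hgB
      obtain ⟨X, hX, hXs, hXg, m, hm, hXm⟩ := hc g ⟨hleast.1, hgB⟩
      have hgX : g ∈ support X := by rw [mem_support, hXg]; decide
      have hmg : m = g := hm.unique ⟨hgX, fun e he =>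
        hgN e ((((N.reorient A).reorient {f, g}).support_isCircuit X hX).subset_ground he)⟩
      rw [hmg, hXg] at hXm
      exact absurd hXm (by decide)
    have hnotleast : ∀ {b}, b ≠ g → ¬ IsLeast N.E b := fun hb hl => hb (hl.unique hleast)
    have hfB : f ∉ B' := by
      intro hfB
      obtain ⟨Y, hY, hYs, hYf, m, hm, hYm⟩ := hd f hfB (hnotleast hfg)
      have hfY : f ∈ support Y := by rw [mem_support, hYf]; decide
      have hmf : m = f := hm.unique ⟨hfY, fun e he =>
        hfN e (hY.1.subset_ground he) (by
          rintro rfl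
          rw [hYs] at he
          rcases N.fundCocircuit_subset_insert_compl f B' he with h' | h'
          exacts [hfg h'.symm, h'.2 hgB])⟩
      rw [hmf, hYf] at hYm
      exact absurd hYm (by decide)
    have hins : insert g (B' \ {g}) = B' := by rw [insert_sdiff_singleton, insert_eq_of_mem hgB]
    have hB : M.IsBase (B' \ {g}) := by
      rw [hg.isBase_iff, hins, h.1.isBase_iff]
      exact ⟨⟨hB', hfB⟩, fun h => h.2 rfl⟩
    obtain ⟨X, Y, hXY⟩ := exists_isBasisSigning hf hg hB
    refine ⟨B' \ {g}, X, Y, hXY, hins.symm, fun e heE => ⟨fun heB => ?_, fun heB => ?_⟩⟩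
    · obtain ⟨W, hW, hWs, hWe, m, hm, hWm⟩ := hd e heB.1 (hnotleast (hEg heE))
      obtain ⟨V, rfl⟩ := exists_eq_flip_flip A {f, g} W
      rw [reorient_reorient_isSignedCocircuit_iff] at hW
      rw [support_flip, support_flip] at hWs hm
      rw [flip_pair_apply_of_ne (hEf heE) (hEg heE), reorientSign_mul_eq_one_iff] at hWe
      have hVs : support V ⊆ insert e (N.E \ insert g (B' \ {g})) := by
        rw [hins, hWs]
        exact N.fundCocircuit_subset_insert_compl e B'
      have hVsign := cocircuit_sign hXY heB hW hVs
      have hVf : V f ≠ 0 := by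
        rw [← hVsign]
        exact mul_ne_zero (hXY.circuit_ne_zero heB) (by rw [hWe]; exact reorientSign_ne_zero A e)
      have hmf : m = f := hm.unique ⟨hVf, fun x hx => hfN x (hW.1.subset_ground hx) (by
        rintro rfl
        rcases hVs hx with h' | h'
        exacts [hEg heE h'.symm, h'.2 (mem_insert _ _)])⟩
      rw [hmf, flip_pair_apply_left hfA] at hWm
      have hVf1 : V f = 1 := neg_injective hWm
      rw [hVf1] at hVsign
      rw [sign_eq_of_mul_eq_one hVsign, hWe]
    · have heB' : e ∉ B' := fun h => heB ⟨h, hEg heE⟩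
      obtain ⟨W, hW, hWs, hWe, m, hm, hWm⟩ := hc e ⟨by
        change e ∈ N.E
        rw [hE]; exact Or.inr (Or.inr heE), heB'⟩
      obtain ⟨V, rfl⟩ := exists_eq_flip_flip A {f, g} W
      rw [reorient_reorient_isSignedCircuit_iff] at hW
      rw [support_flip, support_flip] at hWs hm
      rw [flip_pair_apply_of_ne (hEf heE) (hEg heE), reorientSign_mul_eq_one_iff] at hWe
      have hVs : support V ⊆ insert e (insert g (B' \ {g})) := by
        rw [hins, hWs]
        exact N.fundCircuit_subset_insert e B'
      have hVsign := circuit_sign hXY heE heB hW hVs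
      have hVg : V g ≠ 0 := by
        rw [← hVsign]
        exact mul_ne_zero (by rw [hWe]; exact reorientSign_ne_zero A e)
          (hXY.cocircuit_ne_zero heE heB)
      have hmg : m = g := hm.unique ⟨hVg, fun x hx =>
        hgN x ((N.support_isCircuit V hW).subset_ground hx)⟩
      rw [hmg, flip_pair_apply_right hgA] at hWm
      have hVg1 : V g = 1 := neg_injective hWm
      rw [hVg1] at hVsign
      rw [← sign_eq_of_mul_eq_one hVsign, hWe]
  · rintro ⟨B, X, Y, hB, rfl, hs⟩
    have hbase := hsub hB.isBase
    refine ⟨hbase, fun e he => ?_, fun b hb hbl => ?_⟩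
    · replace he : e ∈ N.E ∧ e ∉ insert g B := he
      have heN := he.1
      rw [hE] at heN
      rcases heN with rfl | rfl | heE
      · have hV := h.circuit_isSignedCircuit hcomp hfg hB
        have hVs : support (withSign X g 1) = N.fundCircuit e (insert g B) := by
          refine (N.support_isCircuit _ hV).eq_fundCircuit_of_subset hbase.indep ?_
          rw [support_withSign _ _ (by decide), hB.support_circuit, insert_comm]
        refine ⟨_, (reorient_reorient_isSignedCircuit_iff _).2 hV, by
          rw [support_flip, support_flip]; exact hVs, ?_, g, ⟨?_, fun x hx => ?_⟩, ?_⟩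
        · rw [flip_pair_apply_left hfA, withSign_of_ne _ _ hfg, hB.circuit_apply, neg_neg]
        · rw [support_flip, support_flip, mem_support, withSign_self]; decide
        · rw [support_flip, support_flip] at hx
          exact hgN x ((N.support_isCircuit _ hV).subset_ground hx)
        · rw [flip_pair_apply_right hgA, withSign_self]
      · exact absurd (mem_insert _ _) he.2
      · have heB : e ∉ B := fun h => he.2 (mem_insert_of_mem _ h)
        obtain ⟨V, hV, hVs, hVe⟩ := N.isOrthogonalPair.exists_circuit_sign
          (hbase.fundCircuit_isCircuit he.1 he.2) (N.mem_fundCircuit e (insert g B))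
          (reorientSign_ne_zero A e)
        have hsg := circuit_sign hB heE heB hV
          (by rw [hVs]; exact N.fundCircuit_subset_insert e _)
        rw [hVe, (hs e heE).2 heB, sign_mul_self (reorientSign_ne_zero A e)] at hsg
        refine ⟨_, (reorient_reorient_isSignedCircuit_iff _).2 hV, by
          rw [support_flip, support_flip]; exact hVs, ?_, g, ⟨?_, fun x hx => ?_⟩, ?_⟩
        · rw [flip_pair_apply_of_ne (hEf heE) (hEg heE), hVe,
            sign_mul_self (reorientSign_ne_zero A e)]
        · rw [support_flip, support_flip, mem_support, ← hsg]; decide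
        · rw [support_flip, support_flip] at hx
          exact hgN x ((N.support_isCircuit _ hV).subset_ground hx)
        · rw [flip_pair_apply_right hgA, ← hsg]
    · have hbB : b ∈ B := hb.resolve_left (by rintro rfl; exact hbl hleast)
      have hbE := hB.isBase.subset_ground hbB
      obtain ⟨W, hW, hWs, hWb⟩ := N.isOrthogonalPair.exists_cocircuit_sign
        (Matroid.fundCocircuit_isCocircuit hb hbase) (N.mem_fundCocircuit b (insert g B))
        (reorientSign_ne_zero A b)
      have hWs' : support W ⊆ insert b (N.E \ insert g B) := by
        rw [hWs]; exact N.fundCocircuit_subset_insert_compl b _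
      have hsg := cocircuit_sign hB hbB hW hWs'
      rw [hWb, (hs b hbE).1 hbB, sign_mul_self (reorientSign_ne_zero A b)] at hsg
      refine ⟨_, (reorient_reorient_isSignedCocircuit_iff _).2 hW, by
          rw [support_flip, support_flip]; exact hWs, ?_, f, ⟨?_, fun x hx => ?_⟩, ?_⟩
      · rw [flip_pair_apply_of_ne (hEf hbE) (hEg hbE), hWb,
          sign_mul_self (reorientSign_ne_zero A b)]
      · rw [support_flip, support_flip, mem_support, ← hsg]; decide
      · rw [support_flip, support_flip] at hx
        refine hfN x (hW.1.subset_ground hx) ?_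
        rintro rfl
        rcases hWs' hx with h' | h'
        exacts [hEg hbE h'.symm, h'.2 (mem_insert _ _)]
      · rw [flip_pair_apply_left hfA, ← hsg]

/-- The fully optimal bases of the reorientation of a compliant extension-lifting correspond to the
bases whose reorientation is the given one. -/
theorem isFullyOptimal_iff_basisReorientation_eq [LinearOrder α]
    (h : IsGenericExtensionLifting f F g G N) (hf : M.IsGenericExtension f F)
    (hg : M.IsGenericLifting g G) (hcomp : Compliant f g N) (hfg : f ≠ g) (hA : A ⊆ M.E)
    (hgf : g < f) (hfE : ∀ e ∈ M.E, f < e) {B' : Set α} :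
    ((N.reorient A).reorient {f, g}).IsFullyOptimal B' ↔
      ∃ B, M.IsBase B ∧ B' = insert g B ∧
        M.basisReorientation (M.extensionSignature f F) (M.liftingSignature g G) B = A := by
  rw [h.isFullyOptimal_iff hf hg hcomp hfg hA hgf hfE]
  refine exists_congr fun B => ⟨?_, ?_⟩
  · rintro ⟨X, Y, hB, hB', hs⟩
    exact ⟨hB.isBase, hB', (hB.basisReorientation_eq_iff hf hg hA).2 hs⟩
  · rintro ⟨hB, hB', hBA⟩
    obtain ⟨X, Y, hXY⟩ := exists_isBasisSigning hf hg hB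
    exact ⟨X, Y, hXY, hB', (hXY.basisReorientation_eq_iff hf hg hA).1 hBA⟩

end IsGenericExtensionLifting
end OrientedMatroid

/-! ### Free extensions of matroids -/

namespace Matroid

variable {α : Type*} {M N : Matroid α} {f : α}

/-- The free extension of a finite matroid by an element `f` not in the ground set. -/
theorem exists_freeExtension (M : Matroid α) (hE : M.E.Finite) {f : α} (hf : f ∉ M.E) :
    ∃ N : Matroid α, N.E = insert f M.E ∧ M = N.delete {f} ∧
      ∀ C, (N.IsCircuit C ∧ f ∈ C) ↔ ∃ B, M.IsBase B ∧ C = insert f B := by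
  classical
  obtain ⟨B₀, hB₀⟩ := M.exists_isBase
  have hfin : ∀ {I : Set α}, M.Indep (I \ {f}) → I.Finite := fun {I} h =>
    ((hE.subset h.subset_ground).insert f).subset (by simp)
  have hcard : ∀ {B}, M.IsBase B → B.ncard = B₀.ncard := fun hB => by
    rw [ncard_def, ncard_def, hB.encard_eq_encard_of_isBase hB₀]
  have hle : ∀ {I}, M.Indep I → I.ncard ≤ B₀.ncard := fun {I} hI => by
    obtain ⟨B, hB, hIB⟩ := hI.exists_isBase_superset
    rw [← hcard hB]
    exact ncard_le_ncard hIB (hE.subset hB.subset_ground)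
  -- The bound by the rank of M makes B ∪ f dependent for each basis B and is the only constraint
  -- that f brings.
  let P : IndepMatroid α := IndepMatroid.ofFinite (E := insert f M.E) (hE.insert f)
    (Indep := fun I => M.Indep (I \ {f}) ∧ I.ncard ≤ B₀.ncard)
    (indep_empty := by simp)
    (indep_subset := fun I J hJ hIJ => ⟨hJ.1.subset (sdiff_subset_sdiff_left hIJ),
      (ncard_le_ncard hIJ (hfin hJ.1)).trans hJ.2⟩)
    (indep_aug := by
      rintro I J ⟨hI, hIc⟩ ⟨hJ, hJc⟩ hlt
      have hIfin := hfin hI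
      have hJfin := hfin hJ
      by_cases hfIJ : f ∈ J ∧ f ∉ I
      · refine ⟨f, hfIJ.1, hfIJ.2, by simpa using hI, ?_⟩
        rw [ncard_insert_of_notMem hfIJ.2 hIfin]
        omega
      · have hlt' : (I \ {f}).ncard < (J \ {f}).ncard := by
          by_cases hfI : f ∈ I
          · have h1 := ncard_sdiff_singleton_add_one hfI hIfin
            by_cases hfJ : f ∈ J
            · have h2 := ncard_sdiff_singleton_add_one hfJ hJfin
              omega
            · rw [sdiff_singleton_eq_self hfJ]
              omega
          · have hfJ : f ∉ J := fun h => hfIJ ⟨h, hfI⟩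
            rwa [sdiff_singleton_eq_self hfI, sdiff_singleton_eq_self hfJ]
        obtain ⟨e, he, hins⟩ := hI.augment hJ (by
          rw [← hIfin.sdiff.cast_ncard_eq, ← hJfin.sdiff.cast_ncard_eq]
          exact_mod_cast hlt')
        have hef : e ≠ f := he.1.2
        have heI : e ∉ I := fun h => he.2 ⟨h, hef⟩
        refine ⟨e, he.1.1, heI, ?_, ?_⟩
        · rwa [insert_sdiff_of_notMem _ (by simpa using hef)]
        · rw [ncard_insert_of_notMem heI hIfin]
          omega)
    (subset_ground := by
      rintro I ⟨hI, -⟩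
      exact sdiff_singleton_subset_iff.1 hI.subset_ground)
  have hindep : ∀ {I}, P.matroid.Indep I ↔ M.Indep (I \ {f}) ∧ I.ncard ≤ B₀.ncard := Iff.rfl
  have hindepM : ∀ {I}, M.Indep I ↔ P.matroid.Indep I ∧ f ∉ I := by
    intro I
    rw [hindep]
    constructor
    · intro h
      have hfI : f ∉ I := fun h' => hf (h.subset_ground h')
      rw [sdiff_singleton_eq_self hfI]
      exact ⟨⟨h, hle h⟩, hfI⟩
    · rintro ⟨⟨h, -⟩, hfI⟩
      rwa [sdiff_singleton_eq_self hfI] at h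
  refine ⟨P.matroid, rfl, ext_indep ?_ fun I _ => ?_, fun C => ⟨?_, ?_⟩⟩
  · change M.E = insert f M.E \ {f}
    rw [insert_sdiff_self_of_notMem hf]
  · rw [hindepM, deleteElem_indep_iff]
  · rintro ⟨hC, hfC⟩
    have hI : M.Indep (C \ {f}) := hindepM.2 ⟨hC.sdiff_singleton_indep hfC, fun h => h.2 rfl⟩
    have hCc : B₀.ncard < C.ncard := by
      by_contra hlt
      exact hC.not_indep (hindep.2 ⟨hI, not_lt.1 hlt⟩)
    refine ⟨C \ {f}, ?_, by rw [insert_sdiff_singleton, insert_eq_of_mem hfC]⟩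
    obtain ⟨B, hB, hCB⟩ := hI.exists_isBase_superset
    have hle' : B.ncard ≤ (C \ {f}).ncard := by
      have := ncard_sdiff_singleton_add_one hfC (hfin hI)
      rw [hcard hB]
      omega
    rw [eq_of_subset_of_ncard_le hCB hle' (hE.subset hB.subset_ground)]
    exact hB
  · rintro ⟨B, hB, rfl⟩
    have hfB : f ∉ B := fun h => hf (hB.subset_ground h)
    have hBfin := hE.subset hB.subset_ground
    refine ⟨?_, mem_insert _ _⟩
    rw [isCircuit_iff_dep_forall_sdiff_singleton_indep]
    refine ⟨⟨fun h => ?_, insert_subset_insert hB.subset_ground⟩, fun e he => hindep.2 ⟨?_, ?_⟩⟩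
    · have := (hindep.1 h).2
      rw [ncard_insert_of_notMem hfB hBfin, hcard hB] at this
      omega
    · refine hB.indep.subset ?_
      rintro x ⟨⟨hx, -⟩, hxf⟩
      exact hx.resolve_left hxf
    · have := ncard_sdiff_singleton_add_one he (hBfin.insert f)
      rw [ncard_insert_of_notMem hfB hBfin, hcard hB] at this
      omega

theorem indep_insert_iff_of_freeExtension (hdel : M = N.delete {f})
    (hfN : f ∈ N.E) (hc : ∀ C, (N.IsCircuit C ∧ f ∈ C) ↔ ∃ B, M.IsBase B ∧ C = insert f B)
    {J : Set α} (hfJ : f ∉ J) : N.Indep (insert f J) ↔ M.Indep J ∧ ¬ M.IsBase J := by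
  have hind : ∀ {I}, M.Indep I ↔ N.Indep I ∧ f ∉ I := by
    intro I; rw [hdel, deleteElem_indep_iff]
  constructor
  · intro h
    refine ⟨hind.2 ⟨h.subset (subset_insert _ _), hfJ⟩, fun hB => ?_⟩
    exact ((hc _).2 ⟨J, hB, rfl⟩).1.not_indep h
  · rintro ⟨hJ, hnb⟩
    have hJN := (hind.1 hJ).1
    rw [indep_iff_forall_subset_not_isCircuit (insert_subset hfN hJN.subset_ground)]
    intro C hCJ hC
    by_cases hfC : f ∈ C
    · obtain ⟨B, hB, rfl⟩ := (hc C).1 ⟨hC, hfC⟩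
      have hfB : f ∉ B := (hind.1 hB.indep).2
      have hBJ : B ⊆ J := fun x hx => (hCJ (mem_insert_of_mem _ hx)).resolve_left
        (by rintro rfl; exact hfB hx)
      exact hnb (hB.eq_of_subset_indep hJ hBJ ▸ hB)
    · refine hC.not_indep (hJN.subset fun x hx => (hCJ hx).resolve_left ?_)
      rintro rfl; exact hfC hx

end Matroid

/-! ### Free extensions of generic liftings -/

namespace OrientedMatroid

variable {α : Type*} {M F G : OrientedMatroid α} {N : Matroid α} {f g : α}

/-- The free extension of a generic lifting is a generic lifting of the free extension. -/
theorem contract_freeExtension (hf : M.IsGenericExtension f F) (hg : M.IsGenericLifting g G)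
    (hfg : f ≠ g) (hNE : N.E = insert f G.E) (hdel : G.toMatroid = N.delete {f})
    (hc : ∀ C, (N.IsCircuit C ∧ f ∈ C) ↔ ∃ B, G.IsBase B ∧ C = insert f B) :
    F.toMatroid = N.contract {g} ∧
      ∀ D, (N.IsCocircuit D ∧ g ∈ D) ↔ ∃ B, F.IsBase B ∧ D = insert g (F.E \ B) := by
  have hind : ∀ {I}, G.Indep I ↔ N.Indep I ∧ f ∉ I := by
    intro I; rw [hdel, Matroid.deleteElem_indep_iff]
  have hfN : f ∈ N.E := by rw [hNE]; exact mem_insert _ _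
  have hfE := hf.notMem
  have hfG : f ∉ G.E := by
    rw [hg.ground_eq]
    rintro (h | h)
    exacts [hfg h, hfE h]
  have hgl : N.IsNonloop g := by
    rw [← Matroid.indep_singleton]
    exact (hind.1 (Matroid.indep_singleton.2 hg.isNonloop)).1
  have hFN : F.toMatroid = N.contract {g} := by
    refine Matroid.ext_indep ?_ fun I _ => ?_
    · rw [Matroid.contract_ground, hNE, hf.ground_eq, hg.ground_eq, insert_comm,
        insert_sdiff_self_of_notMem]
      rintro (h | h)
      exacts [hfg h.symm, hg.notMem h]
    · rw [hgl.contractElem_indep_iff]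
      by_cases hfI : f ∈ I
      · obtain ⟨J, rfl, hfJ⟩ : ∃ J, I = insert f J ∧ f ∉ J :=
          ⟨I \ {f}, by rw [insert_sdiff_singleton, insert_eq_of_mem hfI], fun h => h.2 rfl⟩
        -- Both sides say that J ∪ g is independent in G without being a basis.
        rw [Matroid.indep_insert_iff_of_freeExtension hf.toMatroid_eq hf.mem hf.2 hfJ,
          insert_comm, Matroid.indep_insert_iff_of_freeExtension hdel hfN hc
            (by simp [hfg, hfJ]), hg.indep_iff, hg.isBase_iff]
        simp only [mem_insert_iff, hfg.symm, false_or]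
        tauto
      · have := hf.indep_iff (I := I)
        rw [hg.indep_iff, hind] at this
        have hfI' : f ∉ insert g I := by simp [hfg, hfI]
        tauto
  have hbase : ∀ {B}, F.IsBase B ↔ N.IsBase (insert g B) ∧ g ∉ B := by
    intro B
    rw [hFN, hgl.indep.contract_isBase_iff, union_singleton, Set.disjoint_singleton_right]
  have hFE : F.E = N.E \ {g} := by rw [hFN, Matroid.contract_ground]
  have hgN : g ∈ N.E := hgl.mem_ground
  have hGbase : ∀ {B}, G.IsBase B → N.IsBase B := by
    intro B hB
    refine (hind.1 hB.indep).1.isBase_of_forall_insert ?_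
    rintro e ⟨heN, heB⟩ hdep
    have hfB : f ∉ B := (hind.1 hB.indep).2
    by_cases hef : e = f
    · subst hef
      exact ((hc _).2 ⟨B, hB, rfl⟩).1.not_indep hdep
    · have heG : e ∈ G.E := by rw [hNE] at heN; exact heN.resolve_left hef
      exact (hB.insert_dep ⟨heG, heB⟩).not_indep (hind.2 ⟨hdep, by simp [Ne.symm hef, hfB]⟩)
  have hfwd : ∀ D, N.IsCocircuit D → g ∈ D → ∃ B, F.IsBase B ∧ D = insert g (F.E \ B) := by
    intro D hD hgD
    -- Genericity at g: a circuit C in the hyperplane N.E \ D either contains f, hence a basis of N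
    -- disjoint from D, or lies in G. In the latter case a circuit of G in C ∪ g would meet D only
    -- in g, while a cocircuit of G through g avoiding C puts C inside a basis.
    have hI : N.Indep (N.E \ D) := by
      rw [Matroid.indep_iff_forall_subset_not_isCircuit sdiff_subset]
      intro C hCD hC
      by_cases hfC : f ∈ C
      · obtain ⟨B, hB, rfl⟩ := (hc C).1 ⟨hC, hfC⟩
        obtain ⟨b, hbD, hbB⟩ :=
          (Matroid.dual_dep_iff_forall.1 hD.isCircuit.dep).1 B (hGbase hB)
        exact (hCD (mem_insert_of_mem _ hbB)).2 hbD
      · have hgC : g ∉ C := fun h => (hCD h).2 hgD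
        have hCG : C ⊆ G.E := fun x hx => by
          have := hC.subset_ground hx
          rw [hNE] at this
          exact this.resolve_left (by rintro rfl; exact hfC hx)
        rcases G.exists_isCircuit_or_isCocircuit C hg.mem hgC with
          ⟨K, hK, hgK, hKC⟩ | ⟨K, hK, hgK, hKC⟩
        · rw [hdel, Matroid.delete_isCircuit_iff] at hK
          refine hK.1.inter_isCocircuit_ne_singleton hD (e := g) (Subset.antisymm ?_ ?_)
          · rintro x ⟨hxK, hxD⟩
            rcases hKC hxK with h | h
            · exact h
            · exact absurd hxD (hCD h).2
          · rintro x rfl; exact ⟨hgK, hgD⟩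
        · obtain ⟨B, hB, rfl⟩ := (hg.2 K).1 ⟨hK, hgK⟩
          refine hC.not_indep ((hind.1 (hg.isBase_iff.1 hB).1.indep).1.subset fun x hx => ?_)
          have hxG := hCG hx
          rw [hg.ground_eq] at hxG
          by_contra hxB
          exact Set.disjoint_left.1 hKC (Or.inr ⟨hxG.resolve_left (by rintro rfl; exact hgC hx),
            fun h => hxB (Or.inr h)⟩) hx
    refine ⟨N.E \ D, hbase.2 ⟨hD.insert_isBase hI.isBasis_self hgD, fun h => h.2 hgD⟩, ?_⟩
    rw [hFE]
    ext x
    have : x ∈ D → x ∈ N.E := fun h => hD.subset_ground h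
    by_cases hxg : x = g
    · simp [hxg, hgD]
    · simp only [mem_insert_iff, hxg, false_or, mem_sdiff, mem_singleton_iff, not_false_eq_true]
      tauto
  refine ⟨hFN, fun D => ⟨fun h => hfwd D h.1 h.2, ?_⟩⟩
  rintro ⟨B, hB, rfl⟩
  have hB' := hbase.1 hB
  have hK := Matroid.fundCocircuit_isCocircuit (mem_insert g B) hB'.1
  have hgK := N.mem_fundCocircuit g (insert g B)
  have hKs := N.fundCocircuit_subset_insert_compl g (insert g B)
  obtain ⟨B₁, hB₁, hKB₁⟩ := hfwd _ hK hgK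
  have hBB₁ : B = B₁ := by
    refine hB.eq_of_subset_isBase hB₁ fun x hx => ?_
    by_contra hxB
    have hxK : x ∈ N.fundCocircuit g (insert g B) := by
      rw [hKB₁]; exact Or.inr ⟨hB.subset_ground hx, hxB⟩
    rcases hKs hxK with rfl | h
    · exact hB'.2 hx
    · exact h.2 (Or.inr hx)
  subst hBB₁
  rw [← hKB₁]
  exact ⟨hK, hgK⟩

end OrientedMatroid

/-! ### Existence of a compliant extension-lifting -/

namespace OrientedMatroid
variable {α : Type*}

/-- The composition of two signed subsets. -/
def comp (X Y : α → SignType) (e : α) : SignType := if X e = 0 then Y e else X e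

theorem comp_of_eq_zero {X Y : α → SignType} {e : α} (h : X e = 0) : comp X Y e = Y e := if_pos h

theorem comp_of_ne_zero {X Y : α → SignType} {e : α} (h : X e ≠ 0) : comp X Y e = X e := if_neg h

theorem support_comp (X Y : α → SignType) : support (comp X Y) = support X ∪ support Y := by
  ext e
  by_cases h : X e = 0
  · simp [comp_of_eq_zero h, h]
  · simp [comp_of_ne_zero h, h]

theorem Orthogonal.comp_right {X Y Z : α → SignType} (hY : Orthogonal X Y) (hZ : Orthogonal X Z) :
    Orthogonal X (comp Y Z) := by
  by_cases h : ∃ e, X e * Y e ≠ 0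
  · obtain ⟨e, he⟩ := h
    obtain ⟨x, hx⟩ := hY.exists_of_mul_eq_neg he
    have hx0 : X x * Y x ≠ 0 := by rw [hx]; simpa using he
    rw [← comp_of_ne_zero (Y := Z) (right_ne_zero_of_mul he),
      ← comp_of_ne_zero (Y := Z) (right_ne_zero_of_mul hx0)] at hx
    rw [← comp_of_ne_zero (Y := Z) (right_ne_zero_of_mul he)] at he
    rcases SignType.trichotomy (X e * comp Y Z e) with h1 | h1 | h1
    · exact orthogonal_of_exists ⟨x, by rw [hx, h1, neg_neg]⟩ ⟨e, h1⟩
    · exact absurd h1 he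
    · exact orthogonal_of_exists ⟨e, h1⟩ ⟨x, by rw [hx, h1]⟩
  · push Not at h
    have : ∀ e, X e * comp Y Z e = X e * Z e := by
      intro e
      by_cases hX : X e = 0
      · rw [hX, zero_mul, zero_mul]
      · rw [comp_of_eq_zero ((_root_.mul_eq_zero.1 (h e)).resolve_left hX)]
    simpa only [Orthogonal, this] using hZ

theorem Orthogonal.comp_left {X Y Z : α → SignType} (hY : Orthogonal Y X) (hZ : Orthogonal Z X) :
    Orthogonal (comp Y Z) X :=
  (hY.symm.comp_right hZ.symm).symm

variable {M F G : OrientedMatroid α} {N : Matroid α} {f g : α}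

/-- A circuit of G with g dropped is orthogonal to all cocircuits of M, and a cocircuit of F to all
circuits of M, so `orthogonal_of_forall` applies in M. -/
theorem orthogonal_lifting_extension (hf : M.IsGenericExtension f F) (hg : M.IsGenericLifting g G)
    (hfg : f ≠ g) {X Y : α → SignType} (hX : G.IsSignedCircuit X) (hY : F.IsSignedCocircuit Y) :
    Orthogonal X Y := by
  have hgF : g ∉ F.E := by
    rw [hf.ground_eq]; rintro (h | h); exacts [hfg h.symm, hg.notMem h]
  have hYg := hY.eq_zero hgF
  rw [← orthogonal_withSign_left hYg X 0]
  refine M.isOrthogonalPair.orthogonal_of_forall (fun W hW => ?_) ?_ fun V hV => ?_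
  · rw [orthogonal_withSign_left (hg.isSignedCocircuit_iff.1 hW).2]
    exact hg.orthogonal_of_lifted hX hW
  · rw [support_withSign_zero, sdiff_singleton_subset_iff, ← hg.ground_eq]
    exact (G.support_isCircuit X hX).subset_ground
  · exact hf.orthogonal_of_cocircuit hY hV

/-- The signed circuits of the extension-lifting that are positive on `f`. -/
def LexCircuit (F G : OrientedMatroid α) (N : Matroid α) (f g : α) (X : α → SignType) : Prop :=
  (∃ V, F.IsSignedCircuit V ∧ V f = 1 ∧ X = withSign V g (-1)) ∨
    ∃ Z V, G.IsSignedCircuit Z ∧ Z g = 1 ∧ F.IsSignedCircuit V ∧ V f = 1 ∧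
      N.IsCircuit (support X) ∧ X = comp (withSign Z g 0) V

/-- The signed cocircuits of the extension-lifting that are positive on `g`. -/
def LexCocircuit (F G : OrientedMatroid α) (N : Matroid α) (f g : α) (Y : α → SignType) : Prop :=
  (∃ W, G.IsSignedCocircuit W ∧ W g = 1 ∧ Y = withSign W f 1) ∨
    ∃ D W, F.IsSignedCocircuit D ∧ D f = -1 ∧ G.IsSignedCocircuit W ∧ W g = 1 ∧
      N.IsCocircuit (support Y) ∧ Y = comp (withSign D f 0) W

theorem exists_ne_of_orthogonal {X Y : α → SignType} (h : Orthogonal X Y) {f : α} {s : SignType}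
    (hs : s ≠ 0) (hXY : X f * Y f = s) : ∃ e, e ≠ f ∧ X e * Y e = -s := by
  obtain ⟨x, hx⟩ := h.exists_of_mul_eq_neg (e := f) (by rwa [hXY])
  rw [hXY] at hx
  refine ⟨x, ?_, hx⟩
  rintro rfl
  rw [hXY] at hx
  clear * - hs hx
  revert s; decide

/-- Products of both signs are exhibited: at f (1) and at g (-1) where these are present in both;
otherwise V against D supplies a product 1 and Z against W a product -1. For two compositions, the
leading parts Z and D decide if they meet off f and g; if not, the products just named survive
composition. -/
theorem orthogonal_lexCircuit (hf : M.IsGenericExtension f F) (hg : M.IsGenericLifting g G)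
    (hfg : f ≠ g) {X Y : α → SignType} (hX : LexCircuit F G N f g X)
    (hY : LexCocircuit F G N f g Y) : Orthogonal X Y := by
  have hgF : g ∉ F.E := by
    rw [hf.ground_eq]; rintro (h | h); exacts [hfg h.symm, hg.notMem h]
  have hfG : f ∉ G.E := by
    rw [hg.ground_eq]; rintro (h | h); exacts [hfg h, hf.notMem h]
  rcases hX with ⟨V, hV, hVf, rfl⟩ | ⟨Z, V, hZ, hZg, hV, hVf, -, rfl⟩ <;>
    rcases hY with ⟨W, hW, hWg, rfl⟩ | ⟨D, W, hD, hDf, hW, hWg, -, rfl⟩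
  · refine orthogonal_of_exists ⟨f, ?_⟩ ⟨g, ?_⟩
    · rw [withSign_of_ne _ _ hfg, withSign_self, hVf]; decide
    · rw [withSign_of_ne _ _ hfg.symm, withSign_self, hWg]; decide
  · obtain ⟨x, hxf, hx⟩ := exists_ne_of_orthogonal (hD.2 V hV) (f := f) (s := -1) (by decide)
      (by rw [hVf, hDf]; decide)
    have hx0 : V x * D x ≠ 0 := by rw [hx]; decide
    have hxg : x ≠ g := by
      rintro rfl
      exact left_ne_zero_of_mul hx0 (eq_zero_of_notMem_ground hV hgF)
    refine orthogonal_of_exists ⟨x, ?_⟩ ⟨g, ?_⟩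
    · rw [withSign_of_ne _ _ hxg, comp_of_ne_zero, withSign_of_ne _ _ hxf, hx]
      · decide
      · rw [withSign_of_ne _ _ hxf]; exact right_ne_zero_of_mul hx0
    · rw [withSign_self, comp_of_eq_zero, hWg]
      · decide
      · rw [withSign_of_ne _ _ hfg.symm]; exact hD.eq_zero hgF
  · obtain ⟨x, hxg, hx⟩ := exists_ne_of_orthogonal (hW.2 Z hZ) (f := g) (s := 1) (by decide)
      (by rw [hZg, hWg]; decide)
    have hx0 : Z x * W x ≠ 0 := by rw [hx]; decide
    have hxf : x ≠ f := by
      rintro rfl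
      exact left_ne_zero_of_mul hx0 (eq_zero_of_notMem_ground hZ hfG)
    refine orthogonal_of_exists ⟨f, ?_⟩ ⟨x, ?_⟩
    · rw [withSign_self, comp_of_eq_zero, hVf]
      · decide
      · rw [withSign_of_ne _ _ hfg]; exact eq_zero_of_notMem_ground hZ hfG
    · rw [withSign_of_ne _ _ hxf, comp_of_ne_zero, withSign_of_ne _ _ hxg, hx]
      rw [withSign_of_ne _ _ hxg]; exact left_ne_zero_of_mul hx0
  · by_cases hZD : ∃ e, e ≠ f ∧ e ≠ g ∧ Z e * D e ≠ 0
    · obtain ⟨e, hef, heg, he⟩ := hZD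
      have horth : Orthogonal (withSign Z g 0) (withSign D f 0) := by
        rw [orthogonal_withSign_left, orthogonal_withSign_right]
        · exact orthogonal_lifting_extension hf hg hfg hZ hD
        · exact eq_zero_of_notMem_ground hZ hfG
        · rw [withSign_of_ne _ _ hfg.symm]; exact hD.eq_zero hgF
      have he' : withSign Z g 0 e * withSign D f 0 e ≠ 0 := by
        rwa [withSign_of_ne _ _ hef, withSign_of_ne _ _ heg]
      obtain ⟨x, hx⟩ := horth.exists_of_mul_eq_neg he'
      have hx' : withSign Z g 0 x * withSign D f 0 x ≠ 0 := by rw [hx]; simpa using he'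
      rw [← comp_of_ne_zero (X := withSign Z g 0) (Y := V) (left_ne_zero_of_mul he'),
        ← comp_of_ne_zero (X := withSign Z g 0) (Y := V) (left_ne_zero_of_mul hx'),
        ← comp_of_ne_zero (X := withSign D f 0) (Y := W) (right_ne_zero_of_mul he'),
        ← comp_of_ne_zero (X := withSign D f 0) (Y := W) (right_ne_zero_of_mul hx')] at hx
      rw [← comp_of_ne_zero (X := withSign Z g 0) (Y := V) (left_ne_zero_of_mul he'),
        ← comp_of_ne_zero (X := withSign D f 0) (Y := W) (right_ne_zero_of_mul he')] at he'
      generalize comp (withSign Z g 0) V = X, comp (withSign D f 0) W = Y at *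
      rcases SignType.trichotomy (X e * Y e) with h1 | h1 | h1
      · exact orthogonal_of_exists ⟨x, by rw [hx, h1, neg_neg]⟩ ⟨e, h1⟩
      · exact absurd h1 he'
      · exact orthogonal_of_exists ⟨e, h1⟩ ⟨x, by rw [hx, h1]⟩
    · push Not at hZD
      obtain ⟨x, hxg, hx⟩ := exists_ne_of_orthogonal (hW.2 Z hZ) (f := g) (s := 1) (by decide)
        (by rw [hZg, hWg]; decide)
      have hx0 : Z x * W x ≠ 0 := by rw [hx]; decide
      have hxf : x ≠ f := by
        rintro rfl
        exact left_ne_zero_of_mul hx0 (eq_zero_of_notMem_ground hZ hfG)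
      obtain ⟨y, hyf, hy⟩ := exists_ne_of_orthogonal (hD.2 V hV) (f := f) (s := -1) (by decide)
        (by rw [hVf, hDf]; decide)
      have hy0 : V y * D y ≠ 0 := by rw [hy]; decide
      have hyg : y ≠ g := by
        rintro rfl
        exact left_ne_zero_of_mul hy0 (eq_zero_of_notMem_ground hV hgF)
      refine orthogonal_of_exists ⟨y, ?_⟩ ⟨x, ?_⟩
      · rw [comp_of_eq_zero, comp_of_ne_zero, withSign_of_ne _ _ hyf, hy]
        · decide
        · rw [withSign_of_ne _ _ hyf]; exact right_ne_zero_of_mul hy0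
        · rw [withSign_of_ne _ _ hyg]
          exact (_root_.mul_eq_zero.1 (hZD y hyf hyg)).resolve_right (right_ne_zero_of_mul hy0)
      · rw [comp_of_ne_zero, comp_of_eq_zero, withSign_of_ne _ _ hxg, hx]
        · rw [withSign_of_ne _ _ hxf]
          exact (_root_.mul_eq_zero.1 (hZD x hxf hxg)).resolve_left (left_ne_zero_of_mul hx0)
        · rw [withSign_of_ne _ _ hxg]; exact left_ne_zero_of_mul hx0

theorem orthogonal_circuit_lexCocircuit (hf : M.IsGenericExtension f F)
    (hg : M.IsGenericLifting g G) (hfg : f ≠ g) {X Y : α → SignType} (hX : G.IsSignedCircuit X)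
    (hY : LexCocircuit F G N f g Y) : Orthogonal X Y := by
  have hXf : X f = 0 := eq_zero_of_notMem_ground hX (by
    rw [hg.ground_eq]; rintro (h | h); exacts [hfg h, hf.notMem h])
  rcases hY with ⟨W, hW, -, rfl⟩ | ⟨D, W, hD, -, hW, -, -, rfl⟩
  · exact (orthogonal_withSign_right hXf W 1).2 (hW.2 X hX)
  · exact Orthogonal.comp_right
      ((orthogonal_withSign_right hXf D 0).2 (orthogonal_lifting_extension hf hg hfg hX hD))
      (hW.2 X hX)

theorem orthogonal_lexCircuit_cocircuit (hf : M.IsGenericExtension f F)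
    (hg : M.IsGenericLifting g G) (hfg : f ≠ g) {X Y : α → SignType}
    (hX : LexCircuit F G N f g X) (hY : F.IsSignedCocircuit Y) : Orthogonal X Y := by
  have hYg : Y g = 0 := hY.eq_zero (by
    rw [hf.ground_eq]; rintro (h | h); exacts [hfg h.symm, hg.notMem h])
  rcases hX with ⟨V, hV, -, rfl⟩ | ⟨Z, V, hZ, -, hV, -, -, rfl⟩
  · exact (orthogonal_withSign_left hYg V _).2 (hY.2 V hV)
  · exact Orthogonal.comp_left
      ((orthogonal_withSign_left hYg Z 0).2 (orthogonal_lifting_extension hf hg hfg hZ hY))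
      (hY.2 V hV)

/-- In the realizable picture the new f is g + δf with δ infinitesimal. A covector positive on g is
then positive on f, unless it vanishes on f, when its large part D is negative on the old f and W is
a correction. A circuit through f has g with opposite sign; substituting for g by means of Z gives a
circuit without g, where Z dominates V. -/
theorem exists_compliant_extensionLifting (hf : M.IsGenericExtension f F)
    (hg : M.IsGenericLifting g G) (hfg : f ≠ g) :
    ∃ N, IsGenericExtensionLifting f F g G N ∧ Compliant f g N := by
  have hgF : g ∉ F.E := by
    rw [hf.ground_eq]; rintro (h | h); exacts [hfg h.symm, hg.notMem h]
  have hfG : f ∉ G.E := by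
    rw [hg.ground_eq]; rintro (h | h); exacts [hfg h, hf.notMem h]
  obtain ⟨N, hNE, hdel, hc⟩ := G.exists_freeExtension G.ground_finite hfG
  obtain ⟨hcon, hd⟩ := contract_freeExtension hf hg hfg hNE hdel hc
  have circ : ∀ {C}, G.IsCircuit C ↔ N.IsCircuit C ∧ f ∉ C := fun {C} => by
    rw [hdel, Matroid.delete_isCircuit_iff, Set.disjoint_singleton_right]
  have cocirc : ∀ {C}, F.IsCocircuit C ↔ N.IsCocircuit C ∧ g ∉ C := fun {C} => by
    rw [hcon, Matroid.contract_isCocircuit_iff, Set.disjoint_singleton_right]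
  have lexCircuit_support : ∀ {X}, LexCircuit F G N f g X → N.IsCircuit (support X) := by
    rintro X (⟨V, hV, hVf, rfl⟩ | ⟨Z, V, hZ, hZg, hV, hVf, h, rfl⟩)
    · obtain ⟨B, hB, hVB⟩ := (hf.2 _).1 ⟨F.support_isCircuit V hV,
        show V f ≠ 0 by rw [hVf]; decide⟩
      rw [support_withSign _ _ (by decide), hVB, insert_comm]
      exact ((hc _).2 ⟨_, (hg.isBase_iff.1 hB).1, rfl⟩).1
    · exact h
  have lexCocircuit_support : ∀ {X}, LexCocircuit F G N f g X → N.IsCocircuit (support X) := by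
    rintro X (⟨W, hW, hWg, rfl⟩ | ⟨D, W, hD, hDf, hW, hWg, h, rfl⟩)
    · obtain ⟨B, hB, hWB⟩ := (hg.2 _).1 ⟨hW.1, show W g ≠ 0 by rw [hWg]; decide⟩
      refine ((hd _).2 ⟨B, (hf.isBase_iff.1 hB).1, ?_⟩).1
      rw [support_withSign _ _ (by decide), hWB, hf.ground_eq,
        insert_sdiff_of_notMem _ (hf.isBase_iff.1 hB).2, insert_comm]
    · exact h
  have pair : IsOrthogonalPair N
      (fun X => G.IsSignedCircuit X ∨ LexCircuit F G N f g X ∨ LexCircuit F G N f g (-X))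
      (fun Y => F.IsSignedCocircuit Y ∨ LexCocircuit F G N f g Y ∨
        LexCocircuit F G N f g (-Y)) := by
    refine ⟨?_, ?_, ?_, ?_, ?_, ?_, ?_, ?_⟩
    · rw [hNE]; exact G.ground_finite.insert f
    · rintro X (h | h | h)
      · exact (circ.1 (G.support_isCircuit X h)).1
      · exact lexCircuit_support h
      · rw [← support_neg_sign]; exact lexCircuit_support h
    · rintro X (h | h | h)
      · exact (cocirc.1 h.1).1
      · exact lexCocircuit_support h
      · rw [← support_neg_sign]; exact lexCocircuit_support h
    · intro K hK
      by_cases hfK : f ∈ K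
      · obtain ⟨B', hB', rfl⟩ := (hc K).1 ⟨hK, hfK⟩
        by_cases hgB : g ∈ B'
        · have hins : insert g (B' \ {g}) = B' := by
            rw [insert_sdiff_singleton, insert_eq_of_mem hgB]
          have hB : M.IsBase (B' \ {g}) := by
            rw [hg.isBase_iff, hins]; exact ⟨hB', fun h => h.2 rfl⟩
          obtain ⟨V, hV, hVs, hVf⟩ := F.isOrthogonalPair.exists_circuit_sign
            (hf.isCircuit_insert hB) (mem_insert f _) (s := 1) (by decide)
          refine ⟨_, Or.inr (Or.inl (Or.inl ⟨V, hV, hVf, rfl⟩)), ?_⟩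
          rw [support_withSign _ _ (by decide), hVs, insert_comm, hins]
        · have hZc := hB'.fundCircuit_isCircuit hg.mem hgB
          obtain ⟨Z, hZ, hZs, hZg⟩ := G.isOrthogonalPair.exists_circuit_sign hZc
            (G.mem_fundCircuit g B') (s := 1) (by decide)
          -- Exchanging c for g in B' gives a basis of G through g, hence a basis B' \ c of M; Z
          -- supplies the missing c. Such a c exists because g is not a loop.
          obtain ⟨c, hc1, hcg⟩ : ∃ c ∈ G.fundCircuit g B', c ≠ g := by
            by_contra! h
            refine hg.isNonloop.indep.not_dep (hZc.dep.superset ?_ (by simpa using hg.mem))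
            exact fun x hx => h x hx
          have hsub := G.fundCircuit_subset_insert g B'
          have hcB : c ∈ B' := (hsub hc1).resolve_left hcg
          have hind := (hB'.indep.mem_fundCircuit_iff
            (by rw [hB'.closure_eq]; exact hg.mem) hgB).1 hc1
          have hbase := hB'.exchange_isBase_of_indep' hcB hgB hind
          rw [insert_sdiff_of_notMem _ (by simpa using hcg.symm)] at hbase
          have hB : M.IsBase (B' \ {c}) := hg.isBase_iff.2 ⟨hbase, fun h => hgB h.1⟩
          obtain ⟨V, hV, hVs, hVf⟩ := F.isOrthogonalPair.exists_circuit_sign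
            (hf.isCircuit_insert hB) (mem_insert f _) (s := 1) (by decide)
          have hs : support (comp (withSign Z g 0) V) = insert f B' := by
            rw [support_comp, support_withSign_zero, hZs, hVs]
            apply Subset.antisymm
            · rintro x (⟨hx, hxg⟩ | rfl | hx)
              · exact Or.inr ((hsub hx).resolve_left hxg)
              · exact mem_insert _ _
              · exact Or.inr hx.1
            · rintro x (rfl | hx)
              · exact Or.inr (mem_insert _ _)
              · by_cases hxc : x = c
                · subst hxc; exact Or.inl ⟨hc1, hcg⟩
                · exact Or.inr (Or.inr ⟨hx, hxc⟩)
          exact ⟨_, Or.inr (Or.inl (Or.inr ⟨Z, V, hZ, hZg, hV, hVf, by rw [hs]; exact hK, rfl⟩)),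
            hs⟩
      · obtain ⟨X, hX, hXs⟩ := G.exists_signing K (circ.2 ⟨hK, hfK⟩)
        exact ⟨X, Or.inl hX, hXs⟩
    · intro K hK
      by_cases hgK : g ∈ K
      · obtain ⟨B, hB, rfl⟩ := (hd K).1 ⟨hK, hgK⟩
        by_cases hfB : f ∈ B
        · have hDc := Matroid.fundCocircuit_isCocircuit hfB hB
          obtain ⟨D, hD, hDs, hDf⟩ := F.isOrthogonalPair.exists_cocircuit_sign hDc
            (F.mem_fundCocircuit f B) (s := -1) (by decide)
          -- Dually, d is exchanged for f to obtain a basis of M; it exists because f is not a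
          -- coloop of F.
          obtain ⟨d, hd1, hdf⟩ : ∃ d ∈ F.fundCocircuit f B, d ≠ f := by
            by_contra! h
            exact (Matroid.coindep_iff_forall_subset_not_isCocircuit.1 hf.coindep).1 _
              (fun x hx => h x hx) hDc
          have hsub := F.fundCocircuit_subset_insert_compl f B
          have hdB : d ∈ F.E \ B := (hsub hd1).resolve_left hdf
          have hind := (hB.indep.mem_fundCircuit_iff
            (by rw [hB.closure_eq]; exact hdB.1) hdB.2).1
            (hB.mem_fundCocircuit_iff_mem_fundCircuit.1 hd1)
          have hbase := hB.exchange_isBase_of_indep' hfB hdB.2 hind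
          have hB₁ : M.IsBase (insert d B \ {f}) := hf.isBase_iff.2 ⟨hbase, fun h => h.2 rfl⟩
          obtain ⟨W, hW, hWs, hWg⟩ := G.isOrthogonalPair.exists_cocircuit_sign
            (hg.isCocircuit_insert hB₁) (mem_insert g _) (s := 1) (by decide)
          have hs : support (comp (withSign D f 0) W) = insert g (F.E \ B) := by
            rw [support_comp, support_withSign_zero, hDs, hWs]
            apply Subset.antisymm
            · rintro x (⟨hx, hxf⟩ | rfl | hx)
              · exact Or.inr ((hsub hx).resolve_left hxf)
              · exact mem_insert _ _
              · refine Or.inr ⟨by rw [hf.ground_eq]; exact Or.inr hx.1, fun hxB => ?_⟩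
                exact hx.2 ⟨Or.inr hxB, by rintro rfl; exact hf.notMem hx.1⟩
            · rintro x (rfl | hx)
              · exact Or.inr (mem_insert _ _)
              · by_cases hxd : x = d
                · subst hxd; exact Or.inl ⟨hd1, hdf⟩
                · have hxE := hx.1
                  rw [hf.ground_eq] at hxE
                  refine Or.inr (Or.inr ⟨hxE.resolve_left ?_, fun h => ?_⟩)
                  · rintro rfl; exact hx.2 hfB
                  · exact h.1.elim hxd hx.2
          exact ⟨_, Or.inr (Or.inl (Or.inr ⟨D, W, hD, hDf, hW, hWg, by rw [hs]; exact hK, rfl⟩)),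
            hs⟩
        · have hBM : M.IsBase B := hf.isBase_iff.2 ⟨hB, hfB⟩
          obtain ⟨W, hW, hWs, hWg⟩ := G.isOrthogonalPair.exists_cocircuit_sign
            (hg.isCocircuit_insert hBM) (mem_insert g _) (s := 1) (by decide)
          refine ⟨_, Or.inr (Or.inl (Or.inl ⟨W, hW, hWg, rfl⟩)), ?_⟩
          rw [support_withSign _ _ (by decide), hWs, hf.ground_eq,
            insert_sdiff_of_notMem _ hfB, insert_comm]
      · obtain ⟨X, hX, hXs⟩ := F.exists_signedCocircuit (cocirc.2 ⟨hK, hgK⟩)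
        exact ⟨X, Or.inl hX, hXs⟩
    · rintro X (h | h | h)
      · exact Or.inl (G.neg_signed X h)
      · exact Or.inr (Or.inr (by rwa [neg_neg]))
      · exact Or.inr (Or.inl h)
    · rintro X (h | h | h)
      · exact Or.inl (F.neg_signedCocircuit h)
      · exact Or.inr (Or.inr (by rwa [neg_neg]))
      · exact Or.inr (Or.inl h)
    · rintro X Y (hX | hX | hX) (hY | hY | hY)
      · exact orthogonal_lifting_extension hf hg hfg hX hY
      · exact orthogonal_circuit_lexCocircuit hf hg hfg hX hY
      · exact orthogonal_neg_right.1 (orthogonal_circuit_lexCocircuit hf hg hfg hX hY)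
      · exact orthogonal_lexCircuit_cocircuit hf hg hfg hX hY
      · exact orthogonal_lexCircuit hf hg hfg hX hY
      · exact orthogonal_neg_right.1 (orthogonal_lexCircuit hf hg hfg hX hY)
      · exact orthogonal_neg_left.1 (orthogonal_lexCircuit_cocircuit hf hg hfg hX hY)
      · exact orthogonal_neg_left.1 (orthogonal_lexCircuit hf hg hfg hX hY)
      · exact orthogonal_neg_left.1 (orthogonal_neg_right.1
          (orthogonal_lexCircuit hf hg hfg hX hY))
  have lexCircuit_apply : ∀ {X}, LexCircuit F G N f g X → X f = 1 := by
    rintro X (⟨V, hV, hVf, rfl⟩ | ⟨Z, V, hZ, hZg, hV, hVf, h, rfl⟩)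
    · rw [withSign_of_ne _ _ hfg, hVf]
    · rw [comp_of_eq_zero, hVf]
      rw [withSign_of_ne _ _ hfg]; exact eq_zero_of_notMem_ground hZ hfG
  have lexCocircuit_apply : ∀ {Y}, LexCocircuit F G N f g Y → Y g = 1 ∧ Y f ≠ -1 := by
    rintro Y (⟨W, hW, hWg, rfl⟩ | ⟨D, W, hD, hDf, hW, hWg, h, rfl⟩)
    · rw [withSign_of_ne _ _ hfg.symm, withSign_self]
      exact ⟨hWg, by decide⟩
    · rw [comp_of_eq_zero (by rw [withSign_of_ne _ _ hfg.symm]; exact hD.eq_zero hgF),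
        comp_of_eq_zero (withSign_self _ _ _), hW.eq_zero hfG]
      exact ⟨hWg, by decide⟩
  have lexCircuit_contract : ∀ {X}, LexCircuit F G N f g X →
      F.IsCircuit (support (withSign X g 0)) → F.IsSignedCircuit (withSign X g 0) := by
    rintro X (⟨V, hV, hVf, rfl⟩ | ⟨Z, V, hZ, hZg, hV, hVf, h, rfl⟩) hXF
    · rw [withSign_withSign, withSign_eq_self (eq_zero_of_notMem_ground hV hgF)]
      exact hV
    · exfalso
      have hZc := G.support_isCircuit Z hZ
      have hZg' : g ∈ support Z := by rw [mem_support, hZg]; decide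
      have hnt : (support Z).Nontrivial := by
        by_contra h
        rw [not_nontrivial_iff] at h
        have : support Z = {g} := h.eq_singleton_of_mem hZg'
        rw [this] at hZc
        exact hg.isNonloop.indep.not_dep hZc.dep
      have hM : M.IsCircuit (support Z \ {g}) := by
        rw [hg.toMatroid_eq]; exact hZc.contractElem_isCircuit hnt hZg'
      have hF := hf.isCircuit_iff.1 hM
      have heq := hF.1.eq_of_subset_isCircuit hXF (by
        rw [support_withSign_zero, support_comp, support_withSign_zero]
        exact fun x hx => ⟨Or.inl hx, hx.2⟩)
      apply hF.2
      rw [heq, mem_support, withSign_of_ne _ _ hfg, comp_of_eq_zero, hVf]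
      · decide
      · rw [withSign_of_ne _ _ hfg]; exact eq_zero_of_notMem_ground hZ hfG
  refine ⟨ofOrthogonalPair N _ _ pair, ⟨⟨⟨hdel, fun X => ?_⟩, hc⟩, ⟨⟨hcon, fun Z => ?_⟩, hd⟩⟩,
    fun Y hY => ?_⟩
  · constructor
    · intro hX
      exact ⟨Or.inl hX, eq_zero_of_notMem_ground hX hfG⟩
    · rintro ⟨hX | hX | hX, hXf⟩
      · exact hX
      · rw [lexCircuit_apply hX] at hXf
        exact absurd hXf (by decide)
      · have := lexCircuit_apply hX
        rw [Pi.neg_apply, hXf] at this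
        exact absurd this (by decide)
  · constructor
    · intro hZ
      refine ⟨F.support_isCircuit Z hZ, ?_⟩
      have hZg := eq_zero_of_notMem_ground hZ hgF
      rcases SignType.trichotomy (Z f) with h | h | h
      · refine ⟨withSign Z g 1, Or.inr (Or.inr (Or.inl ⟨-Z, F.neg_signed Z hZ, ?_, ?_⟩)), ?_⟩
        · rw [Pi.neg_apply, h, neg_neg]
        · rw [neg_withSign]
        · rw [withSign_withSign, withSign_eq_self hZg]
      · obtain ⟨s, -, hs⟩ := hg.exists_sign (hf.isSignedCircuit_iff.2 ⟨hZ, h⟩)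
        exact ⟨_, Or.inl hs, by rw [withSign_withSign, withSign_eq_self hZg]⟩
      · exact ⟨withSign Z g (-1), Or.inr (Or.inl (Or.inl ⟨Z, hZ, h, rfl⟩)),
          by rw [withSign_withSign, withSign_eq_self hZg]⟩
    · rintro ⟨hZ, X, hX | hX | hX, rfl⟩
      · refine (hf.isSignedCircuit_iff.1 ((hg.1.2 _).2 ⟨hf.isCircuit_iff.2 ⟨hZ, ?_⟩,
          X, hX, rfl⟩)).1
        rw [notMem_support, withSign_of_ne _ _ hfg]
        exact eq_zero_of_notMem_ground hX hfG
      · exact lexCircuit_contract hX hZ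
      · have hneg : withSign (-X) g 0 = -withSign X g 0 := by
          rw [neg_withSign, neg_zero]
        have := lexCircuit_contract hX (by rwa [hneg, support_neg_sign])
        rw [hneg] at this
        simpa using F.neg_signed _ this
  · rintro ⟨hYg, hYf⟩
    rw [ofOrthogonalPair_isSignedCocircuit_iff] at hY
    rcases hY with hY | hY | hY
    · rw [hY.eq_zero hgF] at hYg
      exact absurd hYg (by decide)
    · exact (lexCocircuit_apply hY).2 hYf
    · have := (lexCocircuit_apply hY).1
      rw [Pi.neg_apply, hYg] at this
      exact absurd this (by decide)

end OrientedMatroid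

/-! ### Assembly of the theorem -/

theorem theorem1 {α : Type*} (M Mf Mg : OrientedMatroid α) (f g : α) (hfg : f ≠ g)
    (hf : M.IsGenericExtension f Mf) (hg : M.IsGenericLifting g Mg) :
    -- the map `B ↦ O(B)` is a bijection onto the compatible reorientations
    Set.BijOn (M.basisReorientation (M.extensionSignature f Mf) (M.liftingSignature g Mg))
      {B | M.IsBase B} (M.compatibleReorientations f Mf g Mg) ∧
    -- a compliant generic extension-lifting given by the two signatures exists
    (∃ N, OrientedMatroid.IsGenericExtensionLifting f Mf g Mg N ∧
      OrientedMatroid.Compliant f g N) ∧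
    -- for each of them and each ordering, the inverse bijection is given by fully optimal bases
    (∀ N, OrientedMatroid.IsGenericExtensionLifting f Mf g Mg N →
      OrientedMatroid.Compliant f g N →
      ∀ [LinearOrder α], g < f → (∀ e ∈ M.E, f < e) →
        (∀ A ∈ M.compatibleReorientations f Mf g Mg,
          ((N.reorient A).reorient {f, g}).Bounded ∧
          ∃! B, ((N.reorient A).reorient {f, g}).IsFullyOptimal B) ∧
        Set.BijOn (fun A => ((N.reorient A).reorient {f, g}).fullyOptimalBasis \ {g})
          (M.compatibleReorientations f Mf g Mg) {B | M.IsBase B} ∧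
        Set.InvOn (fun A => ((N.reorient A).reorient {f, g}).fullyOptimalBasis \ {g})
          (M.basisReorientation (M.extensionSignature f Mf) (M.liftingSignature g Mg))
          {B | M.IsBase B} (M.compatibleReorientations f Mf g Mg)) := by
  have hbij := OrientedMatroid.bijOn_basisReorientation hf hg
  refine ⟨hbij, OrientedMatroid.exists_compliant_extensionLifting hf hg hfg, ?_⟩
  intro N hN hcomp _ hgf hfE
  -- Uniqueness of the fully optimal basis is the injectivity of B ↦ O(B), and it makes the choice
  -- in `fullyOptimalBasis` harmless.
  have hopt : ∀ B, M.IsBase B → ∀ B', ((N.reorient (M.basisReorientation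
      (M.extensionSignature f Mf) (M.liftingSignature g Mg) B)).reorient {f, g}).IsFullyOptimal B' ↔
        B' = insert g B := by
    intro B hB B'
    rw [hN.isFullyOptimal_iff_basisReorientation_eq hf hg hcomp hfg
      (M.basisReorientation_subset _ _ B) hgf hfE]
    constructor
    · rintro ⟨B₁, hB₁, rfl, heq⟩
      rw [hbij.injOn hB₁ hB heq]
    · rintro rfl
      exact ⟨B, hB, rfl, rfl⟩
  have hleft : Set.LeftInvOn (fun A => ((N.reorient A).reorient {f, g}).fullyOptimalBasis \ {g})
      (M.basisReorientation (M.extensionSignature f Mf) (M.liftingSignature g Mg))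
      {B | M.IsBase B} := by
    intro B hB
    have hα := (hopt B hB _).1 (Classical.epsilon_spec ⟨_, (hopt B hB _).2 rfl⟩)
    change OrientedMatroid.fullyOptimalBasis _ \ {g} = B
    rw [show OrientedMatroid.fullyOptimalBasis _ = insert g B from hα]
    exact Set.insert_sdiff_self_of_notMem fun h => hg.notMem (hB.subset_ground h)
  have hinv : Set.InvOn (fun A => ((N.reorient A).reorient {f, g}).fullyOptimalBasis \ {g})
      (M.basisReorientation (M.extensionSignature f Mf) (M.liftingSignature g Mg))
      {B | M.IsBase B} (M.compatibleReorientations f Mf g Mg) := by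
    refine ⟨hleft, fun A hA => ?_⟩
    obtain ⟨B, hB, rfl⟩ := hbij.surjOn hA
    exact congrArg _ (hleft hB)
  refine ⟨fun A hA => ?_, (Set.bijOn_comm hinv.symm).1 hbij, hinv⟩
  obtain ⟨B, hB, rfl⟩ := hbij.surjOn hA
  refine ⟨?_, insert g B, (hopt B hB _).2 rfl, fun B' hB' => (hopt B hB B').1 hB'⟩
  obtain ⟨X, Y, hXY⟩ := OrientedMatroid.exists_isBasisSigning hf hg hB
  refine hN.bounded_of_basisSigning hf hg hcomp hfg (M.basisReorientation_subset _ _ B) ?_ hXY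
    ((hXY.basisReorientation_eq_iff hf hg (M.basisReorientation_subset _ _ B)).1 rfl)
  rw [hN.ground_eq hg]
  refine ⟨by simp, ?_⟩
  rintro e (rfl | rfl | he)
  exacts [hgf.le, le_rfl, (hgf.trans (hfE e he)).le]
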